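/- **Conventions.** A decision tree over $n$ Boolean variables has size equal to its number of leaves. For a distribution $\mathcal D$ on $\{0,1\}^n$, a tree $T$ is $\varepsilon$-close to $f$ under $\mathcal D$ if $\Pr_{x\sim\mathcal D}[T(x)\neq f(x)]\le\varepsilon$. Algorithms are programs for a randomized unit-cost RAM (registers and arrays of natural numbers; addition, truncated subtraction, tests for zero, indirect addressing, and drawing a uniformly random element of $\{0,\dots,y\}$ for a stored number $y$). An algorithm runs in time $\tau$ if on every input, and for all outcomes of its random choices and all oracle answers, it halts within $\tau$ steps. *DT-Learn$(s,s',\varepsilon)$.* Given $n$ and $s$, membership queries to an unknown $f:\{0,1\}^n\to\{0,1\}$, random samples $(x,f(x))$ with $x\sim\mathcal D$ for an unknown distribution $\mathcal D$ on $\{0,1\}^n$ (each oracle call costs one step), and the promise that $f$ is computed by a decision tree of size at most $s$, output with probability at least $2/3$ a decision tree of size at most $s'$ that is $\varepsilon$-close to $f$ under $\mathcal D$. *Vertex Cover can be $a$-approximated on degree-$d$ graphs in randomized time $O(\tau(n))$* if there are a randomized algorithm without oracle and a constant $K$ such that on every graph $G$ with $n\ge 1$ vertices and maximum degree at most $d$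 (given by its adjacency matrix) and every integer $k\ge 1$, the algorithm halts within $K\tau(n)$ steps, answers Yes with probability at least $2/3$ if $G$ has a vertex cover of size at most $k$, and answers No with probability at least $2/3$ if every vertex cover of $G$ has size at least $a\,k$. **Theorem (Reduction from Vertex Cover to DT-Learn).** For every $d\in\mathbb N$ there is a constant $c$ such that for all reals $\delta>0$, $\varepsilon\in(0,1)$ and $\delta'>(\delta+4\varepsilon)d+\delta$ there is a constant $C\in\mathbb N$ with the following property. Let $t(n,1/\varepsilon)$ be any time bound with $t(n,1/\varepsilon)\ge n$ for all $n$, and suppose that some algorithm running in time $t(n,1/\varepsilon)$ solves DT-Learn$(s,(1+\delta)s,\varepsilon)$ over $n$-variable functions for all $n\ge1$ and all $s\le c\,n$. Then Vertex Cover can be $(1+\delta')$-approximated on degree-$d$, $n$-vertex graphs in randomized time $$O\bigl(n^2\cdot t(Cn^2,1/\varepsilon)\bigr).$$ In particular, if in addition $t(an,1/\varepsilon)=O(t(n,1/\varepsilon))$ for every constant $a\in\mathbb N$, then this time is $O(n^2\cdot t(n^2,1/\varepsilon))$. -/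

import Mathlib

namespace DTLearning

/-! ### Decision trees -/

/-- Decision trees over `n` Boolean variables. -/
inductive DTree (n : ℕ) : Type
  | leaf (b : Bool) : DTree n
  | node (i : Fin n) (low high : DTree n) : DTree n

namespace DTree

/-- The function computed by a tree: `low` is followed if the queried bit is `0`, `high` if it
is `1`. -/
def eval {n : ℕ} : DTree n → (Fin n → Bool) → Bool
  | leaf b, _ => b
  | node i low high, x => if x i then high.eval x else low.eval x

/-- The size of a tree is its number of leaves. -/
def size {n : ℕ} : DTree n → ℕ
  | leaf _ => 1
  | node _ low high => low.size + high.size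

/-- The tree computes `f` on every input. -/
def Computes {n : ℕ} (T : DTree n) (f : (Fin n → Bool) → Bool) : Prop :=
  ∀ x, T.eval x = f x

/-- Preorder listing of a tree: a leaf is written as its label `0` or `1`, an internal node
querying variable `i` as `i + 2` followed by the listings of its two subtrees. -/
def listing {n : ℕ} : DTree n → List ℕ
  | leaf b => [b.toNat]
  | node i low high => ((i : ℕ) + 2) :: (low.listing ++ high.listing)

end DTree

/-- `error_D(g, f)`, the probability over `x ∼ D` that `g x ≠ f x`. -/
noncomputable def error {n : ℕ} (D : PMF (Fin n → Bool)) (g f : (Fin n → Bool) → Bool) : ENNReal :=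
  D.toOuterMeasure {x | g x ≠ f x}

/-! ### Randomized random access machines

Unit-cost RAM with finitely many (per program) registers and memory arrays, all holding natural
numbers, addition and truncated subtraction as arithmetic, and a random number instruction.
Programs are structured (`while`-programs); every executed instruction, every test of a
conditional or of a loop, and every oracle call is charged (at least) one step. -/

/-- Memory contents: registers, and arrays indexed by array name and address. -/
structure Mem where
  reg : ℕ → ℕ
  arr : ℕ → ℕ → ℕ

namespace Mem

/-- Write `v` to register `x`. -/
def setReg (m : Mem) (x v : ℕ) : Mem :=
  ⟨Function.update m.reg x v, m.arr⟩

/-- Write `v` to cell `i` of array `a`. -/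
def setCell (m : Mem) (a i v : ℕ) : Mem :=
  ⟨m.reg, Function.update m.arr a (Function.update (m.arr a) i v)⟩

/-- The bit string stored in cells `0, …, n - 1` of array `a` (a cell is read as `1` iff it is
nonzero). -/
def readBits (m : Mem) (n a : ℕ) : Fin n → Bool :=
  fun i => decide (m.arr a i ≠ 0)

/-- Write the bit string `v` to cells `0, …, n - 1` of array `a`. -/
def writeBits (m : Mem) {n : ℕ} (a : ℕ) (v : Fin n → Bool) : Mem :=
  ⟨m.reg, Function.update m.arr a
    (fun i => if h : i < n then (v ⟨i, h⟩).toNat else m.arr a i)⟩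

/-- The memory holds the tree `T` as an output: array `0` begins with the listing of `T`. -/
def HoldsTree {n : ℕ} (m : Mem) (T : DTree n) : Prop :=
  ∀ (i : ℕ) (h : i < T.listing.length), m.arr 0 i = T.listing[i]

end Mem

/-- Programs with oracle calls from `O`. -/
inductive Prog (O : Type) : Type
  | skip : Prog O
  /-- `x := c` for a constant `c` -/
  | const (x c : ℕ) : Prog O
  /-- `x := y + z` -/
  | add (x y z : ℕ) : Prog O
  /-- `x := y - z`, truncated at `0` -/
  | sub (x y z : ℕ) : Prog O
  /-- `x := a[y]` -/
  | load (x a y : ℕ) : Prog O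
  /-- `a[y] := x` -/
  | store (a y x : ℕ) : Prog O
  /-- `x :=` a uniformly random element of `{0, …, y}` -/
  | rand (x y : ℕ) : Prog O
  /-- an oracle call -/
  | call (o : O) : Prog O
  /-- sequential composition -/
  | seq (p q : Prog O) : Prog O
  /-- `if x ≠ 0 then p else q` -/
  | ite (x : ℕ) (p q : Prog O) : Prog O
  /-- `while x ≠ 0 do p` -/
  | loop (x : ℕ) (p : Prog O) : Prog O

/-- A configuration: the list of programs still to be executed, one after the other, and the
memory. The machine has halted when the list is empty. -/
abbrev Config (O : Type) : Type := List (Prog O) × Mem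

/-- One step of the machine, where `h` answers the oracle calls. -/
noncomputable def step {O : Type} (h : O → Mem → PMF Mem) : Config O → PMF (Config O)
  | ([], m) => PMF.pure ([], m)
  | (.skip :: k, m) => PMF.pure (k, m)
  | (.const x c :: k, m) => PMF.pure (k, m.setReg x c)
  | (.add x y z :: k, m) => PMF.pure (k, m.setReg x (m.reg y + m.reg z))
  | (.sub x y z :: k, m) => PMF.pure (k, m.setReg x (m.reg y - m.reg z))
  | (.load x a y :: k, m) => PMF.pure (k, m.setReg x (m.arr a (m.reg y)))
  | (.store a y x :: k, m) => PMF.pure (k, m.setCell a (m.reg y) (m.reg x))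
  | (.rand x y :: k, m) =>
      (PMF.uniformOfFintype (Fin (m.reg y + 1))).map (fun v => (k, m.setReg x (v : ℕ)))
  | (.call o :: k, m) => (h o m).map (fun m' => (k, m'))
  | (.seq p q :: k, m) => PMF.pure (p :: q :: k, m)
  | (.ite x p q :: k, m) => PMF.pure ((if m.reg x ≠ 0 then p else q) :: k, m)
  | (.loop x p :: k, m) =>
      PMF.pure (if m.reg x ≠ 0 then (p :: .loop x p :: k, m) else (k, m))

/-- The distribution of the configuration after `t` steps from a given configuration. -/
noncomputable def run {O : Type} (h : O → Mem → PMF Mem) : ℕ → Config O → PMF (Config O)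
  | 0, c => PMF.pure c
  | t + 1, c => (step h c).bind (run h t)

/-- Every possible outcome of the random experiment is a halted configuration. -/
def AlwaysHalted {O : Type} (μ : PMF (Config O)) : Prop :=
  ∀ c ∈ μ.support, c.1 = []

/-- The probability that the memory satisfies `P`. -/
noncomputable def probMem {O : Type} (μ : PMF (Config O)) (P : Mem → Prop) : ENNReal :=
  μ.toOuterMeasure {c | P c.2}

/-! ### The learning task -/

/-- The oracles of a learner with queries: `query a x` puts into register `x` the value `f(v)` at
the string `v` stored in array `a`; `sample a x` draws `v ∼ D`, writes `v` to array `a` and `f(v)`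
to register `x`. -/
inductive LearnerCall : Type
  | query (a x : ℕ) : LearnerCall
  | sample (a x : ℕ) : LearnerCall

/-- Answers to the oracle calls of a learner with target `f` and distribution `D`. -/
noncomputable def learnerOracle {n : ℕ} (f : (Fin n → Bool) → Bool) (D : PMF (Fin n → Bool)) :
    LearnerCall → Mem → PMF Mem
  | .query a x, m => PMF.pure (m.setReg x (f (m.readBits n a)).toNat)
  | .sample a x, m => D.map (fun v => (m.writeBits a v).setReg x (f v).toNat)

/-- Input of a learner: `n` in register `0`, `s` in register `1`, everything else `0`. -/
def learnerInput (n s : ℕ) : Mem where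
  reg := fun i => if i = 0 then n else if i = 1 then s else 0
  arr := fun _ _ => 0

/-- The program `p` solves DT-Learn`(s, (1 + δ) s, ε)` over `n`-variable functions, for all
`s ≤ c n`, in time `τ n`: it always halts within `τ n` steps, and if the target `f` is a size-`s`
decision tree then with probability at least `2/3` its output is a decision tree of size at most
`(1 + δ) s` that is `ε`-close to `f` under `D`. -/
def SolvesDTLearn (p : Prog LearnerCall) (c : ℕ) (δ ε : ℝ) (τ : ℕ → ℕ) : Prop :=
  ∀ n s : ℕ, 1 ≤ n → s ≤ c * n →
    ∀ (f : (Fin n → Bool) → Bool) (D : PMF (Fin n → Bool)),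
      AlwaysHalted (run (learnerOracle f D) (τ n) ([p], learnerInput n s)) ∧
      ((∃ T : DTree n, T.Computes f ∧ T.size ≤ s) →
        2 / 3 ≤ probMem (run (learnerOracle f D) (τ n) ([p], learnerInput n s))
          (fun m => ∃ T : DTree n, m.HoldsTree T ∧ (T.size : ℝ) ≤ (1 + δ) * s ∧
            error D T.eval f ≤ ENNReal.ofReal ε))

/-! ### Approximating Vertex Cover -/

/-- Programs without oracle. -/
def noOracle : Empty → Mem → PMF Mem := fun o => o.elim

open Classical in
/-- Input of an algorithm for Vertex Cover: `n` in register `0`, `k` in register `1`, the adjacency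
matrix of `G` in row-major order in array `0`, everything else `0`. -/
noncomputable def vertexCoverInput {n : ℕ} (G : SimpleGraph (Fin n)) (k : ℕ) : Mem where
  reg := fun i => if i = 0 then n else if i = 1 then k else 0
  arr := fun a j =>
    if a = 0 ∧ ∃ u v : Fin n, j = (u : ℕ) * n + (v : ℕ) ∧ G.Adj u v then 1 else 0

/-- Vertex Cover can be `a`-approximated on `n`-vertex graphs of maximum degree at most `d` in
randomized time `O(τ n)`: some program halts within `K · τ n` steps on every input, says Yes
(`1` in register `0`) with probability at least `2/3` if `G` has a vertex cover of size at most
`k`, and No (`0` in register `0`) with probability at least `2/3` if every vertex cover of `G` has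
size at least `a k`. -/
def ApproximatesVertexCover (d : ℕ) (a : ℝ) (τ : ℕ → ℕ) : Prop :=
  ∃ (p : Prog Empty) (K : ℕ), ∀ n : ℕ, 1 ≤ n → ∀ G : SimpleGraph (Fin n),
    (∀ v, (G.neighborSet v).ncard ≤ d) → ∀ k : ℕ, 1 ≤ k →
      AlwaysHalted (run noOracle (K * τ n) ([p], vertexCoverInput G k)) ∧
      ((∃ S : Finset (Fin n), G.IsVertexCover (S : Set (Fin n)) ∧ S.card ≤ k) →
        2 / 3 ≤ probMem (run noOracle (K * τ n) ([p], vertexCoverInput G k))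
          (fun m => m.reg 0 = 1)) ∧
      ((∀ S : Finset (Fin n), G.IsVertexCover (S : Set (Fin n)) → a * k ≤ (S.card : ℝ)) →
        2 / 3 ≤ probMem (run noOracle (K * τ n) ([p], vertexCoverInput G k))
          (fun m => m.reg 0 = 0))

end DTLearning

/-! Let the graph have `k` edges and take `l = C n` layers of `n` variables: variable `j` stands for
the vertex `j % n` in layer `j / n`. The target accepts a string if, for some edge, both endpoints
are `1` in every layer and layer `0` has no other ones. The distribution is uniform on `4 l k`
points: for every edge and layer, the indicator of the edge (repeated in all layers) occurs twice,
and each of the two endpoints is erased once in that layer. The target accepts the former points and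
rejects the latter.

Upper bound (`exists_tree_of_cover`): given a vertex cover of size at most `κ`, a tree queries the
cover vertices in layer `0`. At the first `1`, at `w` say, it verifies the other layers of `w` and
then tries the edges at `w` one by one. Its size is at most `s = κ l + k (l + n) + 1`.

Lower bound (`size_add_errors_ge`): in a fixed layer, a tree that errs nowhere notices both erasures
of every edge. By `exists_cover_of_notices` it then has at least (size of some cover) `+ k` nodes in
that layer, and `le_nodesAt_add_errors` trades missing nodes for errors. If all covers have at least
`v` elements, summation over the layers gives `l (v + k) + 1 ≤ |T| + W`, where `W` counts the errors
among the sample points.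

The algorithm simulates the learner with size bound `s` and answers Yes if the output is a tree with
`q |T| ≤ D s` and `q W ≤ 4 E l k`, where `D / q` and `E / q` approximate `1 + δ` and `ε` from above.
If a cover of size `κ` exists, every successful output passes. If any tree passes, the two bounds
and `k ≤ d κ` give `v ≤ (1 + δ + (δ + 4 ε) d + η) κ` with `η` small for large `q` and `C`, hence `v
< (1 + δ') κ` (`cover_lt_of_small`). Having many layers is what makes the `n k` term of `s`
negligible. So in the No case the answer is never wrong.

Time: an oracle call is simulated in `O(k (n + l)) = O(n²)` steps (`simulate_good`). The final check
evaluates `O(n²)` points at cost `O(n²)` each, and `n⁴ ≤ n² t(C n²)` because `t(m) ≥ m`.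
Deterministic code is verified with timed Hoare triples `Tri` and frame conditions, and `Good`
carries the results over to randomized runs. -/

namespace DTLearning

/-! ### Size of trees that recognize edges -/

namespace DTree

/-- The number of internal nodes that query a variable of layer `i`. -/
def nodesAt {N : ℕ} (lay : Fin N → ℕ) (i : ℕ) : DTree N → ℕ
  | leaf _ => 0
  | node j low high => (if lay j = i then 1 else 0) + low.nodesAt lay i + high.nodesAt lay i

/-- The vertices whose layer `i` variable is queried somewhere in the tree. -/
def vertsAt {N : ℕ} (vert lay : Fin N → ℕ) (i : ℕ) : DTree N → Finset ℕ
  | leaf _ => ∅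
  | node j low high =>
      (if lay j = i then {vert j} else ∅) ∪ low.vertsAt vert lay i ∪ high.vertsAt vert lay i

theorem card_vertsAt_le {N : ℕ} (vert lay : Fin N → ℕ) (i : ℕ) (T : DTree N) :
    (T.vertsAt vert lay i).card ≤ T.nodesAt lay i := by
  induction T with
  | leaf b => simp [vertsAt]
  | node j low high h1 h2 =>
    simp only [vertsAt, nodesAt]
    refine (Finset.card_union_le _ _).trans (Nat.add_le_add ?_ h2)
    refine (Finset.card_union_le _ _).trans (Nat.add_le_add ?_ h1)
    split <;> simp

/-- A binary tree has one more leaf than internal nodes, and each internal node is counted in at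
most one layer. -/
theorem sum_nodesAt_lt_size {N : ℕ} (lay : Fin N → ℕ) (l : ℕ) (T : DTree N) :
    ∑ i ∈ Finset.range l, T.nodesAt lay i + 1 ≤ T.size := by
  induction T with
  | leaf b => simp [nodesAt, size]
  | node j low high h1 h2 =>
    simp only [nodesAt, size, Finset.sum_add_distrib]
    have : ∑ i ∈ Finset.range l, (if lay j = i then 1 else 0) ≤ 1 := by
      rw [Finset.sum_ite_eq]; split <;> simp
    omega

end DTree

/-- The bit string with ones exactly at the variables of the two endpoints of `e`, except that
the variable of `w` in layer `i` is `0`. -/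
def flipPoint {N : ℕ} (vert lay : Fin N → ℕ) (e : ℕ × ℕ) (i w : ℕ) : Fin N → Bool :=
  fun j => decide ((vert j = e.1 ∨ vert j = e.2) ∧ ¬ (lay j = i ∧ vert j = w))

/-- The bit string with ones exactly at the variables of the two endpoints of `e`. -/
def edgePoint {N : ℕ} (vert : Fin N → ℕ) (e : ℕ × ℕ) : Fin N → Bool :=
  fun j => decide (vert j = e.1 ∨ vert j = e.2)

/-- The tree notices that the variable of `w` in layer `i` is flipped. -/
def Notices {N : ℕ} (vert lay : Fin N → ℕ) (i : ℕ) (T : DTree N) (e : ℕ × ℕ) (w : ℕ) : Prop :=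
  T.eval (edgePoint vert e) ≠ T.eval (flipPoint vert lay e i w)

section Lower

variable {N : ℕ} {vert lay : Fin N → ℕ}

theorem notices_node {i w : ℕ} {e : ℕ × ℕ} {j : Fin N} {low high : DTree N}
    (hj : ¬ (lay j = i ∧ vert j = w)) :
    Notices vert lay i (.node j low high) e w ↔
      Notices vert lay i (if edgePoint vert e j then high else low) e w := by
  have : flipPoint vert lay e i w j = edgePoint vert e j := by
    simp [flipPoint, edgePoint, hj]
  simp only [Notices, DTree.eval, this]
  split <;> simp

theorem notices_low {i w : ℕ} {e : ℕ × ℕ} {j : Fin N} {low high : DTree N}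
    (hj : ¬ (vert j = e.1 ∨ vert j = e.2)) :
    Notices vert lay i (.node j low high) e w ↔ Notices vert lay i low e w := by
  simp [Notices, DTree.eval, flipPoint, edgePoint, hj]

/-- The two points differ only in the layer `i` variables of `w`, so their paths separate only at a
query of such a variable. -/
theorem Notices.mem_vertsAt {i w : ℕ} {e : ℕ × ℕ} {T : DTree N}
    (h : Notices vert lay i T e w) : w ∈ T.vertsAt vert lay i := by
  induction T with
  | leaf b => simp [Notices, DTree.eval] at h
  | node j low high h1 h2 =>
    simp only [DTree.vertsAt, Finset.mem_union]
    by_cases hj : lay j = i ∧ vert j = w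
    · simp [hj.1, hj.2]
    · rw [notices_node hj] at h
      split at h
      · exact Or.inr (h2 h)
      · exact Or.inl (Or.inr (h1 h))

open Classical in
-- Induction on the tree. If the root queries `w` in layer `i`, then `w` joins the cover and the low
-- subtree deals with the edges that avoid `w`. An edge at `w` with both erasures noticed is charged
-- to the high subtree, which must query its other endpoint in layer `i`; different edges at `w`
-- have different other endpoints. A query in another layer merely distributes the edges over the
-- two subtrees.
theorem exists_cover_of_notices (i : ℕ) (T : DTree N) (E : Finset (ℕ × ℕ))
    (hE : ∀ e ∈ E, e.1 < e.2) :
    ∃ S : Finset ℕ,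
      S.card + (E.filter (fun e => Notices vert lay i T e e.1 ∧ Notices vert lay i T e e.2)).card
        ≤ T.nodesAt lay i ∧
      ∀ e ∈ E, (Notices vert lay i T e e.1 ∨ Notices vert lay i T e e.2) → e.1 ∈ S ∨ e.2 ∈ S := by
  induction T generalizing E with
  | leaf b => exact ⟨∅, by simp [Notices, DTree.eval]⟩
  | node j low high h1 h2 =>
    set E1 := E.filter (fun e => vert j = e.1 ∨ vert j = e.2) with hE1
    set E0 := E.filter (fun e => ¬ (vert j = e.1 ∨ vert j = e.2)) with hE0
    have hsplit : ∀ (P : ℕ × ℕ → Prop) [DecidablePred P],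
        (E.filter P).card = (E1.filter P).card + (E0.filter P).card := by
      intro P _
      rw [← Finset.card_union_of_disjoint]
      · congr 1
        ext e
        simp only [hE1, hE0, Finset.mem_union, Finset.mem_filter]
        tauto
      · exact Finset.disjoint_filter_filter (Finset.disjoint_filter_filter_not _ _ _)
    obtain ⟨S0, hS0, hc0⟩ := h1 E0 (fun e he => hE e (Finset.filter_subset _ _ he))
    have hl0 : ∀ e ∈ E0, ∀ w, Notices vert lay i (.node j low high) e w ↔
        Notices vert lay i low e w := fun e he w => notices_low (Finset.mem_filter.1 he).2
    have hf0 : E0.filter (fun e => Notices vert lay i (.node j low high) e e.1 ∧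
        Notices vert lay i (.node j low high) e e.2) =
        E0.filter (fun e => Notices vert lay i low e e.1 ∧ Notices vert lay i low e e.2) :=
      Finset.filter_congr (fun e he => by rw [hl0 e he, hl0 e he])
    rw [hsplit, hf0]
    by_cases hj : lay j = i
    -- The root pays for the new cover vertex, the high subtree for the doubly noticed edges at it,
    -- the low subtree for all the rest.
    · refine ⟨insert (vert j) S0, ?_, ?_⟩
      · have hcard : (E1.filter (fun e => Notices vert lay i (.node j low high) e e.1 ∧
            Notices vert lay i (.node j low high) e e.2)).card ≤
            (high.vertsAt vert lay i).card := by
          refine Finset.card_le_card_of_injOn (fun e => if vert j = e.1 then e.2 else e.1) ?_ ?_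
          · intro e he
            have he' := Finset.mem_filter.1 he
            have he1 := (Finset.mem_filter.1 he'.1).2
            have hlt := hE e (Finset.mem_filter.1 he'.1).1
            have hp : edgePoint vert e j = true := by simpa [edgePoint] using he1
            dsimp only
            split
            · rename_i h
              have := he'.2.2
              rw [notices_node (by omega), hp] at this
              exact this.mem_vertsAt
            · rename_i h
              have := he'.2.1
              rw [notices_node (by omega), hp] at this
              exact this.mem_vertsAt
          · intro e he e' he' heq
            have h1 := Finset.mem_filter.1 (Finset.mem_filter.1 he).1
            have h2 := Finset.mem_filter.1 (Finset.mem_filter.1 he').1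
            have hlt := hE e h1.1
            have hlt' := hE e' h2.1
            have h3 := h1.2
            have h4 := h2.2
            dsimp only at heq
            ext <;> split at heq <;> split at heq <;> omega
        have := Finset.card_insert_le (vert j) S0
        have := high.card_vertsAt_le vert lay i
        simp only [DTree.nodesAt, if_pos hj]
        omega
      · intro e he h
        by_cases hv : vert j = e.1 ∨ vert j = e.2
        · rcases hv with hv | hv <;> simp [hv]
        · have he0 : e ∈ E0 := Finset.mem_filter.2 ⟨he, hv⟩
          rw [hl0 e he0, hl0 e he0] at h
          rcases hc0 e he0 h with h | h <;> simp [h]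
    · obtain ⟨S1, hS1, hc1⟩ := h2 E1 (fun e he => hE e (Finset.filter_subset _ _ he))
      have hl1 : ∀ e ∈ E1, ∀ w, Notices vert lay i (.node j low high) e w ↔
          Notices vert lay i high e w := by
        intro e he w
        have hp : edgePoint vert e j = true := by
          simpa [edgePoint] using (Finset.mem_filter.1 he).2
        rw [notices_node (fun h => hj h.1), hp]; rfl
      have hf1 : E1.filter (fun e => Notices vert lay i (.node j low high) e e.1 ∧
          Notices vert lay i (.node j low high) e e.2) =
          E1.filter (fun e => Notices vert lay i high e e.1 ∧ Notices vert lay i high e e.2) :=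
        Finset.filter_congr (fun e he => by rw [hl1 e he, hl1 e he])
      rw [hf1]
      refine ⟨S1 ∪ S0, ?_, ?_⟩
      · have := Finset.card_union_le S1 S0
        simp only [DTree.nodesAt, if_neg hj]
        omega
      · intro e he h
        by_cases hv : vert j = e.1 ∨ vert j = e.2
        · have he1 : e ∈ E1 := Finset.mem_filter.2 ⟨he, hv⟩
          rw [hl1 e he1, hl1 e he1] at h
          rcases hc1 e he1 h with h | h <;> simp [h]
        · have he0 : e ∈ E0 := Finset.mem_filter.2 ⟨he, hv⟩
          rw [hl0 e he0, hl0 e he0] at h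
          rcases hc0 e he0 h with h | h <;> simp [h]

/-- The sample points of an edge and a layer: two copies of the edge indicator, and the two
strings obtained from it by deleting an endpoint in that layer. -/
def samplePoint {N : ℕ} (vert lay : Fin N → ℕ) (e : ℕ × ℕ) (i b : ℕ) : Fin N → Bool :=
  fun j => decide ((vert j = e.1 ∨ vert j = e.2) ∧ ¬ (b = 2 ∧ lay j = i ∧ vert j = e.1) ∧
    ¬ (b = 3 ∧ lay j = i ∧ vert j = e.2))

/-- If the vertex covers of `E` have at least `v` elements, then a tree makes errors or queries
many variables of layer `i`. -/
theorem le_nodesAt_add_errors (i : ℕ) (T : DTree N) (E : Finset (ℕ × ℕ))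
    (hE : ∀ e ∈ E, e.1 < e.2) (f : (Fin N → Bool) → Bool)
    (hf1 : ∀ e ∈ E, ∀ b < 2, f (samplePoint vert lay e i b) = true)
    (hf0 : ∀ e ∈ E, ∀ b, b = 2 ∨ b = 3 → f (samplePoint vert lay e i b) = false) (v : ℕ)
    (hv : ∀ S : Finset ℕ, (∀ e ∈ E, e.1 ∈ S ∨ e.2 ∈ S) → v ≤ S.card) :
    v + E.card ≤ T.nodesAt lay i + ∑ e ∈ E, ((Finset.range 4).filter
      (fun b => T.eval (samplePoint vert lay e i b) ≠ f (samplePoint vert lay e i b))).card := by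
  classical
  obtain ⟨S, hS, hc⟩ := exists_cover_of_notices (vert := vert) (lay := lay) i T E hE
  set L : ℕ × ℕ → ℕ := fun e => ((Finset.range 4).filter
      (fun b => T.eval (samplePoint vert lay e i b) ≠ f (samplePoint vert lay e i b))).card with hL
  have hs0 : ∀ e, samplePoint vert lay e i 0 = edgePoint vert e := by
    intro e; ext j; simp [samplePoint, edgePoint]
  have hs1 : ∀ e, samplePoint vert lay e i 1 = edgePoint vert e := by
    intro e; ext j; simp [samplePoint, edgePoint]
  have hs2 : ∀ e, samplePoint vert lay e i 2 = flipPoint vert lay e i e.1 := by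
    intro e; ext j; simp [samplePoint, flipPoint]
  have hs3 : ∀ e, samplePoint vert lay e i 3 = flipPoint vert lay e i e.2 := by
    intro e; ext j; simp [samplePoint, flipPoint]
  -- An error at the edge indicator counts twice. With at most one error the indicator is therefore
  -- accepted, and at most one of the erasures is missed.
  have hkey : ∀ e ∈ E,
      (L e = 0 → Notices vert lay i T e e.1 ∧ Notices vert lay i T e e.2) ∧
      (L e ≤ 1 → Notices vert lay i T e e.1 ∨ Notices vert lay i T e e.2) := by
    intro e he
    have g0 := hf1 e he 0 (by norm_num)
    have g1 := hf1 e he 1 (by norm_num)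
    have g2 := hf0 e he 2 (by norm_num)
    have g3 := hf0 e he 3 (by norm_num)
    have hLe : L e = (if T.eval (edgePoint vert e) ≠ true then 1 else 0) +
        (if T.eval (edgePoint vert e) ≠ true then 1 else 0) +
        (if T.eval (flipPoint vert lay e i e.1) ≠ false then 1 else 0) +
        (if T.eval (flipPoint vert lay e i e.2) ≠ false then 1 else 0) := by
      simp only [hL, Finset.card_filter, Finset.sum_range_succ, Finset.sum_range_zero, zero_add,
        g0, g1, g2, g3]
      simp only [hs0, hs1, hs2, hs3]
    rw [hLe]
    unfold Notices
    cases T.eval (edgePoint vert e) <;> cases T.eval (flipPoint vert lay e i e.1) <;>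
      cases T.eval (flipPoint vert lay e i e.2) <;> simp
  -- Edges with at least two errors need not be covered by `S`; their first endpoints are added.
  have hcov := hv (S ∪ (E.filter (fun e => 2 ≤ L e)).image Prod.fst) (by
    intro e he
    by_cases h : 2 ≤ L e
    · left
      exact Finset.mem_union_right _ (Finset.mem_image_of_mem _ (Finset.mem_filter.2 ⟨he, h⟩))
    · rcases hc e he ((hkey e he).2 (by omega)) with h | h <;> simp [h])
  have h1 := Finset.card_union_le S ((E.filter (fun e => 2 ≤ L e)).image Prod.fst)
  have h2 := Finset.card_image_le (s := E.filter (fun e => 2 ≤ L e)) (f := Prod.fst)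
  have h3 := Finset.card_filter_add_card_filter_not (s := E)
    (fun e => Notices vert lay i T e e.1 ∧ Notices vert lay i T e e.2)
  -- An edge pays one error for not being doubly noticed, and a second one for the vertex added to
  -- the cover on its behalf.
  have h4 : (E.filter (fun e => ¬ (Notices vert lay i T e e.1 ∧
      Notices vert lay i T e e.2))).card + (E.filter (fun e => 2 ≤ L e)).card ≤ ∑ e ∈ E, L e := by
    rw [Finset.card_filter, Finset.card_filter, ← Finset.sum_add_distrib]
    refine Finset.sum_le_sum (fun e he => ?_)
    have := (hkey e he).1
    by_cases ha : Notices vert lay i T e e.1 ∧ Notices vert lay i T e e.2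
    · rw [if_neg (not_not.2 ha)]
      split_ifs <;> omega
    · have : L e ≠ 0 := fun h => ha (this h)
      rw [if_pos ha]
      split_ifs <;> omega
  change v + E.card ≤ T.nodesAt lay i + ∑ e ∈ E, L e
  omega

end Lower

/-! ### Small trees from vertex covers -/

/-- Some tree of size at most `s` agrees with `f` on `A`. -/
def HasTreeOn {N : ℕ} (A : Set (Fin N → Bool)) (f : (Fin N → Bool) → Bool) (s : ℕ) : Prop :=
  ∃ T : DTree N, T.size ≤ s ∧ ∀ x ∈ A, T.eval x = f x

namespace HasTreeOn

variable {N : ℕ} {A : Set (Fin N → Bool)} {f : (Fin N → Bool) → Bool}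

theorem mono {s s' : ℕ} {A' : Set (Fin N → Bool)} (h : HasTreeOn A' f s) (hA : A ⊆ A')
    (hs : s ≤ s') : HasTreeOn A f s' :=
  let ⟨T, h1, h2⟩ := h
  ⟨T, h1.trans hs, fun x hx => h2 x (hA hx)⟩

theorem const (b : Bool) (h : ∀ x ∈ A, f x = b) : HasTreeOn A f 1 :=
  ⟨.leaf b, le_rfl, fun x hx => (h x hx).symm⟩

theorem node (j : Fin N) {s0 s1 : ℕ} (h1 : HasTreeOn {x ∈ A | x j = true} f s1)
    (h0 : HasTreeOn {x ∈ A | x j = false} f s0) : HasTreeOn A f (s0 + s1) := by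
  obtain ⟨T1, a1, b1⟩ := h1
  obtain ⟨T0, a0, b0⟩ := h0
  refine ⟨.node j T0 T1, by simp only [DTree.size]; omega, fun x hx => ?_⟩
  simp only [DTree.eval]
  split
  · rename_i h; exact b1 x ⟨hx, h⟩
  · rename_i h; exact b0 x ⟨hx, by simpa using h⟩

/-- Read the variables in `J`, answering `0` as soon as one of them is not `b`. -/
theorem conj (b : Bool) (J : Finset (Fin N)) {s : ℕ}
    (h : HasTreeOn {x ∈ A | ∀ j ∈ J, x j = b} f s)
    (h0 : ∀ x ∈ A, ∀ j ∈ J, x j ≠ b → f x = false) : HasTreeOn A f (s + J.card) := by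
  classical
  induction J using Finset.induction_on generalizing A with
  | empty => exact h.mono (by simp) le_rfl
  | insert j J hj ih =>
    have hr : HasTreeOn {x ∈ A | x j = b} f (s + J.card) := by
      refine ih (h.mono ?_ le_rfl) ?_
      · rintro x ⟨⟨hx, hxj⟩, hxJ⟩
        exact ⟨hx, by simpa [hxj] using hxJ⟩
      · rintro x ⟨hx, _⟩ j' hj'
        exact h0 x hx j' (Finset.mem_insert_of_mem hj')
    have hl : HasTreeOn {x ∈ A | x j = !b} f 1 :=
      const false (fun x hx => h0 x hx.1 j (Finset.mem_insert_self _ _) (by simp [hx.2]))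
    rw [Finset.card_insert_of_notMem hj, ← add_assoc]
    cases b
    · exact node j hl hr
    · exact (node j hr hl).mono subset_rfl (by omega)

end HasTreeOn

/-- The edge recognition function: the layer `0` string is the indicator of an edge in `E`, and
the variables of its endpoints are `1` in all layers. -/
def IsEdge {N : ℕ} (vert lay : Fin N → ℕ) (E : Finset (ℕ × ℕ)) (x : Fin N → Bool) : Prop :=
  ∃ e ∈ E, (∀ j, vert j = e.1 ∨ vert j = e.2 → x j = true) ∧
    ∀ j, lay j = 0 → x j = true → vert j = e.1 ∨ vert j = e.2

section Upper

variable {N : ℕ} {vert lay : Fin N → ℕ} {n l : ℕ} {f : (Fin N → Bool) → Bool}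

/-- Once the first endpoint is known, the edges at it are searched one by one. -/
theorem hasTreeOn_star (E F : Finset (ℕ × ℕ)) (w : ℕ) (A : Set (Fin N → Bool))
    (hinj : ∀ j j', lay j = lay j' → vert j = vert j' → j = j')
    (h0 : ∀ u < n, ∃ j, vert j = u ∧ lay j = 0)
    (hlay : ∀ j, lay j < l) (hvert : ∀ j, vert j < n)
    (hE : ∀ e ∈ E, e.1 < e.2 ∧ e.2 < n) (hf : ∀ x, f x = true ↔ IsEdge vert lay E x)
    (hF : ∀ e ∈ F, e ∈ E ∧ (e.1 = w ∨ e.2 = w))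
    (hw : ∀ x ∈ A, ∀ j, vert j = w → x j = true)
    (hA : ∀ x ∈ A, f x = true → ∃ e ∈ F, (∀ j, vert j = e.1 ∨ vert j = e.2 → x j = true) ∧
      ∀ j, lay j = 0 → x j = true → vert j = e.1 ∨ vert j = e.2) :
    HasTreeOn A f (F.card * (l + n) + 1) := by
  classical
  have hlcard : ∀ (P : Fin N → Prop) [DecidablePred P], (∀ j, P j → ∀ j', P j' → vert j = vert j') →
      (Finset.univ.filter P).card ≤ l := by
    intro P _ hP
    rw [← Finset.card_range l]
    refine Finset.card_le_card_of_injOn lay (fun j _ => by simpa using hlay j) ?_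
    intro j hj j' hj' h
    exact hinj j j' h (hP _ (by simpa using hj) _ (by simpa using hj'))
  have hncard : (Finset.univ.filter (fun j => lay j = 0)).card ≤ n := by
    rw [← Finset.card_range n]
    refine Finset.card_le_card_of_injOn vert (fun j _ => by simpa using hvert j) ?_
    intro j hj j' hj' h
    refine hinj j j' ?_ h
    have h1 : lay j = 0 := by simpa using hj
    have h2 : lay j' = 0 := by simpa using hj'
    rw [h1, h2]
  -- `A` shrinks to the inputs that reach the current node, and `hA` records that only the edges
  -- left in `F` can still witness acceptance.
  induction F using Finset.induction_on generalizing A with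
  | empty =>
    refine (HasTreeOn.const false ?_).mono subset_rfl (by omega)
    intro x hx
    by_contra h
    obtain ⟨e, he, _⟩ := hA x hx (by simpa using h)
    simp at he
  | insert e F heF ih =>
    obtain ⟨heE, hew⟩ := hF e (Finset.mem_insert_self _ _)
    obtain ⟨hlt, hltn⟩ := hE e heE
    set u := if e.1 = w then e.2 else e.1 with hu
    have huw : u ≠ w := by rw [hu]; split <;> omega
    have hun : u < n := by rw [hu]; split <;> omega
    have huvw : ∀ a, (a = e.1 ∨ a = e.2) ↔ (a = w ∨ a = u) := by
      intro a; rw [hu]; split <;> omega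
    obtain ⟨j0, hj0, hl0⟩ := h0 u hun
    have hother : ∀ e' ∈ F, u ≠ e'.1 ∧ u ≠ e'.2 := by
      intro e' he'
      obtain ⟨h1, h2⟩ := hF e' (Finset.mem_insert_of_mem he')
      have h3 := hE e' h1
      have h4 : e ≠ e' := fun h => heF (h ▸ he')
      by_contra h5
      apply h4
      ext <;> (rw [hu] at h5 huw; split at h5 <;> omega)
    rw [Finset.card_insert_of_notMem heF]
    have hlow : HasTreeOn {x ∈ A | x j0 = false} f (F.card * (l + n) + 1) := by
      refine ih _ (fun e' he' => hF e' (Finset.mem_insert_of_mem he'))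
        (fun x hx => hw x hx.1) (fun x hx hfx => ?_)
      obtain ⟨e', he', h1, h2⟩ := hA x hx.1 hfx
      rcases Finset.mem_insert.1 he' with rfl | he'
      · have := h1 j0 ((huvw _).2 (Or.inr hj0))
        rw [hx.2] at this; simp at this
      · exact ⟨e', he', h1, h2⟩
    -- Once the layer `0` bit of `u` is `1`, only `e` remains possible. The other layers of `u` must
    -- be `1` and the rest of layer `0` must be `0`; each of these tests adds one rejecting leaf.
    have hhigh : HasTreeOn {x ∈ A | x j0 = true} f (1 +
        (Finset.univ.filter (fun j => lay j = 0 ∧ vert j ≠ u ∧ vert j ≠ w)).card +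
        (Finset.univ.filter (fun j => vert j = u ∧ lay j ≠ 0)).card) := by
      have hcase : ∀ x ∈ A, x j0 = true → f x = true →
          (∀ j, vert j = e.1 ∨ vert j = e.2 → x j = true) ∧
          ∀ j, lay j = 0 → x j = true → vert j = e.1 ∨ vert j = e.2 := by
        intro x hx hxj hfx
        obtain ⟨e', he', h1, h2⟩ := hA x hx hfx
        rcases Finset.mem_insert.1 he' with rfl | he'
        · exact ⟨h1, h2⟩
        · have := h2 j0 hl0 hxj
          have := hother e' he'
          omega
      refine HasTreeOn.conj true _ (HasTreeOn.conj false _ (HasTreeOn.const true ?_) ?_) ?_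
      · rintro x ⟨⟨⟨hx, hxj⟩, hx1⟩, hx2⟩
        rw [hf]
        refine ⟨e, heE, fun j hj => ?_, fun j hj hxj' => ?_⟩
        · rcases (huvw _).1 hj with hj | hj
          · exact hw x hx j hj
          · by_cases h : lay j = 0
            · rw [hinj j j0 (by omega) (by omega)]; exact hxj
            · exact hx1 j (by simp [hj, h])
        · rw [huvw]
          by_contra h
          push Not at h
          have := hx2 j (by simp [hj, h])
          rw [this] at hxj'; simp at hxj'
      · rintro x ⟨⟨hx, hxj⟩, _⟩ j hj hne
        by_contra h
        obtain ⟨h1, h2⟩ := hcase x hx hxj (by simpa using h)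
        simp only [Finset.mem_filter, Finset.mem_univ, true_and] at hj
        have := (huvw _).1 (h2 j hj.1 (by simpa using hne))
        omega
      · rintro x ⟨hx, hxj⟩ j hj hne
        by_contra h
        obtain ⟨h1, h2⟩ := hcase x hx hxj (by simpa using h)
        simp only [Finset.mem_filter, Finset.mem_univ, true_and] at hj
        exact hne (h1 j ((huvw _).2 (Or.inr hj.1)))
    have hc1 : (Finset.univ.filter (fun j => vert j = u ∧ lay j ≠ 0)).card + 1 ≤ l := by
      have h1 : (Finset.univ.filter (fun j => vert j = u)).card ≤ l :=
        hlcard (fun j => vert j = u) (fun j hj j' hj' => Eq.trans hj (Eq.symm hj'))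
      refine le_trans (Finset.card_lt_card ?_) h1
      refine Finset.ssubset_iff_of_subset ?_ |>.2 ⟨j0, by simp [hj0], by simp [hl0]⟩
      intro j; simp only [Finset.mem_filter, Finset.mem_univ, true_and]; exact fun h => h.1
    have hc2 : (Finset.univ.filter (fun j => lay j = 0 ∧ vert j ≠ u ∧ vert j ≠ w)).card ≤ n := by
      refine le_trans (Finset.card_le_card ?_) hncard
      intro j; simp only [Finset.mem_filter, Finset.mem_univ, true_and]; exact fun h => h.1
    refine (HasTreeOn.node j0 hhigh hlow).mono subset_rfl ?_
    rw [Nat.add_mul]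
    omega

/-- A vertex cover of size `k` yields a tree of size `k l + |E| (l + n) + 1`. -/
theorem hasTreeOn_of_cover (E F : Finset (ℕ × ℕ)) (S : Finset ℕ) (A : Set (Fin N → Bool))
    (hinj : ∀ j j', lay j = lay j' → vert j = vert j' → j = j')
    (h0 : ∀ u < n, ∃ j, vert j = u ∧ lay j = 0)
    (hlay : ∀ j, lay j < l) (hvert : ∀ j, vert j < n)
    (hE : ∀ e ∈ E, e.1 < e.2 ∧ e.2 < n) (hf : ∀ x, f x = true ↔ IsEdge vert lay E x)
    (hF : F ⊆ E) (hS : ∀ e ∈ F, e.1 ∈ S ∨ e.2 ∈ S) (hSn : ∀ u ∈ S, u < n)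
    (hA : ∀ x ∈ A, f x = true → ∃ e ∈ F, (∀ j, vert j = e.1 ∨ vert j = e.2 → x j = true) ∧
      ∀ j, lay j = 0 → x j = true → vert j = e.1 ∨ vert j = e.2) :
    HasTreeOn A f (S.card * l + F.card * (l + n) + 1) := by
  classical
  induction S using Finset.induction_on generalizing A F with
  | empty =>
    refine (HasTreeOn.const false ?_).mono subset_rfl (by omega)
    intro x hx
    by_contra h
    obtain ⟨e, he, _⟩ := hA x hx (by simpa using h)
    simpa using hS e he
  | insert w S hwS ih =>
    obtain ⟨j0, hj0, hl0⟩ := h0 w (hSn w (Finset.mem_insert_self _ _))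
    set F1 := F.filter (fun e => e.1 = w ∨ e.2 = w) with hF1
    set F0 := F.filter (fun e => ¬ (e.1 = w ∨ e.2 = w)) with hF0
    have hlow : HasTreeOn {x ∈ A | x j0 = false} f (S.card * l + F0.card * (l + n) + 1) := by
      refine ih F0 _ ((Finset.filter_subset _ _).trans hF) ?_
        (fun u hu => hSn u (Finset.mem_insert_of_mem hu)) ?_
      · intro e he
        obtain ⟨h1, h2⟩ := Finset.mem_filter.1 he
        have := hS e h1
        simp only [Finset.mem_insert] at this
        tauto
      · intro x hx hfx
        obtain ⟨e, he, h1, h2⟩ := hA x hx.1 hfx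
        refine ⟨e, Finset.mem_filter.2 ⟨he, fun h => ?_⟩, h1, h2⟩
        have := h1 j0 (by omega)
        rw [hx.2] at this; simp at this
    have hhigh : HasTreeOn {x ∈ A | x j0 = true} f (F1.card * (l + n) + 1 +
        (Finset.univ.filter (fun j => vert j = w ∧ lay j ≠ 0)).card) := by
      have hcase : ∀ x ∈ A, x j0 = true → f x = true →
          ∃ e ∈ F1, (∀ j, vert j = e.1 ∨ vert j = e.2 → x j = true) ∧
          ∀ j, lay j = 0 → x j = true → vert j = e.1 ∨ vert j = e.2 := by
        intro x hx hxj hfx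
        obtain ⟨e, he, h1, h2⟩ := hA x hx hfx
        have := h2 j0 hl0 hxj
        exact ⟨e, Finset.mem_filter.2 ⟨he, by omega⟩, h1, h2⟩
      refine HasTreeOn.conj true _ (hasTreeOn_star E F1 w _ hinj h0 hlay hvert hE hf ?_ ?_ ?_) ?_
      · intro e he
        obtain ⟨h1, h2⟩ := Finset.mem_filter.1 he
        exact ⟨hF h1, h2⟩
      · rintro x ⟨⟨hx, hxj⟩, hx1⟩ j hj
        by_cases h : lay j = 0
        · rw [hinj j j0 (by omega) (by omega)]; exact hxj
        · exact hx1 j (by simp [hj, h])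
      · rintro x ⟨⟨hx, hxj⟩, hx1⟩ hfx
        exact hcase x hx hxj hfx
      · rintro x ⟨hx, hxj⟩ j hj hne
        by_contra h
        obtain ⟨e, he, h1, h2⟩ := hcase x hx hxj (by simpa using h)
        simp only [Finset.mem_filter, Finset.mem_univ, true_and] at hj
        have h3 := (Finset.mem_filter.1 he).2
        exact hne (h1 j (by omega))
    -- The layer `0` variable of `w` has already been queried. The room this leaves absorbs the
    -- accounting unit of the star, so that a cover vertex costs exactly `l`.
    have hc1 : (Finset.univ.filter (fun j => vert j = w ∧ lay j ≠ 0)).card + 1 ≤ l := by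
      have h1 : (Finset.univ.filter (fun j => vert j = w)).card ≤ l := by
        rw [← Finset.card_range l]
        refine Finset.card_le_card_of_injOn lay (fun j _ => by simpa using hlay j) ?_
        intro j hj j' hj' h
        have h1 : vert j = w := by simpa using hj
        have h2 : vert j' = w := by simpa using hj'
        exact hinj j j' h (by rw [h1, h2])
      refine le_trans (Finset.card_lt_card ?_) h1
      refine Finset.ssubset_iff_of_subset ?_ |>.2 ⟨j0, by simp [hj0], by simp [hl0]⟩
      intro j; simp only [Finset.mem_filter, Finset.mem_univ, true_and]; exact fun h => h.1
    have hc2 : F1.card + F0.card = F.card := Finset.card_filter_add_card_filter_not _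
    refine (HasTreeOn.node j0 hhigh hlow).mono subset_rfl ?_
    rw [Finset.card_insert_of_notMem hwS, ← hc2, Nat.add_mul, Nat.add_mul]
    omega

end Upper

/-! ### Runs of the machine -/

section Runs

variable {O : Type} {h : O → Mem → PMF Mem}

theorem run_nil (t : ℕ) (m : Mem) : run h t ([], m) = PMF.pure ([], m) := by
  induction t with
  | zero => rfl
  | succ t ih => simp [run, step, ih]

theorem run_add (a b : ℕ) (c : Config O) : run h (a + b) c = (run h a c).bind (run h b) := by
  induction a generalizing c with
  | zero => simp [run]
  | succ a ih =>
    rw [Nat.add_right_comm]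
    simp only [run, PMF.bind_bind]
    congr 1
    funext c'
    exact ih c'

/-- Halted configurations are fixed by `step`, so time bounds can be relaxed freely. -/
theorem run_eq_of_halted {a b : ℕ} {c : Config O} (hab : a ≤ b) (hc : AlwaysHalted (run h a c)) :
    run h b c = run h a c := by
  obtain ⟨b, rfl⟩ := Nat.exists_eq_add_of_le hab
  rw [run_add]
  ext x
  rw [PMF.bind_apply]
  have : ∀ y, run h a c y * run h b y x = run h a c y * (PMF.pure y : PMF (Config O)) x := by
    intro y
    by_cases hy : y ∈ (run h a c).support
    · obtain ⟨K, m⟩ := y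
      have : K = [] := hc _ hy
      subst this
      rw [run_nil]
    · rw [PMF.mem_support_iff, not_not] at hy
      simp [hy]
  simp_rw [this]
  rw [← PMF.bind_apply, PMF.bind_pure]

theorem alwaysHalted_bind {α : Type} {μ : PMF α} {F : α → PMF (Config O)} :
    AlwaysHalted (μ.bind F) ↔ ∀ v ∈ μ.support, AlwaysHalted (F v) := by
  simp only [AlwaysHalted, PMF.mem_support_bind_iff]
  exact ⟨fun H v hv c hc => H c ⟨v, hv, hc⟩, fun H c ⟨v, hv, hc⟩ => H v hv c hc⟩

theorem probMem_bind {α : Type} (μ : PMF α) (F : α → PMF (Config O)) (P : Mem → Prop) :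
    probMem (μ.bind F) P = ∑' v, μ v * probMem (F v) P := by
  simp only [probMem, PMF.toOuterMeasure_bind_apply]

open Classical in
theorem probMem_pure (c : Config O) (P : Mem → Prop) :
    probMem (PMF.pure c) P = if P c.2 then 1 else 0 := by
  simp [probMem, PMF.toOuterMeasure_pure_apply]

theorem run_succ_map {α : Type} {μ : PMF α} {F : α → Config O} {c : Config O}
    (hs : step h c = μ.map F) (t : ℕ) : run h (t + 1) c = μ.bind (fun v => run h t (F v)) := by
  simp only [run, hs, PMF.bind_map]; rfl

theorem run_succ_pure {c c' : Config O} (hs : step h c = PMF.pure c') (t : ℕ) :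
    run h (t + 1) c = run h t c' := by
  simp only [run, hs, PMF.pure_bind]

/-- All runs from `c` halt within `t` steps, and `P` holds in the end with probability at
least `q`. -/
structure Good (h : O → Mem → PMF Mem) (t : ℕ) (c : Config O) (P : Mem → Prop) (q : ENNReal) :
    Prop where
  halted : AlwaysHalted (run h t c)
  prob : q ≤ probMem (run h t c) P

variable {t : ℕ} {c : Config O} {P : Mem → Prop} {q : ENNReal}

theorem Good.mono {t' : ℕ} (H : Good h t c P q) (ht : t ≤ t') : Good h t' c P q := by
  constructor
  · rw [run_eq_of_halted ht H.halted]; exact H.halted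
  · rw [run_eq_of_halted ht H.halted]; exact H.prob

theorem Good.weaken {q' : ENNReal} (H : Good h t c P q) (hq : q' ≤ q) : Good h t c P q' :=
  ⟨H.halted, hq.trans H.prob⟩

theorem Good.of_step {c' : Config O} (hs : step h c = PMF.pure c') (H : Good h t c' P q) :
    Good h (t + 1) c P q := by
  constructor
  · rw [run_succ_pure hs]; exact H.halted
  · rw [run_succ_pure hs]; exact H.prob

/-- The guarantee may depend on the outcome. This lets the simulation follow each random choice of
the learner and average afterwards. -/
theorem Good.of_step_map {α : Type} {μ : PMF α} {F : α → Config O} {q : α → ENNReal}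
    (hs : step h c = μ.map F) (H : ∀ v ∈ μ.support, Good h t (F v) P (q v)) :
    Good h (t + 1) c P (∑' v, μ v * q v) := by
  constructor
  · rw [run_succ_map hs, alwaysHalted_bind]
    exact fun v hv => (H v hv).halted
  · rw [run_succ_map hs, probMem_bind]
    refine ENNReal.tsum_le_tsum (fun v => ?_)
    by_cases hv : v ∈ μ.support
    · exact mul_le_mul_right (H v hv).prob _
    · rw [PMF.mem_support_iff, not_not] at hv
      simp [hv]

theorem Good.nil_one {m : Mem} (hP : P m) : Good h 0 ([], m) P 1 :=
  ⟨by simp [run, AlwaysHalted], by simp [run, probMem_pure, hP]⟩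

theorem Good.nil_zero {m : Mem} : Good h 0 ([], m) P 0 :=
  ⟨by simp [run, AlwaysHalted], by simp⟩

end Runs

/-! ### Deterministic programs -/

namespace Mem

@[simp] theorem setReg_reg (m : Mem) (x v i : ℕ) :
    (m.setReg x v).reg i = if i = x then v else m.reg i := by
  simp [setReg, Function.update_apply]

@[simp] theorem setReg_arr (m : Mem) (x v : ℕ) : (m.setReg x v).arr = m.arr := rfl

@[simp] theorem setCell_reg (m : Mem) (a i v : ℕ) : (m.setCell a i v).reg = m.reg := rfl

@[simp] theorem setCell_arr (m : Mem) (a i v b : ℕ) :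
    (m.setCell a i v).arr b = if b = a then Function.update (m.arr a) i v else m.arr b := by
  simp [setCell, Function.update_apply]

end Mem

/-- The program may write to register `i`. -/
def Prog.WritesReg {O : Type} : Prog O → ℕ → Prop
  | .const x _, i => i = x
  | .add x _ _, i => i = x
  | .sub x _ _, i => i = x
  | .load x _ _, i => i = x
  | .seq p q, i => p.WritesReg i ∨ q.WritesReg i
  | .ite _ p q, i => p.WritesReg i ∨ q.WritesReg i
  | .loop _ p, i => p.WritesReg i
  | _, _ => False

/-- The program may write to array `a`. -/
def Prog.WritesArr {O : Type} : Prog O → ℕ → Prop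
  | .store b _ _, a => a = b
  | .seq p q, a => p.WritesArr a ∨ q.WritesArr a
  | .ite _ p q, a => p.WritesArr a ∨ q.WritesArr a
  | .loop _ p, a => p.WritesArr a
  | _, _ => False

/-- `m` and `m'` differ at most in the places to which `p` writes. -/
structure Frame {O : Type} (p : Prog O) (m m' : Mem) : Prop where
  reg : ∀ i, ¬ p.WritesReg i → m'.reg i = m.reg i
  arr : ∀ a, ¬ p.WritesArr a → m'.arr a = m.arr a

theorem Frame.refl {O : Type} (p : Prog O) (m : Mem) : Frame p m m :=
  ⟨fun _ _ => rfl, fun _ _ => rfl⟩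

theorem Frame.trans {O : Type} {p : Prog O} {m m' m'' : Mem} (h1 : Frame p m m')
    (h2 : Frame p m' m'') : Frame p m m'' :=
  ⟨fun i hi => (h2.reg i hi).trans (h1.reg i hi), fun a ha => (h2.arr a ha).trans (h1.arr a ha)⟩

/-! ### Big-step semantics and timed Hoare triples -/

/-- Big-step semantics of deterministic programs: `Exec p m t m'` says that `p` leads from `m`
to `m'` in `t` steps. -/
inductive Exec : Prog Empty → Mem → ℕ → Mem → Prop
  | skip (m : Mem) : Exec .skip m 1 m
  | const (x c : ℕ) (m : Mem) : Exec (.const x c) m 1 (m.setReg x c)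
  | add (x y z : ℕ) (m : Mem) : Exec (.add x y z) m 1 (m.setReg x (m.reg y + m.reg z))
  | sub (x y z : ℕ) (m : Mem) : Exec (.sub x y z) m 1 (m.setReg x (m.reg y - m.reg z))
  | load (x a y : ℕ) (m : Mem) : Exec (.load x a y) m 1 (m.setReg x (m.arr a (m.reg y)))
  | store (a y x : ℕ) (m : Mem) : Exec (.store a y x) m 1 (m.setCell a (m.reg y) (m.reg x))
  | seq {p q : Prog Empty} {m m1 m2 : Mem} {a b : ℕ} (h1 : Exec p m a m1)
      (h2 : Exec q m1 b m2) : Exec (.seq p q) m (a + b + 1) m2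
  | iteTrue {x : ℕ} {p q : Prog Empty} {m m' : Mem} {a : ℕ} (hx : m.reg x ≠ 0)
      (h1 : Exec p m a m') : Exec (.ite x p q) m (a + 1) m'
  | iteFalse {x : ℕ} {p q : Prog Empty} {m m' : Mem} {a : ℕ} (hx : m.reg x = 0)
      (h1 : Exec q m a m') : Exec (.ite x p q) m (a + 1) m'
  | loopDone {x : ℕ} {p : Prog Empty} {m : Mem} (hx : m.reg x = 0) : Exec (.loop x p) m 1 m
  | loopStep {x : ℕ} {p : Prog Empty} {m m1 m2 : Mem} {a b : ℕ} (hx : m.reg x ≠ 0)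
      (h1 : Exec p m a m1) (h2 : Exec (.loop x p) m1 b m2) : Exec (.loop x p) m (a + b + 1) m2

/-- Links the two semantics: a deterministic prefix only changes the memory and delays the
continuation `k`. -/
theorem Exec.good {p : Prog Empty} {m m' : Mem} {a : ℕ} (H : Exec p m a m')
    {h : Empty → Mem → PMF Mem} {t : ℕ} {k : List (Prog Empty)} {P : Mem → Prop} {q : ENNReal}
    (G : Good h t (k, m') P q) : Good h (t + a) (p :: k, m) P q := by
  induction H generalizing t k with
  | skip | const | add | sub | load | store => exact G.of_step rfl
  | seq h1 h2 ih1 ih2 =>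
    rename_i p q m m1 m2 a b
    have := (ih1 (ih2 G)).of_step (c := (.seq p q :: k, m)) rfl
    exact this.mono (by omega)
  | iteTrue hx h1 ih =>
    exact (ih G).of_step (by simp [step, hx])
  | iteFalse hx h1 ih =>
    exact (ih G).of_step (by simp [step, hx])
  | loopDone hx => exact G.of_step (by simp [step, hx])
  | loopStep hx h1 h2 ih1 ih2 =>
    rename_i x p m m1 m2 a b
    have := (ih1 (ih2 G)).of_step (c := (.loop x p :: k, m)) (by simp [step, hx])
    exact this.mono (by omega)

/-- `Prog.WritesReg` ignores `rand` and oracle calls. This is sound here because `Exec` has no rule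
for them. -/
theorem Exec.frame {p : Prog Empty} {m m' : Mem} {a : ℕ} (H : Exec p m a m') : Frame p m m' := by
  induction H with
  | skip => exact Frame.refl _ _
  | const | add | sub | load =>
    refine ⟨fun i hi => ?_, fun a ha => rfl⟩
    simp only [Prog.WritesReg] at hi
    simp [hi]
  | store =>
    refine ⟨fun i hi => rfl, fun a ha => ?_⟩
    simp only [Prog.WritesArr] at ha
    simp [ha]
  | seq h1 h2 ih1 ih2 =>
    refine ⟨fun i hi => ?_, fun a ha => ?_⟩
    · simp only [Prog.WritesReg, not_or] at hi
      rw [ih2.reg i hi.2, ih1.reg i hi.1]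
    · simp only [Prog.WritesArr, not_or] at ha
      rw [ih2.arr a ha.2, ih1.arr a ha.1]
  | iteTrue hx h1 ih =>
    refine ⟨fun i hi => ?_, fun a ha => ?_⟩
    · simp only [Prog.WritesReg, not_or] at hi
      exact ih.reg i hi.1
    · simp only [Prog.WritesArr, not_or] at ha
      exact ih.arr a ha.1
  | iteFalse hx h1 ih =>
    refine ⟨fun i hi => ?_, fun a ha => ?_⟩
    · simp only [Prog.WritesReg, not_or] at hi
      exact ih.reg i hi.2
    · simp only [Prog.WritesArr, not_or] at ha
      exact ih.arr a ha.2
  | loopDone hx => exact Frame.refl _ _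
  | loopStep hx h1 h2 ih1 ih2 => exact Frame.trans ⟨ih1.reg, ih1.arr⟩ ih2

/-- From `m`, the program `p` halts within `T` steps in a memory that satisfies `Q`. -/
def Tri (p : Prog Empty) (m : Mem) (T : ℕ) (Q : Mem → Prop) : Prop :=
  ∃ m' a, a ≤ T ∧ Exec p m a m' ∧ Q m'

namespace Tri

variable {p q : Prog Empty} {m : Mem} {T T' : ℕ} {Q Q' : Mem → Prop}

theorem good (H : Tri p m T Q) {h : Empty → Mem → PMF Mem} {t : ℕ} {k : List (Prog Empty)}
    {P : Mem → Prop} {r : ENNReal} (G : ∀ m', Q m' → Frame p m m' → Good h t (k, m') P r) :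
    Good h (t + T) (p :: k, m) P r := by
  obtain ⟨m', a, ha, he, hQ⟩ := H
  exact (he.good (G m' hQ he.frame)).mono (by omega)

theorem mono (H : Tri p m T Q) (hT : T ≤ T') (hQ : ∀ m', Q m' → Frame p m m' → Q' m') :
    Tri p m T' Q' := by
  obtain ⟨m', a, ha, he, hm⟩ := H
  exact ⟨m', a, ha.trans hT, he, hQ m' hm he.frame⟩

theorem time (H : Tri p m T Q) (hT : T ≤ T') : Tri p m T' Q := H.mono hT (fun _ h _ => h)

theorem skip (H : Q m) : Tri .skip m 1 Q := ⟨_, _, le_rfl, .skip m, H⟩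

theorem const {x c : ℕ} (H : Q (m.setReg x c)) : Tri (.const x c) m 1 Q :=
  ⟨_, _, le_rfl, .const x c m, H⟩

theorem add {x y z : ℕ} (H : Q (m.setReg x (m.reg y + m.reg z))) : Tri (.add x y z) m 1 Q :=
  ⟨_, _, le_rfl, .add x y z m, H⟩

theorem sub {x y z : ℕ} (H : Q (m.setReg x (m.reg y - m.reg z))) : Tri (.sub x y z) m 1 Q :=
  ⟨_, _, le_rfl, .sub x y z m, H⟩

theorem load {x a y : ℕ} (H : Q (m.setReg x (m.arr a (m.reg y)))) : Tri (.load x a y) m 1 Q :=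
  ⟨_, _, le_rfl, .load x a y m, H⟩

theorem store {a y x : ℕ} (H : Q (m.setCell a (m.reg y) (m.reg x))) : Tri (.store a y x) m 1 Q :=
  ⟨_, _, le_rfl, .store a y x m, H⟩

theorem seq (H : Tri p m T (fun m' => Tri q m' T' Q)) : Tri (.seq p q) m (T + T' + 1) Q := by
  obtain ⟨m1, a, ha, he, m2, b, hb, he2, hQ⟩ := H
  exact ⟨m2, _, by omega, .seq he he2, hQ⟩

theorem ite {x : ℕ} (h1 : m.reg x ≠ 0 → Tri p m T Q) (h0 : m.reg x = 0 → Tri q m T' Q) :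
    Tri (.ite x p q) m (max T T' + 1) Q := by
  by_cases hx : m.reg x = 0
  · obtain ⟨m1, a, ha, he, hQ⟩ := h0 hx
    exact ⟨m1, _, by omega, .iteFalse hx he, hQ⟩
  · obtain ⟨m1, a, ha, he, hQ⟩ := h1 hx
    exact ⟨m1, _, by omega, .iteTrue hx he, hQ⟩

/-- Loops with a variant `V`. -/
theorem loop {x : ℕ} (Inv : Mem → Prop) (V : Mem → ℕ) (h0 : Inv m)
    (hstep : ∀ m1, Frame (.loop x p) m m1 → Inv m1 → m1.reg x ≠ 0 →
      Tri p m1 T (fun m2 => Inv m2 ∧ V m2 < V m1)) :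
    Tri (.loop x p) m (V m * (T + 1) + 1) (fun m' => Inv m' ∧ m'.reg x = 0) := by
  suffices ∀ v m1, V m1 = v → Frame (.loop x p) m m1 → Inv m1 →
      Tri (.loop x p) m1 (v * (T + 1) + 1) (fun m' => Inv m' ∧ m'.reg x = 0) from
    this _ m rfl (Frame.refl _ _) h0
  intro v
  induction v using Nat.strong_induction_on with
  | _ v ih =>
    intro m1 hv hf hI
    by_cases hx : m1.reg x = 0
    · exact ⟨m1, 1, by omega, .loopDone hx, hI, hx⟩
    · obtain ⟨m2, a, ha, he, hI2, hlt⟩ := hstep m1 hf hI hx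
      rw [hv] at hlt
      have hf2 : Frame (.loop x p) m1 m2 := ⟨he.frame.reg, he.frame.arr⟩
      obtain ⟨m3, b, hb, he3, hQ⟩ := ih (V m2) hlt m2 rfl (hf.trans hf2) hI2
      refine ⟨m3, _, ?_, .loopStep hx he he3, hQ⟩
      have : (V m2 + 1) * (T + 1) ≤ v * (T + 1) := Nat.mul_le_mul_right _ hlt
      rw [Nat.add_mul] at this
      omega

end Tri

/-- Programs without loops and random choices. -/
def Prog.LoopFree : Prog Empty → Prop
  | .seq p q => p.LoopFree ∧ q.LoopFree
  | .ite _ p q => p.LoopFree ∧ q.LoopFree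
  | .rand _ _ => False
  | .loop _ _ => False
  | _ => True

/-- The result of a loop-free program. -/
def Prog.exec : Prog Empty → Mem → Mem
  | .const x c, m => m.setReg x c
  | .add x y z, m => m.setReg x (m.reg y + m.reg z)
  | .sub x y z, m => m.setReg x (m.reg y - m.reg z)
  | .load x a y, m => m.setReg x (m.arr a (m.reg y))
  | .store a y x, m => m.setCell a (m.reg y) (m.reg x)
  | .seq p q, m => q.exec (p.exec m)
  | .ite x p q, m => if m.reg x = 0 then q.exec m else p.exec m
  | _, m => m

/-- A time bound for a loop-free program. -/
def Prog.cost : Prog Empty → ℕ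
  | .seq p q => p.cost + q.cost + 1
  | .ite _ p q => max p.cost q.cost + 1
  | _ => 1

/-- Reduces a straight-line block to its symbolic result `p.exec m`, which `simp` can compute. -/
theorem Tri.loopFree {p : Prog Empty} (hp : p.LoopFree) {m : Mem} {Q : Mem → Prop}
    (hQ : Q (p.exec m)) : Tri p m p.cost Q := by
  induction p generalizing m Q with
  | skip => exact Tri.skip hQ
  | const => exact Tri.const hQ
  | add => exact Tri.add hQ
  | sub => exact Tri.sub hQ
  | load => exact Tri.load hQ
  | store => exact Tri.store hQ
  | rand => exact hp.elim
  | call o => exact o.elim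
  | seq p q ihp ihq => exact Tri.seq (ihp hp.1 (ihq hp.2 hQ))
  | ite x p q ihp ihq =>
    refine Tri.ite (fun hx => ihp hp.1 ?_) (fun hx => ihq hp.2 ?_)
    · simpa [Prog.exec, hx] using hQ
    · simpa [Prog.exec, hx] using hQ
  | loop => exact hp.elim

/-- `for i < y do body`, with `r` as a counter; registers `2` and `3` hold `1` and `0`. -/
def forLoop (i r y : ℕ) (body : Prog Empty) : Prog Empty :=
  .seq (.const i 0) (.seq (.add r y 3) (.loop r (.seq body (.seq (.add i i 2) (.sub r r 2)))))

/-- The remaining count in `r` is the variant, and the counters always add up to `n`. Besides the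
body, a round costs five steps: two counter updates, two sequencings and the loop test. -/
theorem Tri.forLoop {i r y : ℕ} {body : Prog Empty} {m : Mem} {T : ℕ} (n : ℕ)
    (Inv : ℕ → Mem → Prop) (h2 : m.reg 2 = 1) (h3 : m.reg 3 = 0) (hy : m.reg y = n)
    (hi : i ≠ y ∧ i ≠ r ∧ i ≠ 2 ∧ i ≠ 3 ∧ r ≠ 2)
    (hb : ∀ j, body.WritesReg j → j ≠ i ∧ j ≠ r ∧ j ≠ 2)
    (h0 : Inv 0 ((m.setReg i 0).setReg r n))
    (hstep : ∀ j < n, ∀ m1, Frame (forLoop i r y body) m m1 → m1.reg i = j → Inv j m1 →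
      Tri body m1 T (fun m2 => Inv (j + 1) ((m2.setReg i (j + 1)).setReg r (n - (j + 1))))) :
    Tri (DTLearning.forLoop i r y body) m (n * (T + 5) + 5) (Inv n) := by
  obtain ⟨hiy, hir, hi2, hi3, hr2⟩ := hi
  unfold DTLearning.forLoop
  refine Tri.time (Tri.seq (Tri.const (Tri.seq (Tri.add
    (Tri.mono (Tri.loop (T := T + 4)
      (fun m1 => Inv (m1.reg i) m1 ∧ m1.reg i + m1.reg r = n ∧ m1.reg 2 = 1)
      (fun m1 => m1.reg r) ?_ ?_) le_rfl ?_))))) ?_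
  · simp [hi2.symm, hr2.symm, h2, h3, hy, hir, hiy.symm, hi3.symm, h0]
  · rintro m1 hf ⟨hI, hs, h21⟩ hr
    have hF : Frame (DTLearning.forLoop i r y body) m m1 := by
      refine ⟨fun j hj => ?_, fun a ha => ?_⟩
      · have := hf.reg j
        simp only [DTLearning.forLoop, Prog.WritesReg, not_or] at hj this
        rw [this hj.2.2]
        simp [hj.1, hj.2.1]
      · have := hf.arr a
        simp only [DTLearning.forLoop, Prog.WritesArr, not_or] at ha this
        rw [this ha.2.2]
        rfl
    refine Tri.time (Tri.seq (Tri.mono (hstep (m1.reg i) (by omega) m1 hF rfl hI) le_rfl ?_))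
      (T := T + 3 + 1) le_rfl
    intro m2 hI2 hf2
    have e1 : m2.reg i = m1.reg i := hf2.reg i (fun h => (hb i h).1 rfl)
    have e2 : m2.reg r = m1.reg r := hf2.reg r (fun h => (hb r h).2.1 rfl)
    have e3 : m2.reg 2 = 1 := (hf2.reg 2 (fun h => (hb 2 h).2.2 rfl)).trans h21
    refine Tri.time (Tri.seq (Tri.add (Tri.sub ?_))) (T := 3) le_rfl
    have e4 : n - (m1.reg i + 1) = m1.reg r - 1 := by omega
    rw [e4] at hI2
    simp only [Mem.setReg_reg, e1, e2, e3, hi2.symm, hr2.symm, hir, hir.symm, if_true, if_false]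
    refine ⟨⟨hI2, by omega, trivial⟩, by omega⟩
  · rintro m' ⟨⟨hI, hs, -⟩, hr⟩ -
    rw [hr, Nat.add_zero] at hs
    rw [← hs]; exact hI
  · simp [hi3.symm, hiy.symm, hy, h3]; ring_nf; omega

infixr:60 " ;; " => Prog.seq

/-! ### Evaluation of the edge recognition function -/

/-- Clears register `20` unless the first `n` cells of array `a` vanish outside of the cells with
addresses in registers `18` and `19`. -/
def testLayerZero (a : ℕ) : Prog Empty :=
  forLoop 21 22 0 (.load 23 a 21 ;; .ite 23
    -- Registers `24` and `25` receive the absolute differences to the two allowed addresses, as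
    -- sums of opposite truncated differences.
    (.sub 24 21 18 ;; .sub 25 18 21 ;; .add 24 24 25 ;; .sub 25 21 19 ;; .sub 26 19 21 ;;
      .add 25 25 26 ;; .ite 24 (.ite 25 (.const 20 0) .skip) .skip) .skip)

theorem testLayerZero_spec (a : ℕ) {m : Mem} (h2 : m.reg 2 = 1) (h3 : m.reg 3 = 0) :
    Tri (testLayerZero a) m (m.reg 0 * 25 + 5) (fun m' => m'.reg 20 ≠ 0 ↔
      m.reg 20 ≠ 0 ∧ ∀ w < m.reg 0, m.arr a w ≠ 0 → w = m.reg 18 ∨ w = m.reg 19) := by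
  refine Tri.time (Tri.forLoop (T := 18) (m.reg 0) (fun j m' => m'.reg 20 ≠ 0 ↔
      m.reg 20 ≠ 0 ∧ ∀ w < j, m.arr a w ≠ 0 → w = m.reg 18 ∨ w = m.reg 19)
      h2 h3 rfl (by decide) ?_ ?_ ?_) (by omega)
  · simp [Prog.WritesReg]
  · simp
  · intro j hj m1 hf hj1 hI
    have f18 := hf.reg 18 (by simp [forLoop, Prog.WritesReg])
    have f19 := hf.reg 19 (by simp [forLoop, Prog.WritesReg])
    have fa := hf.arr a (by simp [forLoop, Prog.WritesArr])
    rw [Nat.forall_lt_succ_right]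
    refine Tri.time (Tri.loopFree (by simp [Prog.LoopFree]) ?_) (by simp [Prog.cost])
    simp [Prog.exec]
    split_ifs
    all_goals
      simp [hj1, f18, f19, fa] at *
      grind

/-- Clears register `20` unless the two columns of array `a` with addresses in registers `18` and
`19` have no zeros. -/
def testColumns (a : ℕ) : Prog Empty :=
  forLoop 21 22 5 (.load 23 a 18 ;; .ite 23 .skip (.const 20 0) ;;
    .load 23 a 19 ;; .ite 23 .skip (.const 20 0) ;; .add 18 18 0 ;; .add 19 19 0)

theorem testColumns_spec (a : ℕ) {m : Mem} (h2 : m.reg 2 = 1) (h3 : m.reg 3 = 0) :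
    Tri (testColumns a) m (m.reg 5 * 25 + 5) (fun m' => m'.reg 20 ≠ 0 ↔
      m.reg 20 ≠ 0 ∧ ∀ i < m.reg 5, m.arr a (i * m.reg 0 + m.reg 18) ≠ 0 ∧
        m.arr a (i * m.reg 0 + m.reg 19) ≠ 0) := by
  -- Registers `18` and `19` walk down the two columns, one layer of `n` cells per round.
  refine Tri.mono (Tri.forLoop (T := 18) (m.reg 5) (fun j m' =>
      m'.reg 18 = j * m.reg 0 + m.reg 18 ∧ m'.reg 19 = j * m.reg 0 + m.reg 19 ∧
      (m'.reg 20 ≠ 0 ↔ m.reg 20 ≠ 0 ∧ ∀ i < j, m.arr a (i * m.reg 0 + m.reg 18) ≠ 0 ∧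
        m.arr a (i * m.reg 0 + m.reg 19) ≠ 0))
      h2 h3 rfl (by decide) ?_ ?_ ?_) (by omega) (fun m' h _ => h.2.2)
  · simp [Prog.WritesReg]
  · simp
  · intro j hj m1 hf hj1 ⟨hI1, hI2, hI⟩
    have f0 := hf.reg 0 (by simp [forLoop, Prog.WritesReg])
    have fa := hf.arr a (by simp [forLoop, Prog.WritesArr])
    rw [Nat.forall_lt_succ_right]
    refine Tri.time (Tri.loopFree (by simp [Prog.LoopFree]) ?_) (by simp [Prog.cost])
    simp [Prog.exec]
    split_ifs
    all_goals
      simp [hj1, f0, fa, hI1, hI2, Nat.add_mul] at *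
      grind

/-- The edge recognition function for bit strings in an array `x`, and edges listed in arrays
`U` and `V`. -/
def EdgeRec (n l k : ℕ) (U V x : ℕ → ℕ) : Prop :=
  ∃ e < k, (∀ w < n, x w ≠ 0 → w = U e ∨ w = V e) ∧
    ∀ i < l, x (i * n + U e) ≠ 0 ∧ x (i * n + V e) ≠ 0

/-- Evaluates the edge recognition function at the bit string in array `a`. -/
def evalEdgeRec (a : ℕ) : Prog Empty :=
  .const 15 0 ;; forLoop 16 17 4 (.load 18 1 16 ;; .load 19 2 16 ;; .const 20 1 ;;
    testLayerZero a ;; testColumns a ;; .ite 20 (.const 15 1) .skip)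

open Classical in
theorem evalEdgeRec_spec (a : ℕ) {m : Mem} (h2 : m.reg 2 = 1) (h3 : m.reg 3 = 0) :
    Tri (evalEdgeRec a) m (m.reg 4 * (25 * m.reg 0 + 25 * m.reg 5 + 30) + 10) (fun m' =>
      m'.reg 15 =
        if EdgeRec (m.reg 0) (m.reg 5) (m.reg 4) (m.arr 1) (m.arr 2) (m.arr a) then 1 else 0) := by
  refine Tri.time (Tri.seq (Tri.const (Tri.forLoop (T := 25 * m.reg 0 + 25 * m.reg 5 + 25)
    (m.reg 4) (fun j m' => m'.reg 15 =
      if EdgeRec (m.reg 0) (m.reg 5) j (m.arr 1) (m.arr 2) (m.arr a) then 1 else 0)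
      ?_ ?_ ?_ (by decide) ?_ ?_ ?_))) (T := 1 + (m.reg 4 * ((25 * m.reg 0 + 25 * m.reg 5 + 25) + 5)
        + 5) + 1) (by ring_nf; omega)
  · simpa using h2
  · simpa using h3
  · simp
  · intro j hj
    simp [Prog.WritesReg, testLayerZero, testColumns, forLoop] at hj
    omega
  · simp [EdgeRec]
  · intro e he m1 hf he1 hI
    have fr : ∀ i, i = 0 ∨ i = 2 ∨ i = 3 ∨ i = 5 → m1.reg i = m.reg i := by
      intro i hi
      rw [hf.reg i]
      · rcases hi with rfl | rfl | rfl | rfl <;> simp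
      · rcases hi with rfl | rfl | rfl | rfl <;>
          simp [Prog.WritesReg, testLayerZero, testColumns, forLoop]
    have fa : ∀ b, m1.arr b = m.arr b := fun b => by
      rw [hf.arr b (by simp [Prog.WritesArr, testLayerZero, testColumns, forLoop])]; rfl
    refine Tri.time (Tri.seq (Tri.load (Tri.seq (Tri.load (Tri.seq (Tri.const (Tri.seq
      (Tri.mono (testLayerZero_spec a ?_ ?_) le_rfl
        (fun m2 hm2 hf2 => Tri.seq (Tri.mono (testColumns_spec a ?_ ?_)
          (?_ : _ ≤ m.reg 5 * 25 + 5)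
          (fun m3 hm3 hf3 => Tri.time (T' := 2)
            (Tri.loopFree (by simp [Prog.LoopFree]) ?_) le_rfl))))))))))) ?_
    · simp [fr, h2]
    · simp [fr, h3]
    · rw [hf2.reg 2 (by simp [Prog.WritesReg, testLayerZero, forLoop])]; simp [fr, h2]
    · rw [hf2.reg 3 (by simp [Prog.WritesReg, testLayerZero, forLoop])]; simp [fr, h3]
    · rw [hf2.reg 5 (by simp [Prog.WritesReg, testLayerZero, forLoop])]; simp [fr]
    · have e0 := hf2.reg 0 (by simp [Prog.WritesReg, testLayerZero, forLoop])
      have e5 := hf2.reg 5 (by simp [Prog.WritesReg, testLayerZero, forLoop])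
      have e18 := hf2.reg 18 (by simp [Prog.WritesReg, testLayerZero, forLoop])
      have e19 := hf2.reg 19 (by simp [Prog.WritesReg, testLayerZero, forLoop])
      have e15 := hf2.reg 15 (by simp [Prog.WritesReg, testLayerZero, forLoop])
      have e15' := hf3.reg 15 (by simp [Prog.WritesReg, testColumns, forLoop])
      have ea := hf2.arr a (by simp [Prog.WritesArr, testLayerZero, forLoop])
      simp [fr, fa, he1] at e0 e5 e18 e19 e15 ea hm2
      simp only [e0, e5, e18, e19, ea, e15, hm2] at hm3 e15'
      have hiff : EdgeRec (m.reg 0) (m.reg 5) (e + 1) (m.arr 1) (m.arr 2) (m.arr a) ↔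
          EdgeRec (m.reg 0) (m.reg 5) e (m.arr 1) (m.arr 2) (m.arr a) ∨ m3.reg 20 ≠ 0 := by
        rw [hm3]
        unfold EdgeRec
        constructor
        · rintro ⟨e', he', h⟩
          rcases Nat.lt_succ_iff_lt_or_eq.1 he' with h' | rfl
          · exact Or.inl ⟨e', h', h⟩
          · exact Or.inr ⟨fun w hw h' => h.1 w hw (by simpa using h'), h.2⟩
        · rintro (⟨e', he', h⟩ | h)
          · exact ⟨e', by omega, h⟩
          · exact ⟨e, by omega, fun w hw h' => h.1 w hw (by simpa using h'), h.2⟩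
      rw [hiff]
      by_cases hc : m3.reg 20 = 0
      · simp [Prog.exec, hc, e15', hI]
      · simp [Prog.exec, hc]
    · simp [fr]; omega

/-! ### Sample points computed from their numbers -/

/-- Division with remainder of register `x` by register `y`: the quotient is put into `q`, the
remainder into `x`. -/
def divMod (x y q : ℕ) : Prog Empty :=
  -- Register `29` is kept at `x - (y - 1)`, which is nonzero exactly while `y ≤ x`.
  .const q 0 ;; .sub 30 y 2 ;; .sub 29 x 30 ;;
    .loop 29 (.sub x x y ;; .add q q 2 ;; .sub 29 x 30)

theorem divMod_spec {x y q : ℕ} (hxy : x ≠ y ∧ x ≠ q ∧ x ≠ 2 ∧ x ≠ 29 ∧ x ≠ 30)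
    (hy : y ≠ q ∧ y ≠ 2 ∧ y ≠ 29 ∧ y ≠ 30) (hq : q ≠ 2 ∧ q ≠ 29 ∧ q ≠ 30) {m : Mem}
    (h2 : m.reg 2 = 1) (hy0 : 0 < m.reg y) :
    Tri (divMod x y q) m (m.reg x / m.reg y * 6 + 7) (fun m' =>
      m'.reg x = m.reg x % m.reg y ∧ m'.reg q = m.reg x / m.reg y) := by
  obtain ⟨a1, a2, a3, a4, a5⟩ := hxy
  obtain ⟨b1, b2, b3, b4⟩ := hy
  obtain ⟨c1, c2, c3⟩ := hq
  refine Tri.time (Tri.seq (Tri.const (Tri.seq (Tri.sub (Tri.seq (Tri.sub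
    (Tri.mono (Tri.loop (T := 5) (fun m1 => m1.reg x % m.reg y = m.reg x % m.reg y ∧
      m1.reg q + m1.reg x / m.reg y = m.reg x / m.reg y ∧
      m1.reg 29 = m1.reg x - (m.reg y - 1)) (fun m1 => m1.reg x / m.reg y) ?_ ?_) ?_ ?_)))))))
      (T := 1 + (1 + (1 + (m.reg x / m.reg y * 6 + 1) + 1) + 1) + 1) (by omega)
  · simp [*, Ne.symm c1]
  · rintro m1 hf ⟨h4, h5, h6⟩ h7
    have fy := hf.reg y (by simp [Prog.WritesReg, *, Ne.symm a1])
    have f2 := hf.reg 2 (by simp [Prog.WritesReg, *, Ne.symm a3, Ne.symm c1])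
    have f30 := hf.reg 30 (by simp [Prog.WritesReg, *, Ne.symm a5, Ne.symm c3])
    simp [*, Ne.symm c1] at fy f2 f30
    refine Tri.time (Tri.loopFree (by simp [Prog.LoopFree]) ?_) (by simp [Prog.cost])
    have hle : m.reg y ≤ m1.reg x := by omega
    have hd := Nat.div_eq_sub_div hy0 hle
    have hm := Nat.mod_eq_sub_mod hle
    simp [Prog.exec, *, Ne.symm a2, Ne.symm a3, Ne.symm a5, Ne.symm c3]
    refine ⟨?_, ?_⟩
    · rw [← hm, h4]
    · omega
  · simp [*]
  · rintro m' ⟨⟨h4, h5, h6⟩, h7⟩ -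
    have hlt : m'.reg x < m.reg y := by omega
    rw [Nat.mod_eq_of_lt hlt] at h4
    rw [Nat.div_eq_of_lt hlt] at h5
    exact ⟨h4, by omega⟩

/-- The bit at position `j` of the sample point with number `r`; the layers have size `n`, there
are `l` layers and `k` edges, listed in `U` and `V`. -/
def SampleBit (n l k : ℕ) (U V : ℕ → ℕ) (r j : ℕ) : Prop :=
  (j % n = U (r % k) ∨ j % n = V (r % k)) ∧
    ¬ (r / k / l = 2 ∧ j / n = r / k % l ∧ j % n = U (r % k)) ∧
    ¬ (r / k / l = 3 ∧ j / n = r / k % l ∧ j % n = V (r % k))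

/-- Decodes the number of a sample point in register `27`. -/
def decodeSample : Prog Empty :=
  divMod 27 4 28 ;; divMod 28 5 31 ;;
  -- Register `31` holds the type `b < 4` of the point. Register `33 = b - 2` flags `b = 3`, and `32
  -- = (b - 1) - 2 (b - 2)`, with truncated differences, flags `b = 2`.
  .load 18 1 27 ;; .load 19 2 27 ;; .const 34 2 ;; .sub 33 31 34 ;; .sub 32 31 2 ;;
    .sub 32 32 33 ;; .sub 32 32 33

/-- Writes the sample point with its number in register `27` to array `a`. -/
def writeSample (a : ℕ) : Prog Empty :=
  decodeSample ;; forLoop 21 22 6 (.store a 21 3) ;;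
  forLoop 21 22 5 (.sub 23 21 28 ;; .sub 24 28 21 ;; .add 23 23 24 ;;
    .ite 23 (.store a 18 2 ;; .store a 19 2)
      (.sub 24 2 32 ;; .store a 18 24 ;; .sub 24 2 33 ;; .store a 19 24) ;;
    .add 18 18 0 ;; .add 19 19 0)

theorem decodeSample_spec {m : Mem} (h2 : m.reg 2 = 1) (h4 : 0 < m.reg 4) (h5 : 0 < m.reg 5)
    (hr : m.reg 27 < 4 * m.reg 5 * m.reg 4) :
    Tri decodeSample m (m.reg 5 * 24 + 60) (fun m' =>
      m'.reg 18 = m.arr 1 (m.reg 27 % m.reg 4) ∧ m'.reg 19 = m.arr 2 (m.reg 27 % m.reg 4) ∧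
      m'.reg 28 = m.reg 27 / m.reg 4 % m.reg 5 ∧
      m'.reg 32 = (if m.reg 27 / m.reg 4 / m.reg 5 = 2 then 1 else 0) ∧
      m'.reg 33 = (if m.reg 27 / m.reg 4 / m.reg 5 = 3 then 1 else 0)) := by
  -- The quotients are below `4 l` and `4`, so division by repeated subtraction takes only `O(l)`
  -- steps.
  have hq : m.reg 27 / m.reg 4 < 4 * m.reg 5 := (Nat.div_lt_iff_lt_mul h4).2 hr
  have hb : m.reg 27 / m.reg 4 / m.reg 5 < 4 := (Nat.div_lt_iff_lt_mul h5).2 hq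
  refine Tri.time (Tri.seq (Tri.mono (divMod_spec (by decide) (by decide) (by decide) h2 h4)
    (T' := m.reg 5 * 24 + 7) (by omega) ?_)) (T := m.reg 5 * 24 + 7 + 50 + 1) (by omega)
  rintro m1 ⟨h27, h28⟩ hf1
  have f2 : m1.reg 2 = m.reg 2 := hf1.reg 2 (by simp [divMod, Prog.WritesReg])
  have f5 : m1.reg 5 = m.reg 5 := hf1.reg 5 (by simp [divMod, Prog.WritesReg])
  have fa : ∀ b, m1.arr b = m.arr b := fun b => hf1.arr b (by simp [divMod, Prog.WritesArr])
  refine Tri.time (Tri.seq (Tri.mono (divMod_spec (by decide) (by decide) (by decide)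
    (by rw [f2, h2]) (by rw [f5]; exact h5)) (T' := 31) (by rw [f5, h28]; omega) ?_))
    (T := 31 + 18 + 1) (by omega)
  rintro m2 ⟨h28', h31⟩ hf2
  have g2 : m2.reg 2 = 1 := by
    rw [hf2.reg 2 (by simp [divMod, Prog.WritesReg]), f2, h2]
  have g27 : m2.reg 27 = m1.reg 27 := hf2.reg 27 (by simp [divMod, Prog.WritesReg])
  have ga : ∀ b, m2.arr b = m.arr b := fun b =>
    (hf2.arr b (by simp [divMod, Prog.WritesArr])).trans (fa b)
  refine Tri.time (Tri.loopFree (by simp [Prog.LoopFree]) ?_) (by simp [Prog.cost])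
  rw [f5, h28] at h28' h31
  simp only [Prog.exec, Mem.setReg_reg, Mem.setReg_arr, g2, g27, ga, h31, h28', h27]
  refine ⟨by simp, by simp, by simp, ?_, ?_⟩ <;> simp <;> split <;> omega

theorem clearCells_spec (a : ℕ) {m : Mem} (h2 : m.reg 2 = 1) (h3 : m.reg 3 = 0) :
    Tri (forLoop 21 22 6 (.store a 21 3)) m (m.reg 6 * 6 + 5) (fun m' =>
      ∀ j, m'.arr a j = if j < m.reg 6 then 0 else m.arr a j) := by
  refine Tri.forLoop (T := 1) (m.reg 6) (fun i m' =>
    ∀ j, m'.arr a j = if j < i then 0 else m.arr a j) h2 h3 rfl (by decide) ?_ ?_ ?_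
  · simp [Prog.WritesReg]
  · simp
  · intro i hi m1 hf hi1 hI
    have f3 := hf.reg 3 (by simp [forLoop, Prog.WritesReg])
    refine Tri.store ?_
    intro j
    simp only [Mem.setReg_arr, Mem.setCell_arr, if_true, Function.update_apply, hi1, f3, h3, hI]
    split_ifs <;> first | rfl | omega

open Classical in
theorem writeColumns_spec (a : ℕ) {m : Mem} (h2 : m.reg 2 = 1) (h3 : m.reg 3 = 0) (u v : ℕ)
    (hu : u < m.reg 0) (hv : v < m.reg 0) (huv : u ≠ v) (h18 : m.reg 18 = u)
    (h19 : m.reg 19 = v) (b : ℕ) (h32 : m.reg 32 = if b = 2 then 1 else 0)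
    (h33 : m.reg 33 = if b = 3 then 1 else 0) (h6 : m.reg 6 = m.reg 5 * m.reg 0)
    (h0 : ∀ j < m.reg 6, m.arr a j = 0) :
    Tri (forLoop 21 22 5 (.sub 23 21 28 ;; .sub 24 28 21 ;; .add 23 23 24 ;;
    .ite 23 (.store a 18 2 ;; .store a 19 2)
      (.sub 24 2 32 ;; .store a 18 24 ;; .sub 24 2 33 ;; .store a 19 24) ;;
    .add 18 18 0 ;; .add 19 19 0)) m (m.reg 5 * 25 + 5) (fun m' =>
      ∀ j, m'.arr a j = if j < m.reg 6 then (if (j % m.reg 0 = u ∨ j % m.reg 0 = v) ∧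
        ¬ (b = 2 ∧ j / m.reg 0 = m.reg 28 ∧ j % m.reg 0 = u) ∧
        ¬ (b = 3 ∧ j / m.reg 0 = m.reg 28 ∧ j % m.reg 0 = v) then 1 else 0) else m.arr a j) := by
  set n := m.reg 0 with hn
  set B : ℕ → ℕ := fun j => if (j % n = u ∨ j % n = v) ∧
        ¬ (b = 2 ∧ j / n = m.reg 28 ∧ j % n = u) ∧
        ¬ (b = 3 ∧ j / n = m.reg 28 ∧ j % n = v) then 1 else 0 with hB
  refine Tri.mono (Tri.forLoop (T := 20) (m.reg 5) (fun i m' => m'.reg 18 = i * n + u ∧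
    m'.reg 19 = i * n + v ∧ ∀ j, m'.arr a j = if j < m.reg 6 then (if j / n < i then B j else 0)
      else m.arr a j) h2 h3 rfl (by decide) ?_ ?_ ?_) (by omega) ?_
  · simp [Prog.WritesReg]
  · simp [h18, h19]
    intro j hj; exact h0 j hj
  · rintro i hi m1 hf hi1 ⟨hI18, hI19, hI⟩
    have f0 := hf.reg 0 (by simp [forLoop, Prog.WritesReg])
    have f2 := hf.reg 2 (by simp [forLoop, Prog.WritesReg])
    have f28 := hf.reg 28 (by simp [forLoop, Prog.WritesReg])
    have f32 := hf.reg 32 (by simp [forLoop, Prog.WritesReg])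
    have f33 := hf.reg 33 (by simp [forLoop, Prog.WritesReg])
    have hn0 : 0 < n := by omega
    -- One round writes two cells, both in row `i`; the row `j / n` of a cell tells whether it is
    -- already final.
    have key : ∀ j x y, (x = if i = m.reg 28 ∧ b = 2 then 0 else 1) →
        (y = if i = m.reg 28 ∧ b = 3 then 0 else 1) →
        (if j = i * n + v then y else if j = i * n + u then x else m1.arr a j) =
        if j < m.reg 6 then (if j / n ≤ i then B j else 0) else m.arr a j := by
      intro j x y hx hy
      have hin : (i + 1) * n ≤ m.reg 5 * n := Nat.mul_le_mul_right _ hi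
      rw [Nat.add_mul] at hin
      have e1 : ∀ c < n, (i * n + c) / n = i := fun c hc => by
        rw [Nat.add_comm, Nat.add_mul_div_right _ _ hn0, Nat.div_eq_of_lt hc, Nat.zero_add]
      have e2 : ∀ c < n, (i * n + c) % n = c := fun c hc => by
        rw [Nat.add_comm, Nat.add_mul_mod_self_right, Nat.mod_eq_of_lt hc]
      by_cases hjv : j = i * n + v
      · have : j < m.reg 6 := by rw [h6]; omega
        simp only [hB, hjv ▸ this, hjv, e1 v hv, e2 v hv, if_true, hy]
        grind
      by_cases hju : j = i * n + u
      · have : j < m.reg 6 := by rw [h6]; omega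
        simp only [hB, hju ▸ this, hju, e1 u hu, e2 u hu, if_true, hx]
        grind
      rw [if_neg hjv, if_neg hju, hI]
      have e3 : j / n = i → j % n ≠ u ∧ j % n ≠ v := by
        intro h
        have := Nat.div_add_mod' j n
        rw [h] at this
        omega
      by_cases hji : j / n = i
      · have := e3 hji
        simp [hji, hB, this.1, this.2]
      · have : j / n ≤ i ↔ j / n < i := by omega
        simp [this]
    refine Tri.time (Tri.loopFree (by simp [Prog.LoopFree]) ?_) (by simp [Prog.cost])
    by_cases hc : i = m.reg 28
    · have hc1 : i - m.reg 28 + (m.reg 28 - i) = 0 := by omega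
      simp [Prog.exec, hi1, f0, f2, f28, f32, f33, hc1, hI18, hI19, h2, Nat.add_mul, h32, h33,
        Function.update_apply]
      refine ⟨by omega, by omega, fun j => ?_⟩
      refine key j _ _ ?_ ?_
      · simp only [hc, true_and]; split <;> rfl
      · simp only [hc, true_and]; split <;> rfl
    · have hc1 : ¬ (i - m.reg 28 = 0 ∧ m.reg 28 - i = 0) := by omega
      simp [Prog.exec, hi1, f0, f2, f28, hc1, hI18, hI19, h2, Nat.add_mul, Function.update_apply]
      refine ⟨by omega, by omega, fun j => ?_⟩
      refine key j _ _ ?_ ?_ <;> simp [hc]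
  · rintro m' ⟨-, -, h⟩ -
    intro j
    rw [h]
    by_cases hj : j < m.reg 6
    · have : j / n < m.reg 5 := by
        rw [Nat.div_lt_iff_lt_mul (by omega), ← h6]; exact hj
      simp [hj, this, hB]
    · simp [hj]

open Classical in
theorem writeSample_spec (a : ℕ) {m : Mem} (h2 : m.reg 2 = 1) (h3 : m.reg 3 = 0)
    (h4 : 0 < m.reg 4) (h5 : 0 < m.reg 5) (h6 : m.reg 6 = m.reg 5 * m.reg 0)
    (hU : ∀ e < m.reg 4, m.arr 1 e < m.arr 2 e ∧ m.arr 2 e < m.reg 0)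
    (hr : m.reg 27 < 4 * m.reg 5 * m.reg 4) :
    Tri (writeSample a) m (m.reg 5 * 100 + m.reg 6 * 6 + 100) (fun m' =>
      ∀ j, m'.arr a j = if j < m.reg 6 then
        (if SampleBit (m.reg 0) (m.reg 5) (m.reg 4) (m.arr 1) (m.arr 2) (m.reg 27) j then 1 else 0)
        else m.arr a j) := by
  obtain ⟨hU1, hU2⟩ := hU _ (Nat.mod_lt (m.reg 27) h4)
  refine Tri.time (Tri.seq (Tri.mono (decodeSample_spec h2 h4 h5 hr) le_rfl ?_))
    (T := m.reg 5 * 24 + 60 + (m.reg 6 * 6 + 5 + (m.reg 5 * 25 + 5) + 1) + 1) (by omega)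
  rintro m1 ⟨h18, h19, h28, h32, h33⟩ hf1
  have f1 : ∀ i, i < 18 → m1.reg i = m.reg i := fun i hi =>
    hf1.reg i (by simp [decodeSample, divMod, Prog.WritesReg]; omega)
  have fa : m1.arr a = m.arr a := hf1.arr a (by simp [decodeSample, divMod, Prog.WritesArr])
  refine Tri.seq (Tri.mono (clearCells_spec a (by rw [f1 2 (by norm_num), h2])
    (by rw [f1 3 (by norm_num), h3])) (by rw [f1 6 (by norm_num)]) ?_)
  intro m2 h2a hf2
  rw [f1 6 (by norm_num), fa] at h2a
  have f2 : ∀ i, i ≠ 21 → i ≠ 22 → m2.reg i = m1.reg i := fun i hi hi' =>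
    hf2.reg i (by simp [forLoop, Prog.WritesReg]; omega)
  have f2' : ∀ i, i < 18 → m2.reg i = m.reg i := fun i hi =>
    (f2 i (by omega) (by omega)).trans (f1 i hi)
  have e0 := f2' 0 (by norm_num)
  have e2 := f2' 2 (by norm_num)
  have e3 := f2' 3 (by norm_num)
  have e5 := f2' 5 (by norm_num)
  have e6 := f2' 6 (by norm_num)
  have e28 := f2 28 (by norm_num) (by norm_num)
  refine Tri.mono (writeColumns_spec a (by rw [e2, h2]) (by rw [e3, h3])
    (m.arr 1 (m.reg 27 % m.reg 4)) (m.arr 2 (m.reg 27 % m.reg 4)) (by rw [e0]; omega)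
    (by rw [e0]; omega) (by omega) (by rw [f2 18 (by norm_num) (by norm_num), h18])
    (by rw [f2 19 (by norm_num) (by norm_num), h19]) (m.reg 27 / m.reg 4 / m.reg 5)
    (by rw [f2 32 (by norm_num) (by norm_num), h32])
    (by rw [f2 33 (by norm_num) (by norm_num), h33]) (by rw [e0, e5, e6, h6])
    (by intro j hj; rw [e6] at hj; rw [h2a, if_pos hj])) (by rw [e5]) ?_
  intro m3 h3a _ j
  rw [h3a, e0, e6, e28, h28, h2a]
  unfold SampleBit
  split <;> congr

/-! ### Simulation of a learner -/

/-- A bit string as the contents of an array. -/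
def bitArray {N : ℕ} (x : Fin N → Bool) (j : ℕ) : ℕ :=
  if h : j < N then (x ⟨j, h⟩).toNat else 0

open Classical in
/-- The target function of the reduction. -/
noncomputable def target (n l k : ℕ) (U V : ℕ → ℕ) {N : ℕ} (x : Fin N → Bool) : Bool :=
  decide (EdgeRec n l k U V (bitArray x))

open Classical in
/-- The sample point with number `r`. -/
noncomputable def samplePt (n l k : ℕ) (U V : ℕ → ℕ) (N r : ℕ) : Fin N → Bool :=
  fun j => decide (SampleBit n l k U V r j)

/-- The uniform distribution on sample points `0, …, M`. -/
noncomputable def sampleDist (n l k : ℕ) (U V : ℕ → ℕ) (N M : ℕ) : PMF (Fin N → Bool) :=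
  (PMF.uniformOfFintype (Fin (M + 1))).map (fun r : Fin (M + 1) => samplePt n l k U V N r)

/-- Only cells below `l n` are read, and only compared with zero. Hence the arbitrary numbers in a
learner's array act like the bit string they represent. -/
theorem EdgeRec.congr {n l k N : ℕ} {U V x y : ℕ → ℕ} (hl : 0 < l) (hN : N = l * n)
    (hU : ∀ e < k, U e < V e ∧ V e < n) (h : ∀ j < N, x j ≠ 0 ↔ y j ≠ 0) :
    EdgeRec n l k U V x ↔ EdgeRec n l k U V y := by
  have h1 : ∀ i < l, ∀ w < n, i * n + w < N := by
    intro i hi w hw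
    have : (i + 1) * n ≤ l * n := Nat.mul_le_mul_right _ hi
    rw [Nat.add_mul] at this
    omega
  unfold EdgeRec
  refine exists_congr (fun e => and_congr_right (fun he => and_congr ?_ ?_))
  · refine forall_congr' (fun w => forall_congr' (fun hw => ?_))
    rw [h w (by simpa using h1 0 hl w hw)]
  · refine forall_congr' (fun i => forall_congr' (fun hi => ?_))
    have := hU e he
    rw [h _ (h1 i hi _ (by omega)), h _ (h1 i hi _ this.2)]

/-- Simulation of a learner; its registers and arrays are shifted, and oracle calls are replaced
by programs. -/
def simulate : Prog LearnerCall → Prog Empty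
  -- The reduction's code uses scratch registers below `40` and arrays below `4`, so the shifts keep
  -- the learner's memory separate.
  | .skip => .skip
  | .const x c => .const (x + 40) c
  | .add x y z => .add (x + 40) (y + 40) (z + 40)
  | .sub x y z => .sub (x + 40) (y + 40) (z + 40)
  | .load x a y => .load (x + 40) (a + 4) (y + 40)
  | .store a y x => .store (a + 4) (y + 40) (x + 40)
  | .rand x y => .rand (x + 40) (y + 40)
  | .call (.query a x) => evalEdgeRec (a + 4) ;; .add (x + 40) 15 3
  | .call (.sample a x) =>
      .rand 27 8 ;; writeSample (a + 4) ;; evalEdgeRec (a + 4) ;; .add (x + 40) 15 3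
  | .seq p q => simulate p ;; simulate q
  | .ite x p q => .ite (x + 40) (simulate p) (simulate q)
  | .loop x p => .loop (x + 40) (simulate p)

/-- The memory `m'` represents the learner's memory `m`, and agrees with `m0` on the data of the
reduction. -/
structure Represents (m0 m m' : Mem) : Prop where
  reg : ∀ i, m'.reg (i + 40) = m.reg i
  arr : ∀ a, m'.arr (a + 4) = m.arr a
  low : ∀ i < 10, m'.reg i = m0.reg i
  fst : m'.arr 1 = m0.arr 1
  snd : m'.arr 2 = m0.arr 2

theorem Represents.setReg {m0 m m' : Mem} (H : Represents m0 m m') (x v : ℕ) :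
    Represents m0 (m.setReg x v) (m'.setReg (x + 40) v) := by
  refine ⟨fun i => ?_, H.arr, fun i hi => ?_, H.fst, H.snd⟩
  · simp [H.reg]
  · rw [Mem.setReg_reg, if_neg (by omega), H.low i hi]

theorem Represents.setCell {m0 m m' : Mem} (H : Represents m0 m m') (a i v : ℕ) :
    Represents m0 (m.setCell a i v) (m'.setCell (a + 4) i v) := by
  refine ⟨H.reg, fun b => ?_, H.low, ?_, ?_⟩
  · simp [H.arr]
  · simp [H.fst]
  · simp [H.snd]

/-- The reduction data are in place. -/
structure Ready (m : Mem) : Prop where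
  -- Layout: register `4` holds the number of edges, `5` of layers, `6` of variables; `8` is one
  -- less than the number of sample points, as `rand` expects.
  one : m.reg 2 = 1
  zero : m.reg 3 = 0
  edges : 0 < m.reg 4
  layers : 0 < m.reg 5
  vars : m.reg 6 = m.reg 5 * m.reg 0
  lt : ∀ e < m.reg 4, m.arr 1 e < m.arr 2 e ∧ m.arr 2 e < m.reg 0
  samples : m.reg 8 + 1 = 4 * m.reg 5 * m.reg 4

theorem Ready.of_eq {m m' : Mem} (H : Ready m) (hr : ∀ i < 10, m'.reg i = m.reg i)
    (h1 : m'.arr 1 = m.arr 1) (h2 : m'.arr 2 = m.arr 2) : Ready m' := by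
  have a0 := hr 0 (by norm_num)
  have a2 := hr 2 (by norm_num)
  have a3 := hr 3 (by norm_num)
  have a4 := hr 4 (by norm_num)
  have a5 := hr 5 (by norm_num)
  have a6 := hr 6 (by norm_num)
  have a8 := hr 8 (by norm_num)
  constructor <;> simp only [a0, a2, a3, a4, a5, a6, a8, h1, h2]
  exacts [H.one, H.zero, H.edges, H.layers, H.vars, H.lt, H.samples]

/-- The target function for the reduction data in memory. -/
noncomputable def memTarget (m : Mem) : (Fin (m.reg 6) → Bool) → Bool :=
  target (m.reg 0) (m.reg 5) (m.reg 4) (m.arr 1) (m.arr 2)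

/-- The sample distribution for the reduction data in memory. -/
noncomputable def memDist (m : Mem) : PMF (Fin (m.reg 6) → Bool) :=
  sampleDist (m.reg 0) (m.reg 5) (m.reg 4) (m.arr 1) (m.arr 2) (m.reg 6) (m.reg 8)

/-- A time bound for the simulation of one step. -/
def stepCost (m : Mem) : ℕ :=
  -- With `k ≤ d n` and `l = C n` this is `O(n²)`, the overhead factor of the reduction.
  m.reg 4 * (25 * m.reg 0 + 25 * m.reg 5 + 30) + 100 * m.reg 5 + 6 * m.reg 6 + 150

theorem evalEdgeRec_writesReg {a i : ℕ} (h : (evalEdgeRec a).WritesReg i) : 15 ≤ i ∧ i < 27 := by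
  simp [evalEdgeRec, testLayerZero, testColumns, forLoop, Prog.WritesReg] at h
  omega

theorem evalEdgeRec_writesArr {a b : ℕ} : ¬ (evalEdgeRec a).WritesArr b := by
  simp [evalEdgeRec, testLayerZero, testColumns, forLoop, Prog.WritesArr]

theorem writeSample_writesReg {a i : ℕ} (h : (writeSample a).WritesReg i) : 18 ≤ i ∧ i < 35 := by
  simp [writeSample, decodeSample, divMod, forLoop, Prog.WritesReg] at h
  omega

theorem writeSample_writesArr {a b : ℕ} (h : (writeSample a).WritesArr b) : b = a := by
  simpa [writeSample, decodeSample, divMod, forLoop, Prog.WritesArr] using h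

theorem query_spec {m0 m m' : Mem} (hR : Ready m0) (H : Represents m0 m m') (a x : ℕ) :
    Tri (evalEdgeRec (a + 4) ;; .add (x + 40) 15 3) m'
      (m0.reg 4 * (25 * m0.reg 0 + 25 * m0.reg 5 + 30) + 12)
      (fun m'' => Represents m0
        (m.setReg x (memTarget m0 (m.readBits (m0.reg 6) a)).toNat) m'') := by
  classical
  have r0 := H.low 0 (by norm_num)
  have r2 := H.low 2 (by norm_num)
  have r3 := H.low 3 (by norm_num)
  have r4 := H.low 4 (by norm_num)
  have r5 := H.low 5 (by norm_num)
  refine Tri.time (Tri.seq (Tri.mono (evalEdgeRec_spec (a + 4) (by rw [r2, hR.one])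
    (by rw [r3, hR.zero])) le_rfl (fun m1 h15 hf => Tri.add ?_))) (by rw [r0, r4, r5])
  have hf' : ∀ i, i < 15 ∨ 27 ≤ i → m1.reg i = m'.reg i := fun i hi => hf.reg i (fun h => by
    have := evalEdgeRec_writesReg h; omega)
  have hfa : ∀ b, m1.arr b = m'.arr b := fun b => hf.arr b evalEdgeRec_writesArr
  have hv : m1.reg 15 + m1.reg 3 = (memTarget m0 (m.readBits (m0.reg 6) a)).toNat := by
    rw [hf' 3 (by norm_num), r3, hR.zero, h15, r0, r4, r5, H.fst, H.snd, H.arr]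
    have : EdgeRec (m0.reg 0) (m0.reg 5) (m0.reg 4) (m0.arr 1) (m0.arr 2) (m.arr a) ↔
        EdgeRec (m0.reg 0) (m0.reg 5) (m0.reg 4) (m0.arr 1) (m0.arr 2)
          (bitArray (m.readBits (m0.reg 6) a)) := by
      refine EdgeRec.congr hR.layers hR.vars hR.lt (fun j hj => ?_)
      simp [bitArray, hj, Mem.readBits]
    simp only [this, memTarget, target]
    split <;> simp [*]
  rw [hv]
  have H1 : Represents m0 m m1 := by
    refine ⟨fun i => ?_, fun b => ?_, fun i hi => ?_, ?_, ?_⟩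
    · rw [hf' _ (by omega), H.reg]
    · rw [hfa, H.arr]
    · rw [hf' _ (by omega), H.low i hi]
    · rw [hfa, H.fst]
    · rw [hfa, H.snd]
  exact H1.setReg _ _

theorem sample_spec {m0 m m' : Mem} (hR : Ready m0) (H : Represents m0 m m') (a x : ℕ)
    (hr : m'.reg 27 < m0.reg 8 + 1) :
    Tri (writeSample (a + 4) ;; evalEdgeRec (a + 4) ;; .add (x + 40) 15 3) m' (stepCost m0 - 2)
      (fun m'' => Represents m0
        ((m.writeBits a (samplePt (m0.reg 0) (m0.reg 5) (m0.reg 4) (m0.arr 1) (m0.arr 2)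
          (m0.reg 6) (m'.reg 27))).setReg x
          (memTarget m0 (samplePt (m0.reg 0) (m0.reg 5) (m0.reg 4) (m0.arr 1) (m0.arr 2)
          (m0.reg 6) (m'.reg 27))).toNat) m'') := by
  classical
  set v := samplePt (m0.reg 0) (m0.reg 5) (m0.reg 4) (m0.arr 1) (m0.arr 2)
          (m0.reg 6) (m'.reg 27) with hv
  have hR' := hR.of_eq H.low H.fst H.snd
  refine Tri.time (Tri.seq (Tri.mono (writeSample_spec (a + 4) hR'.one hR'.zero hR'.edges
    hR'.layers hR'.vars hR'.lt (by rw [← hR'.samples, H.low 8 (by norm_num)]; exact hr)) le_rfl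
    (fun m1 h1 hf => Tri.mono (query_spec (m := m.writeBits a v) hR ?_ a x) le_rfl ?_))) ?_
  · rw [H.low 0 (by norm_num), H.low 4 (by norm_num), H.low 5 (by norm_num),
      H.low 6 (by norm_num), H.fst, H.snd] at h1
    have hf' : ∀ i, i < 15 ∨ 35 ≤ i → m1.reg i = m'.reg i := fun i hi => hf.reg i (fun h => by
      have := writeSample_writesReg h; omega)
    have hfa : ∀ b, b ≠ a + 4 → m1.arr b = m'.arr b :=
      fun b hb => hf.arr b (fun h => hb (writeSample_writesArr h))
    refine ⟨fun i => ?_, fun b => ?_, fun i hi => ?_, ?_, ?_⟩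
    · rw [hf' _ (by omega), H.reg]; rfl
    · by_cases hb : b = a
      · subst hb
        ext j
        rw [h1, H.arr]
        simp only [Mem.writeBits, Function.update_self]
        by_cases hj : j < m0.reg 6
        · simp only [hj, if_true, dif_pos, hv, samplePt]
          split <;> simp [*]
        · simp [hj]
      · rw [hfa _ (by omega), H.arr]
        simp [Mem.writeBits, hb]
    · rw [hf' _ (by omega), H.low i hi]
    · rw [hfa _ (by omega), H.fst]
    · rw [hfa _ (by omega), H.snd]
  · intro m2 h2 _
    have : (m.writeBits a v).readBits (m0.reg 6) a = v := by
      funext j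
      simp [Mem.readBits, Mem.writeBits]
    rwa [this] at h2
  · rw [H.low 5 (by norm_num), H.low 6 (by norm_num), stepCost]
    omega

/-- The outcome type `Fin (m.reg y + 1)` depends on the memory. Naming the bound lets learner and
simulator draw from literally the same type. -/
theorem step_rand {O : Type} {h : O → Mem → PMF Mem} {x y N : ℕ} {k : List (Prog O)} {m : Mem}
    (hN : m.reg y = N) : step h (.rand x y :: k, m) =
      (PMF.uniformOfFintype (Fin (N + 1))).map (fun v : Fin (N + 1) => (k, m.setReg x v)) := by
  subst hN
  change PMF.map _ (PMF.bind _ (fun a => PMF.pure _)) = _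
  simp [PMF.map, PMF.bind_bind, Function.comp_def]

/-- Induction on the number of learner steps, for arbitrary stacks: each step is matched within
`stepCost`, and random steps are averaged over the same outcomes. As `q` is the indicator of `PL`,
the continuation only has to succeed on final memories that satisfy `PL`, and the learner's
probability of `PL` carries over. -/
theorem simulate_good {m0 : Mem} (hR : Ready m0) {k : List (Prog Empty)} {P PL : Mem → Prop}
    {T : ℕ} (q : Mem → ENNReal)
    (hq : ∀ m, q m = probMem (PMF.pure (([], m) : Config LearnerCall)) PL)
    (hk : ∀ m m', Represents m0 m m' → Good noOracle T (k, m') P (q m)) (t : ℕ)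
    (K : List (Prog LearnerCall)) (m m' : Mem) (H : Represents m0 m m')
    (hh : AlwaysHalted (run (learnerOracle (memTarget m0) (memDist m0)) t (K, m))) :
    Good noOracle (T + stepCost m0 * t) (K.map simulate ++ k, m') P
      (probMem (run (learnerOracle (memTarget m0) (memDist m0)) t (K, m)) PL) := by
  induction t generalizing K m m' with
  | zero =>
    cases K with
    | nil => simpa [run, hq] using hk m m' H
    | cons p K => simp [run, AlwaysHalted] at hh
  | succ t ih =>
    set L := learnerOracle (memTarget m0) (memDist m0) with hL
    have hS : 150 ≤ stepCost m0 := by unfold stepCost; omega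
    have hS1 : T + stepCost m0 * t + stepCost m0 = T + stepCost m0 * (t + 1) := by ring
    cases K with
    | nil =>
      rw [run_nil, ← hq]
      exact (hk m m' H).mono (by omega)
    | cons p K =>
      have hpure : ∀ c1 : Config LearnerCall, ∀ mh : Mem, step L (p :: K, m) = PMF.pure c1 →
          Represents m0 c1.2 mh → Good noOracle (T + stepCost m0 * t)
            (c1.1.map simulate ++ k, mh) P (probMem (run L (t + 1) (p :: K, m)) PL) := by
        intro c1 mh hs hr
        rw [run_succ_pure hs] at hh ⊢
        exact ih _ _ _ hr hh
      cases p with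
      | skip =>
        exact ((hpure (K, m) m' rfl H).of_step (c := (.skip :: _, m')) rfl).mono (by omega)
      | const x c =>
        exact ((hpure (K, m.setReg x c) _ rfl (H.setReg _ _)).of_step
          (c := (.const (x + 40) c :: _, m')) rfl).mono (by omega)
      | add x y z =>
        refine ((hpure (K, m.setReg x (m.reg y + m.reg z)) _ rfl (H.setReg _ _)).of_step
          (c := (.add (x + 40) (y + 40) (z + 40) :: _, m')) ?_).mono (by omega)
        rw [← H.reg, ← H.reg]; rfl
      | sub x y z =>
        refine ((hpure (K, m.setReg x (m.reg y - m.reg z)) _ rfl (H.setReg _ _)).of_step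
          (c := (.sub (x + 40) (y + 40) (z + 40) :: _, m')) ?_).mono (by omega)
        rw [← H.reg, ← H.reg]; rfl
      | load x a y =>
        refine ((hpure (K, m.setReg x (m.arr a (m.reg y))) _ rfl (H.setReg _ _)).of_step
          (c := (.load (x + 40) (a + 4) (y + 40) :: _, m')) ?_).mono (by omega)
        rw [← H.reg, ← H.arr]; rfl
      | store a y x =>
        refine ((hpure (K, m.setCell a (m.reg y) (m.reg x)) _ rfl (H.setCell _ _ _)).of_step
          (c := (.store (a + 4) (y + 40) (x + 40) :: _, m')) ?_).mono (by omega)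
        rw [← H.reg, ← H.reg]; rfl
      | seq p q =>
        exact ((hpure (p :: q :: K, m) m' rfl H).of_step
          (c := (.seq (simulate p) (simulate q) :: _, m')) rfl).mono (by omega)
      | ite x p q =>
        refine ((hpure ((if m.reg x ≠ 0 then p else q) :: K, m) m' rfl H).of_step
          (c := (.ite (x + 40) (simulate p) (simulate q) :: _, m')) ?_).mono (by omega)
        simp only [step, H.reg]
        split <;> rfl
      | loop x p =>
        refine ((hpure (if m.reg x ≠ 0 then (p :: .loop x p :: K, m) else (K, m)) m' rfl ?_).of_step
          (c := (.loop (x + 40) (simulate p) :: _, m')) ?_).mono (by omega)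
        · split <;> exact H
        · simp only [step, H.reg]
          split <;> rfl
      | rand x y =>
        have hs : step L (.rand x y :: K, m) = (PMF.uniformOfFintype (Fin (m.reg y + 1))).map
          (fun v : Fin (m.reg y + 1) => (K, m.setReg x (v : ℕ))) :=
          step_rand rfl
        rw [run_succ_map hs, alwaysHalted_bind] at hh
        rw [run_succ_map hs, probMem_bind]
        refine (Good.of_step_map (c := (.rand (x + 40) (y + 40) :: (K.map simulate ++ k), m'))
          (F := fun v : Fin (m.reg y + 1) => (K.map simulate ++ k, m'.setReg (x + 40) (v : ℕ)))
          (step_rand (H.reg y)) (fun v hv => ih _ _ _ (H.setReg x v) (hh v hv))).mono (by omega)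
      | call o =>
        cases o with
        | query a x =>
          have hs : step L (.call (.query a x) :: K, m) = PMF.pure
              (K, m.setReg x (memTarget m0 (m.readBits (m0.reg 6) a)).toNat) := by
            simp [step, hL, learnerOracle, PMF.pure_map]
          refine ((query_spec hR H a x).good (fun mh hr _ => hpure _ mh hs hr)).mono ?_
          unfold stepCost at hS1 ⊢
          omega
        | sample a x =>
          have hs : step L (.call (.sample a x) :: K, m) =
              (PMF.uniformOfFintype (Fin (m0.reg 8 + 1))).map (fun r : Fin (m0.reg 8 + 1) => (K,
                (m.writeBits a (samplePt (m0.reg 0) (m0.reg 5) (m0.reg 4) (m0.arr 1) (m0.arr 2)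
                (m0.reg 6) r)).setReg x (memTarget m0 (samplePt (m0.reg 0) (m0.reg 5) (m0.reg 4)
                (m0.arr 1) (m0.arr 2) (m0.reg 6) r)).toNat)) := by
            simp only [step, hL, learnerOracle, memDist, sampleDist, PMF.map_comp]
            rfl
          rw [run_succ_map hs, alwaysHalted_bind] at hh
          rw [run_succ_map hs, probMem_bind]
          -- The two extra steps are the outer sequencing and the draw of the sample number.
          refine Good.mono (t := T + stepCost m0 * t + (stepCost m0 - 2) + 1 + 1) ?_ (by omega)
          refine Good.of_step (c' := (.rand 27 8 :: (writeSample (a + 4) ;; evalEdgeRec (a + 4) ;;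
            .add (x + 40) 15 3) :: (K.map simulate ++ k), m')) rfl ?_
          refine Good.of_step_map (μ := PMF.uniformOfFintype (Fin (m0.reg 8 + 1)))
            (F := fun v : Fin (m0.reg 8 + 1) => ((writeSample (a + 4) ;; evalEdgeRec (a + 4) ;;
              .add (x + 40) 15 3) :: (K.map simulate ++ k), m'.setReg 27 (v : ℕ)))
            (step_rand (H.low 8 (by norm_num))) ?_
          · intro v hv
            have H' : Represents m0 m (m'.setReg 27 v) := by
              refine ⟨fun i => ?_, H.arr, fun i hi => ?_, H.fst, H.snd⟩
              · rw [Mem.setReg_reg, if_neg (by omega), H.reg]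
              · rw [Mem.setReg_reg, if_neg (by omega), H.low i hi]
            refine (sample_spec hR H' a x ?_).good (fun mh hr _ => ?_)
            · simpa using v.2
            · have e : (m'.setReg 27 (v : ℕ)).reg 27 = v := by simp
              rw [e] at hr
              exact ih _ _ _ hr (hh v hv)

/-! ### Trees in memory -/

/-- The array `x` contains the list `L` from address `p` on. -/
def Holds (x : ℕ → ℕ) (p : ℕ) (L : List ℕ) : Prop :=
  ∀ (i : ℕ) (h : i < L.length), x (p + i) = L[i]

theorem holds_cons {x : ℕ → ℕ} {p c : ℕ} {L : List ℕ} :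
    Holds x p (c :: L) ↔ x p = c ∧ Holds x (p + 1) L := by
  constructor
  · intro h
    refine ⟨h 0 (by simp), fun i hi => ?_⟩
    have := h (i + 1) (by simpa using hi)
    rw [Nat.add_assoc, Nat.add_comm 1]
    exact this
  · rintro ⟨h0, h⟩ i hi
    cases i with
    | zero => exact h0
    | succ i =>
      have := h i (by simpa using hi)
      rw [Nat.add_assoc, Nat.add_comm 1] at this
      exact this

theorem holds_nil {x : ℕ → ℕ} {p : ℕ} : Holds x p [] := fun i h => by simp at h

theorem holds_append {x : ℕ → ℕ} {p : ℕ} {L L' : List ℕ} :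
    Holds x p (L ++ L') ↔ Holds x p L ∧ Holds x (p + L.length) L' := by
  induction L generalizing p with
  | nil => simp [holds_nil]
  | cons c L ih =>
    rw [List.cons_append, holds_cons, holds_cons, ih, and_assoc, List.length_cons,
      Nat.add_assoc p 1, Nat.add_comm 1]

theorem DTree.listing_length {N : ℕ} (T : DTree N) : T.listing.length + 1 = 2 * T.size := by
  induction T with
  | leaf b => simp [listing, size]
  | node i low high h1 h2 => simp only [listing, size, List.length_cons, List.length_append]; omega

/-- Preorder listings form a prefix code, so what memory contains beyond the listing is irrelevant.
-/
theorem Holds.tree_unique {N : ℕ} {x : ℕ → ℕ} {p : ℕ} {T T' : DTree N}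
    (h : Holds x p T.listing) (h' : Holds x p T'.listing) : T = T' := by
  induction T generalizing p T' with
  | leaf b =>
    cases T' with
    | leaf b' =>
      simp only [DTree.listing, holds_cons] at h h'
      have := h.1.symm.trans h'.1
      cases b <;> cases b' <;> simp_all
    | node i low high =>
      simp only [DTree.listing, holds_cons] at h h'
      have := h.1.symm.trans h'.1
      cases b <;> simp at this
  | node i low high h1 h2 =>
    cases T' with
    | leaf b =>
      simp only [DTree.listing, holds_cons] at h h'
      have := h.1.symm.trans h'.1
      cases b <;> simp at this
    | node i' low' high' =>
      simp only [DTree.listing, holds_cons, holds_append] at h h'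
      have hi := h.1.symm.trans h'.1
      have hl := h1 h.2.1 h'.2.1
      subst hl
      have hh := h2 h.2.2 h'.2.2
      subst hh
      congr 1
      ext; omega

/-- The concatenated listings of some trees. -/
def forest {N : ℕ} (Ts : List (DTree N)) : List ℕ :=
  (Ts.map DTree.listing).flatten

@[simp] theorem forest_nil {N : ℕ} : forest ([] : List (DTree N)) = [] := rfl

@[simp] theorem forest_leaf {N : ℕ} (b : Bool) (Ts : List (DTree N)) :
    forest (.leaf b :: Ts) = b.toNat :: forest Ts := rfl

@[simp] theorem forest_node {N : ℕ} (i : Fin N) (low high : DTree N) (Ts : List (DTree N)) :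
    forest (.node i low high :: Ts) = ((i : ℕ) + 2) :: forest (low :: high :: Ts) := by
  simp [forest, DTree.listing]

/-- From address `p` on, array `y` contains `q` trees and then a tree whose value at `x` is that
of `T`. -/
def EvalState {N : ℕ} (y : ℕ → ℕ) (T : DTree N) (x : Fin N → Bool) (q p : ℕ) : Prop :=
  ∃ (Ts : List (DTree N)) (T' : DTree N), Ts.length = q ∧ Holds y p (forest (Ts ++ [T'])) ∧
    T'.eval x = T.eval x ∧ p + (forest (Ts ++ [T'])).length ≤ T.listing.length

/-- Evaluates the tree in array `4` at the bit string in array `3`. -/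
def evalTree : Prog Empty :=
  -- Register `34` is the position, `35` the number of subtrees to skip, `36` the loop flag. A
  -- listing has no pointer to the high subtree, so the answer `1` skips one subtree; while
  -- skipping, an internal node adds one pending subtree and a leaf removes one.
  .const 34 0 ;; .const 35 0 ;; .const 36 1 ;; .const 37 0 ;; .loop 36 (
    .load 23 4 34 ;; .add 34 34 2 ;; .sub 24 23 2 ;;
    .ite 35 (.ite 24 (.add 35 35 2) (.sub 35 35 2))
      (.ite 24 (.sub 24 24 2 ;; .load 25 3 24 ;; .ite 25 (.add 35 35 2) .skip)
        (.add 37 23 3 ;; .const 36 0)))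

theorem evalTree_spec {N : ℕ} (T : DTree N) (x : Fin N → Bool) {m : Mem} (h2 : m.reg 2 = 1)
    (h3 : m.reg 3 = 0) (hT : Holds (m.arr 4) 0 T.listing)
    (hx : ∀ j : Fin N, m.arr 3 j ≠ 0 ↔ x j = true) :
    Tri evalTree m (T.listing.length * 20 + 40) (fun m' => m'.reg 37 = (T.eval x).toNat) := by
  refine Tri.time (T := 1 + (1 + (1 + (1 + ((T.listing.length + 1) * (15 + 1) + 1) + 1) + 1) + 1)
    + 1) (Tri.seq (Tri.const (Tri.seq (Tri.const (Tri.seq (Tri.const (Tri.seq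
    (Tri.const (Tri.mono (Tri.loop (T := 15)
    (fun m' => (m'.reg 36 = 0 ∧ m'.reg 37 = (T.eval x).toNat) ∨ (m'.reg 36 = 1 ∧
      EvalState (m.arr 4) T x (m'.reg 35) (m'.reg 34)))
    -- The position advances in every round and stays within the listing by the last clause of
    -- `EvalState`; the final leaf clears the flag.
    (fun m' => if m'.reg 36 = 0 then 0 else T.listing.length + 1 - m'.reg 34) ?_ ?_)
    ?_ ?_))))))))) (by omega)
  · right
    refine ⟨by simp, [], T, by simp, ?_, rfl, ?_⟩
    · simpa [forest] using hT
    · simp [forest]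
  · intro m1 hf hI h36
    have f2 := hf.reg 2 (by simp [Prog.WritesReg])
    have f3 := hf.reg 3 (by simp [Prog.WritesReg])
    have fa : ∀ b, m1.arr b = m.arr b := fun b => hf.arr b (by simp [Prog.WritesArr])
    simp [h2, h3] at f2 f3
    rcases hI with ⟨h, -⟩ | ⟨h1, Ts, T', hlen, hH, hev, hle⟩
    · exact absurd h h36
    refine Tri.time (Tri.loopFree (by simp [Prog.LoopFree]) ?_)
      (by simp [Prog.cost])
    cases Ts with
    | nil =>
      have h35 : m1.reg 35 = 0 := by simpa using hlen.symm
      cases T' with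
      | leaf b =>
        simp only [List.nil_append, forest_leaf, forest_nil, holds_cons] at hH
        have hb : b.toNat - 1 = 0 := by cases b <;> rfl
        rw [DTree.eval] at hev
        simp [Prog.exec, f2, f3, fa, hH.1, h35, hb, h1, ← hev]
        simp at hle
        omega
      | node i low high =>
        simp only [List.nil_append, forest_node, holds_cons] at hH hle
        simp only [List.length_cons] at hle
        rw [DTree.eval] at hev
        have hi : m.arr 3 i = 0 ↔ ¬ x i = true := by rw [← hx]; simp
        by_cases hxi : x i = true
        · have hi' : ¬ m.arr 3 i = 0 := (hx i).2 hxi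
          simp only [hxi, if_true] at hev
          simp [Prog.exec, f2, fa, hH.1, h35, h1, hi']
          exact ⟨⟨[low], high, rfl, hH.2, hev, by simp only [List.cons_append, List.nil_append]; omega⟩,
            by omega⟩
        · have hi' := hi.2 hxi
          simp only [hxi] at hev
          simp [Prog.exec, f2, fa, hH.1, h35, h1, hi']
          -- On the answer `0` the high subtree is dropped from the tracked region and never read.
          have : forest [low, high] = forest [low] ++ forest [high] := by simp [forest]
          rw [this, holds_append] at hH
          rw [this, List.length_append] at hle
          exact ⟨⟨[], low, rfl, hH.2.1, by simpa using hev, by simp only [List.nil_append]; omega⟩,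
            by omega⟩
    | cons T1 Ts =>
      have h35 : m1.reg 35 = Ts.length + 1 := by simpa using hlen.symm
      cases T1 with
      | leaf b =>
        simp only [List.cons_append, forest_leaf, holds_cons] at hH hle
        simp only [List.length_cons] at hle
        have hb : b.toNat - 1 = 0 := by cases b <;> rfl
        simp [Prog.exec, f2, fa, hH.1, h35, hb, h1]
        exact ⟨⟨Ts, T', rfl, hH.2, hev, by omega⟩, by omega⟩
      | node i low high =>
        simp only [List.cons_append, forest_node, holds_cons] at hH hle
        simp only [List.length_cons] at hle
        simp [Prog.exec, f2, fa, hH.1, h35, h1]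
        exact ⟨⟨low :: high :: Ts, T', by simp, hH.2, hev, by simp only [List.cons_append]; omega⟩,
          by omega⟩
  · simp
  · rintro m' ⟨h | h, h36⟩ -
    · exact h.2
    · rw [h36] at h; simp at h

/-- Scans the listing of a tree in array `4`, with at most as many steps as register `38` says.
Afterwards register `35` is the number of missing subtrees, register `36` the number of leaves and
register `37` is nonzero if an illegal variable has occurred. -/
def parseTree : Prog Empty :=
  .const 34 0 ;; .const 35 1 ;; .const 36 0 ;; .const 37 0 ;; .add 30 38 3 ;; .loop 30 (
    .load 23 4 34 ;; .add 34 34 2 ;; .sub 38 38 2 ;; .sub 24 23 2 ;;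
    .ite 24 (.add 35 35 2 ;; .sub 24 24 2 ;; .sub 25 6 24 ;; .ite 25 .skip (.const 37 1))
      (.sub 35 35 2 ;; .add 36 36 2) ;;
    .ite 35 (.add 30 38 3) (.const 30 0))

theorem parseTree_spec {N : ℕ} {m : Mem} (h2 : m.reg 2 = 1) (h3 : m.reg 3 = 0)
    (h6 : m.reg 6 = N) :
    Tri parseTree m (m.reg 38 * 25 + 20) (fun m' =>
      (m'.reg 35 = 0 → m'.reg 37 = 0 →
        ∃ T : DTree N, Holds (m.arr 4) 0 T.listing ∧ T.size = m'.reg 36) ∧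
      ∀ T : DTree N, Holds (m.arr 4) 0 T.listing → T.listing.length ≤ m.reg 38 →
        m'.reg 35 = 0 ∧ m'.reg 37 = 0) := by
  refine Tri.time (T := 1 + (1 + (1 + (1 + (1 + (m.reg 38 * (24 + 1) + 1) + 1) + 1) + 1) + 1)
    + 1) (Tri.seq (Tri.const (Tri.seq (Tri.const (Tri.seq (Tri.const (Tri.seq
    (Tri.const (Tri.seq (Tri.add (Tri.mono (Tri.loop (T := 24)
    -- Two-sided invariant: any forest filling the open positions completes the prefix read so far
    -- to a tree, and a tree that fits the fuel leaves such a forest ahead. These give soundness and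
    -- completeness of the scan.
    (fun m' => (m'.reg 37 = 0 → ∀ Ts : List (DTree N), Ts.length = m'.reg 35 →
        Holds (m.arr 4) (m'.reg 34) (forest Ts) →
        ∃ T : DTree N, Holds (m.arr 4) 0 T.listing ∧
          T.size = m'.reg 36 + (Ts.map DTree.size).sum) ∧
      (∀ T : DTree N, Holds (m.arr 4) 0 T.listing → T.listing.length ≤ m.reg 38 →
        ∃ Ts : List (DTree N), Ts.length = m'.reg 35 ∧
        Holds (m.arr 4) (m'.reg 34) (forest Ts) ∧ m'.reg 37 = 0 ∧
        (forest Ts).length ≤ m'.reg 38) ∧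
      m'.reg 30 = if m'.reg 35 = 0 then 0 else m'.reg 38)
    (fun m' => m'.reg 30) ?_ ?_)
    ?_ ?_))))))))))) (by omega)
  · refine ⟨?_, ?_, by simp [h3]⟩
    · intro _ Ts hlen hH
      simp only [Mem.setReg_reg] at hlen hH
      obtain ⟨T, rfl⟩ := List.length_eq_one_iff.1 (by simpa using hlen)
      exact ⟨T, by simpa [forest] using hH, by simp⟩
    · intro T hT hle
      exact ⟨[T], by simp, by simpa [forest] using hT, by simp, by simpa [forest] using hle⟩
  · rintro m1 hf ⟨hA, hB, hC⟩ h30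
    have f2 := hf.reg 2 (by simp [Prog.WritesReg])
    have f3 := hf.reg 3 (by simp [Prog.WritesReg])
    have f6 := hf.reg 6 (by simp [Prog.WritesReg])
    have fa : ∀ b, m1.arr b = m.arr b := fun b => hf.arr b (by simp [Prog.WritesArr])
    simp [h2, h3, h6] at f2 f3 f6
    have h35 : m1.reg 35 ≠ 0 := fun h => h30 (by rw [hC, if_pos h])
    rw [if_neg h35] at hC
    refine Tri.time (Tri.loopFree (by simp [Prog.LoopFree]) ?_) (by simp [Prog.cost])
    set c := m.arr 4 (m1.reg 34) with hc
    by_cases hleaf : c - 1 = 0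
    · have hd : ∃ b : Bool, c = b.toNat := by
        rcases Nat.lt_or_ge c 1 with h | h
        · exact ⟨false, by simp; omega⟩
        · exact ⟨true, by simp; omega⟩
      obtain ⟨b, hb⟩ := hd
      have hA' : m1.reg 37 = 0 → ∀ Ts : List (DTree N), Ts.length = m1.reg 35 - 1 →
          Holds (m.arr 4) (m1.reg 34 + 1) (forest Ts) →
          ∃ T : DTree N, Holds (m.arr 4) 0 T.listing ∧
            T.size = m1.reg 36 + 1 + (Ts.map DTree.size).sum := by
        intro h37 Ts hl hH
        obtain ⟨T, hT, hs⟩ := hA h37 (.leaf b :: Ts) (by simp; omega)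
          (by rw [forest_leaf, holds_cons]; exact ⟨by rw [← hc, hb], hH⟩)
        exact ⟨T, hT, by simp [hs, DTree.size]; omega⟩
      have hB' : ∀ T : DTree N, Holds (m.arr 4) 0 T.listing → T.listing.length ≤ m.reg 38 →
          ∃ Ts : List (DTree N), Ts.length = m1.reg 35 - 1 ∧
          Holds (m.arr 4) (m1.reg 34 + 1) (forest Ts) ∧ m1.reg 37 = 0 ∧
          (forest Ts).length ≤ m1.reg 38 - 1 := by
        intro T hT hle
        obtain ⟨Ts, hl, hH, h37, hlen⟩ := hB T hT hle
        cases Ts with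
        | nil => exact absurd hl.symm h35
        | cons T1 Ts =>
          cases T1 with
          | leaf b' =>
            rw [forest_leaf, holds_cons] at hH
            simp at hl hlen
            exact ⟨Ts, by omega, hH.2, h37, by omega⟩
          | node i low high =>
            rw [forest_node, holds_cons] at hH
            have := hH.1
            omega
      simp only [Prog.exec, Mem.setReg_reg, fa, ← hc, f2]
      by_cases h351 : m1.reg 35 - 1 = 0
      · simp [h351, hleaf] at hA' hB' ⊢
        exact ⟨⟨hA', hB'⟩, by omega⟩
      · simp [h351, f3, hleaf] at hA' hB' ⊢
        exact ⟨⟨hA', hB'⟩, by omega⟩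
    · have hA' : c - 1 - 1 < N → m1.reg 37 = 0 → ∀ Ts : List (DTree N),
          Ts.length = m1.reg 35 + 1 →
          Holds (m.arr 4) (m1.reg 34 + 1) (forest Ts) →
          ∃ T : DTree N, Holds (m.arr 4) 0 T.listing ∧
            T.size = m1.reg 36 + (Ts.map DTree.size).sum := by
        intro hcN h37 Ts hl hH
        obtain ⟨T1, Ts, rfl⟩ := List.exists_cons_of_length_pos (l := Ts) (by omega)
        obtain ⟨T2, Ts, rfl⟩ := List.exists_cons_of_length_pos (l := Ts) (by simp at hl; omega)
        simp at hl
        obtain ⟨T, hT, hs⟩ := hA h37 (.node ⟨c - 1 - 1, hcN⟩ T1 T2 :: Ts) (by simp; omega)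
          (by rw [forest_node, holds_cons]; exact ⟨by rw [← hc]; simp; omega, hH⟩)
        exact ⟨T, hT, by simp [hs, DTree.size]; omega⟩
      have hB' : ∀ T : DTree N, Holds (m.arr 4) 0 T.listing → T.listing.length ≤ m.reg 38 →
          c - 1 - 1 < N ∧ ∃ Ts : List (DTree N), Ts.length = m1.reg 35 + 1 ∧
          Holds (m.arr 4) (m1.reg 34 + 1) (forest Ts) ∧ m1.reg 37 = 0 ∧
          (forest Ts).length ≤ m1.reg 38 - 1 := by
        intro T hT hle
        obtain ⟨Ts, hl, hH, h37, hlen⟩ := hB T hT hle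
        cases Ts with
        | nil => exact absurd hl.symm h35
        | cons T1 Ts =>
          cases T1 with
          | leaf b' =>
            rw [forest_leaf, holds_cons] at hH
            have := hH.1
            cases b' <;> simp at this <;> omega
          | node i low high =>
            rw [forest_node, holds_cons] at hH
            have := i.2
            have := hH.1
            rw [forest_node, List.length_cons] at hlen
            simp at hl
            exact ⟨by omega, low :: high :: Ts, by simp; omega, hH.2, h37, by omega⟩
      simp only [Prog.exec, Mem.setReg_reg, fa, ← hc, f2]
      by_cases hcN : c - 1 - 1 < N
      · have hcN' : ¬ (N - (c - 1 - 1) = 0) := by omega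
        replace hA' := hA' hcN
        replace hB' := fun T h h' => (hB' T h h').2
        simp [hcN', f3, f6, hleaf] at hA' hB' ⊢
        exact ⟨⟨hA', hB'⟩, by omega⟩
      · have hcN' : N - (c - 1 - 1) = 0 := by omega
        -- An illegal variable rules out every tree within the fuel, and the raised flag makes the
        -- first clause vacuous.
        have hB'' : ∀ T : DTree N, Holds (m.arr 4) 0 T.listing → ¬ T.listing.length ≤ m.reg 38 :=
          fun T h h' => hcN (hB' T h h').1
        simp [hcN', f3, f6, hleaf]
        exact ⟨fun T h => not_le.1 (hB'' T h), by omega⟩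
  · simp [h3]
  · rintro m' ⟨⟨hA, hB, hC⟩, h30⟩ -
    constructor
    · intro h35 h37
      obtain ⟨T, hT, hs⟩ := hA h37 [] (by simp [h35]) holds_nil
      exact ⟨T, hT, by simpa using hs⟩
    · intro T hT hle
      obtain ⟨Ts, hl, hH, h37, hlen⟩ := hB T hT hle
      refine ⟨?_, h37⟩
      -- If subtrees are missing when the loop ends, the fuel is used up; but a nonempty forest has
      -- a nonempty listing.
      by_contra h35
      rw [if_neg h35, h30] at hC
      rw [← hC] at hlen
      cases Ts with
      | nil => exact h35 hl.symm
      | cons T1 Ts => cases T1 <;> simp at hlen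

/-! ### Arithmetic -/

/-- `x := c * y` for a constant `c`. -/
def mulConst (x y : ℕ) : ℕ → Prog Empty
  | 0 => .const x 0
  | c + 1 => mulConst x y c ;; .add x x y

theorem mulConst_writesReg {x y c i : ℕ} (h : (mulConst x y c).WritesReg i) : i = x := by
  induction c with
  | zero => exact h
  | succ c ih => exact h.elim ih id

theorem mulConst_writesArr {x y c a : ℕ} : ¬ (mulConst x y c).WritesArr a := by
  induction c with
  | zero => exact id
  | succ c ih => exact fun h => h.elim ih id

theorem mulConst_spec {x y : ℕ} (hxy : x ≠ y) (c : ℕ) (m : Mem) :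
    Tri (mulConst x y c) m (2 * c + 1) (fun m' => m'.reg x = c * m.reg y) := by
  induction c with
  | zero => exact Tri.const (by simp)
  | succ c ih =>
    refine Tri.time (Tri.seq (ih.mono le_rfl (fun m1 h hf => Tri.add ?_)))
      (T := 2 * c + 1 + 1 + 1) (by omega)
    have := hf.reg y (fun h => hxy (mulConst_writesReg h).symm)
    simp [h, this, Nat.add_mul]

/-- `x := y * z`. -/
def mulReg (x y z : ℕ) : Prog Empty :=
  .const x 0 ;; forLoop 16 17 z (.add x x y)

theorem mulReg_spec {x y z : ℕ} (hx : x < 16 ∧ x ≠ 2 ∧ x ≠ 3) (hy : y < 16) (hz : z < 16)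
    (hxy : x ≠ y) (hxz : x ≠ z) {m : Mem} (h2 : m.reg 2 = 1) (h3 : m.reg 3 = 0) :
    Tri (mulReg x y z) m (m.reg z * 6 + 10) (fun m' => m'.reg x = m.reg y * m.reg z) := by
  refine Tri.time (Tri.seq (Tri.const (Tri.forLoop (T := 1) (m.reg z)
    (fun j m' => m'.reg x = m.reg y * j) ?_ ?_ ?_ ?_ ?_ ?_ ?_)))
    (T := 1 + (m.reg z * (1 + 5) + 5) + 1) (by omega)
  · simp [hx.2.1.symm, h2]
  · simp [hx.2.2.symm, h3]
  · simp [hxz.symm]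
  · omega
  · simp [Prog.WritesReg]; omega
  · simp; omega
  · intro j hj m1 hf hj1 hI
    have fy := hf.reg y (by simp [forLoop, Prog.WritesReg]; omega)
    refine Tri.add ?_
    simp only [Mem.setReg_reg, if_true, hI, fy, Ne.symm hxy, if_false]
    rw [if_neg (by omega), if_neg (by omega)]
    ring

/-! ### The check of the learner's output -/

theorem Ready.sampleBit_iff {m : Mem} {r : ℕ} (j : Fin (m.reg 6)) :
    SampleBit (m.reg 0) (m.reg 5) (m.reg 4) (m.arr 1) (m.arr 2) r j ↔
      samplePt (m.reg 0) (m.reg 5) (m.reg 4) (m.arr 1) (m.arr 2) (m.reg 6) r j = true := by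
  simp [samplePt]

/-- The tree errs at the sample point with number `r`. -/
def Errs (m : Mem) (T : DTree (m.reg 6)) (r : ℕ) : Prop :=
  T.eval (samplePt (m.reg 0) (m.reg 5) (m.reg 4) (m.arr 1) (m.arr 2) (m.reg 6) r) ≠
    memTarget m (samplePt (m.reg 0) (m.reg 5) (m.reg 4) (m.arr 1) (m.arr 2) (m.reg 6) r)

open Classical in
/-- The number of sample points below `M` at which the tree errs. -/
noncomputable def numErrs (m : Mem) (T : DTree (m.reg 6)) (M : ℕ) : ℕ :=
  ((Finset.range M).filter (Errs m T)).card

/-- Decides whether the tree in array `4` errs at the sample point with number in register `27`. -/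
def testSample : Prog Empty :=
  -- Array `3` is scratch for the sample point; array `4` is the learner's output array `0` after
  -- the shift.
  writeSample 3 ;; evalEdgeRec 3 ;; evalTree ;; .sub 23 15 37 ;; .sub 24 37 15 ;; .add 23 23 24

theorem evalTree_writesReg {i : ℕ} (h : evalTree.WritesReg i) : 23 ≤ i ∧ i < 38 := by
  simp [evalTree, Prog.WritesReg] at h
  omega

theorem evalTree_writesArr {a : ℕ} : ¬ evalTree.WritesArr a := by
  simp [evalTree, Prog.WritesArr]

theorem testSample_spec {m0 m : Mem} (hR : Ready m0) (hlow : ∀ i < 10, m.reg i = m0.reg i)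
    (h1 : m.arr 1 = m0.arr 1) (h2 : m.arr 2 = m0.arr 2) (T : DTree (m0.reg 6))
    (hT : Holds (m.arr 4) 0 T.listing) (hr : m.reg 27 < m0.reg 8 + 1) :
    Tri testSample m (stepCost m0 + T.listing.length * 20 + 60)
      (fun m' => m'.reg 23 ≠ 0 ↔ Errs m0 T (m.reg 27)) := by
  classical
  have hR' := hR.of_eq hlow h1 h2
  set v := samplePt (m0.reg 0) (m0.reg 5) (m0.reg 4) (m0.arr 1) (m0.arr 2) (m0.reg 6) (m.reg 27)
    with hv
  refine Tri.time (Tri.seq (Tri.mono (writeSample_spec 3 hR'.one hR'.zero hR'.edges hR'.layers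
    hR'.vars hR'.lt (by rw [← hR'.samples, hlow 8 (by norm_num)]; exact hr)) le_rfl
    (fun m1 k1 hf1 => Tri.seq (Tri.mono (evalEdgeRec_spec 3 ?_ ?_)
      (T' := m0.reg 4 * (25 * m0.reg 0 + 25 * m0.reg 5 + 30) + 10) ?_
    (fun m2 k2 hf2 => Tri.seq (Tri.mono (evalTree_spec T v ?_ ?_ ?_ ?_) le_rfl
    (fun m3 k3 hf3 => Tri.time (Tri.loopFree (by simp [Prog.LoopFree]) ?_) (T' := 5) le_rfl)))))))
    (?_ : _ ≤ stepCost m0 + T.listing.length * 20 + 60)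
  all_goals
    try
      have f1 : ∀ i, i < 10 → m1.reg i = m0.reg i := fun i hi =>
        (hf1.reg i (fun h => by have := writeSample_writesReg h; omega)).trans (hlow i hi)
      have g1 : ∀ a, a ≠ 3 → m1.arr a = m.arr a := fun a ha =>
        hf1.arr a (fun h => ha (writeSample_writesArr h))
  · rw [f1 2 (by norm_num), hR.one]
  · rw [f1 3 (by norm_num), hR.zero]
  · rw [f1 0 (by norm_num), f1 4 (by norm_num), f1 5 (by norm_num)]
  all_goals
    try
      have f2 : ∀ i, i < 10 → m2.reg i = m0.reg i := fun i hi =>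
        (hf2.reg i (fun h => by have := evalEdgeRec_writesReg h; omega)).trans (f1 i hi)
      have g2 : ∀ a, m2.arr a = m1.arr a := fun a => hf2.arr a evalEdgeRec_writesArr
      rw [hlow 0 (by norm_num), hlow 4 (by norm_num), hlow 5 (by norm_num),
        hlow 6 (by norm_num), h1, h2] at k1
  · rw [f2 2 (by norm_num), hR.one]
  · rw [f2 3 (by norm_num), hR.zero]
  · rw [g2, g1 4 (by norm_num)]; exact hT
  · intro j
    rw [g2, k1, if_pos j.2, hv, ← Ready.sampleBit_iff]
    simp
  · have e15 : m3.reg 15 = m2.reg 15 :=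
      hf3.reg 15 (fun h => by have := evalTree_writesReg h; omega)
    rw [f1 0 (by norm_num), f1 4 (by norm_num), f1 5 (by norm_num), g1 1 (by norm_num),
      g1 2 (by norm_num), h1, h2] at k2
    have hrec : EdgeRec (m0.reg 0) (m0.reg 5) (m0.reg 4) (m0.arr 1) (m0.arr 2) (m1.arr 3) ↔
        EdgeRec (m0.reg 0) (m0.reg 5) (m0.reg 4) (m0.arr 1) (m0.arr 2) (bitArray v) := by
      refine EdgeRec.congr hR.layers hR.vars hR.lt (fun j hj => ?_)
      rw [k1, if_pos hj]
      simp [bitArray, hj, hv, samplePt]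
    have hm : m2.reg 15 = (memTarget m0 v).toNat := by
      rw [k2]
      simp only [hrec, memTarget, target]
      split <;> rename_i h <;> simp [h]
    simp only [Prog.exec, Mem.setReg_reg, e15, hm, k3, Errs, ← hv]
    cases memTarget m0 v <;> cases T.eval v <;> simp
  · rw [hlow 5 (by norm_num), hlow 6 (by norm_num)]
    unfold stepCost
    omega

/-- Counts the errors of the tree in array `4`. -/
def countErrors : Prog Empty :=
  .const 12 0 ;; forLoop 13 14 9 (.add 27 13 3 ;; testSample ;; .ite 23 (.add 12 12 2) .skip)

theorem testSample_writesReg {i : ℕ} (h : testSample.WritesReg i) : 15 ≤ i ∧ i < 38 := by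
  simp only [testSample, Prog.WritesReg] at h
  rcases h with h | h | h | h | h | h
  · have := writeSample_writesReg h; omega
  · have := evalEdgeRec_writesReg h; omega
  · have := evalTree_writesReg h; omega
  all_goals omega

theorem testSample_writesArr {a : ℕ} (h : testSample.WritesArr a) : a = 3 := by
  simp only [testSample, Prog.WritesArr] at h
  rcases h with h | h | h | h | h | h
  · exact writeSample_writesArr h
  · exact absurd h evalEdgeRec_writesArr
  · exact absurd h evalTree_writesArr
  all_goals exact h.elim

theorem countErrors_spec {m0 m : Mem} (hR : Ready m0) (hlow : ∀ i < 10, m.reg i = m0.reg i)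
    (h1 : m.arr 1 = m0.arr 1) (h2 : m.arr 2 = m0.arr 2) (T : DTree (m0.reg 6))
    (hT : Holds (m.arr 4) 0 T.listing) (h9 : m0.reg 9 = m0.reg 8 + 1) :
    Tri countErrors m (m0.reg 9 * (stepCost m0 + T.listing.length * 20 + 80) + 10)
      (fun m' => m'.reg 12 = numErrs m0 T (m0.reg 9)) := by
  classical
  refine Tri.time (Tri.seq (Tri.const (Tri.forLoop
    (T := stepCost m0 + T.listing.length * 20 + 70) (m0.reg 9)
    (fun j m' => m'.reg 12 = numErrs m0 T j) ?_ ?_ ?_ (by decide) ?_ ?_ ?_)))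
    (T := 1 + (m0.reg 9 * ((stepCost m0 + T.listing.length * 20 + 70) + 5) + 5) + 1) ?_
  · simp [hlow 2, hR.one]
  · simp [hlow 3, hR.zero]
  · simp [hlow 9]
  · intro j hj
    simp only [Prog.WritesReg] at hj
    rcases hj with h | h | h | h
    · omega
    · have := testSample_writesReg h; omega
    · omega
    · exact h.elim
  · simp [numErrs]
  · intro j hj m1 hf hj1 hI
    have f1 : ∀ i, i < 12 → m1.reg i = m.reg i := by
      intro i hi
      rw [hf.reg i]
      · rw [Mem.setReg_reg, if_neg (by omega)]
      · simp only [forLoop, Prog.WritesReg]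
        rintro (h | h | (h | h | h | h) | h | h)
        · omega
        · omega
        · omega
        · have := testSample_writesReg h; omega
        · omega
        · exact h
        · omega
        · omega
    have g1 : ∀ a, a ≠ 3 → m1.arr a = m.arr a := by
      intro a ha
      rw [hf.arr a]
      · rfl
      · simp only [forLoop, Prog.WritesArr]
        rintro (h | h | (h | h | h | h) | h | h)
        all_goals first | exact h | exact ha (testSample_writesArr h)
    refine Tri.time (Tri.seq (Tri.add (Tri.seq (Tri.mono (testSample_spec hR (T := T) ?_ ?_ ?_ ?_ ?_)
      le_rfl (fun m2 h23 hf2 => Tri.time (T' := 2)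
        (Tri.loopFree (by simp [Prog.LoopFree]) ?_) le_rfl))))) ?_
    · intro i hi
      rw [Mem.setReg_reg, if_neg (by omega), f1 i (by omega), hlow i hi]
    · rw [Mem.setReg_arr, g1 1 (by norm_num), h1]
    · rw [Mem.setReg_arr, g1 2 (by norm_num), h2]
    · rw [Mem.setReg_arr, g1 4 (by norm_num)]; exact hT
    · simp only [Mem.setReg_reg, if_true]
      rw [f1 3 (by norm_num), hlow 3 (by norm_num), hR.zero, hj1]
      omega
    · have e12 := hf2.reg 12 (fun h => by have := testSample_writesReg h; omega)
      have e2 := hf2.reg 2 (fun h => by have := testSample_writesReg h; omega)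
      simp only [Mem.setReg_reg, if_true] at h23 e12 e2
      rw [if_neg (by norm_num), hI] at e12
      rw [if_neg (by norm_num), f1 2 (by norm_num), hlow 2 (by norm_num), hR.one] at e2
      rw [hj1, f1 3 (by norm_num), hlow 3 (by norm_num), hR.zero, Nat.add_zero] at h23
      have hcard : numErrs m0 T (j + 1) = numErrs m0 T j + if Errs m0 T j then 1 else 0 := by
        unfold numErrs
        rw [Finset.range_add_one, Finset.filter_insert]
        split
        · rw [Finset.card_insert_of_notMem (by simp)]
        · simp
      rw [hcard]
      by_cases hc : m2.reg 23 = 0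
      · have : ¬ Errs m0 T j := fun h => h23.2 h hc
        simp [Prog.exec, hc, e12, this]
      · have : Errs m0 T j := h23.1 hc
        simp [Prog.exec, hc, e12, this, e2]
    · omega
  · ring_nf; omega

/-- Sets register `10` to `1` if array `4` holds a tree `T` with `q |T| ≤ D s` whose number `W` of
errors satisfies `q W ≤ E M`, and to `0` otherwise. -/
def checkTree (q D E : ℕ) : Prog Empty :=
  -- The fuel `2 D s` suffices: as `q ≥ 1`, an acceptable tree has at most `D s` leaves, and its
  -- listing is shorter than twice that.
  .const 10 0 ;; mulConst 38 7 D ;; .add 38 38 38 ;; parseTree ;;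
  .ite 35 .skip (.ite 37 .skip (
    mulConst 11 36 q ;; mulConst 13 7 D ;; .sub 11 11 13 ;; .ite 11 .skip (
      countErrors ;; mulConst 11 12 q ;; mulConst 13 9 E ;; .sub 11 11 13 ;;
      .ite 11 .skip (.const 10 1))))

/-- Array `y` holds a tree that passes the check. -/
def Accepts (q D E : ℕ) (m : Mem) (y : ℕ → ℕ) : Prop :=
  ∃ T : DTree (m.reg 6), Holds y 0 T.listing ∧ q * T.size ≤ D * m.reg 7 ∧
    q * numErrs m T (m.reg 9) ≤ E * m.reg 9

theorem parseTree_writesReg {i : ℕ} (h : parseTree.WritesReg i) : 23 ≤ i ∧ i < 39 := by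
  simp [parseTree, Prog.WritesReg] at h
  omega

theorem parseTree_writesArr {a : ℕ} : ¬ parseTree.WritesArr a := by
  simp [parseTree, Prog.WritesArr]

theorem countErrors_writesReg {i : ℕ} (h : countErrors.WritesReg i) : 12 ≤ i ∧ i < 38 := by
  simp only [countErrors, forLoop, Prog.WritesReg] at h
  rcases h with h | h | h | (h | h | h | h) | h | h
  all_goals first | exact h.elim | omega | (have := testSample_writesReg h; omega)

/-- A time bound for the check. -/
def checkCost (q D E : ℕ) (m : Mem) : ℕ :=
  m.reg 9 * (stepCost m + D * m.reg 7 * 40 + 80) + D * m.reg 7 * 50 + 10 * (q + D + E) + 100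

open Classical in
theorem checkTree_spec {q D E : ℕ} (hq : 0 < q) {m0 m : Mem} (hR : Ready m0)
    (hlow : ∀ i < 10, m.reg i = m0.reg i)
    (h1 : m.arr 1 = m0.arr 1) (h2 : m.arr 2 = m0.arr 2) (h9 : m0.reg 9 = m0.reg 8 + 1) :
    Tri (checkTree q D E) m (checkCost q D E m0)
      (fun m' => m'.reg 10 = if Accepts q D E m0 (m.arr 4) then 1 else 0) := by
  set s := m0.reg 7 with hs
  refine Tri.time (Tri.seq (Tri.const (Tri.seq (Tri.mono (mulConst_spec (by norm_num) D _) le_rfl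
    (fun m1 k1 hf1 => Tri.seq (Tri.add (Tri.seq (Tri.mono (parseTree_spec (N := m0.reg 6) ?_ ?_ ?_)
    (T' := D * s * 50 + 20) ?_ (fun m2 ⟨k2, k2'⟩ hf2 =>
    Tri.ite (T := 1)
    (T' := m0.reg 9 * (stepCost m0 + D * s * 40 + 80) + 4 * q + 2 * D + 2 * E + 41)
    (fun h35 => Tri.skip ?_) (fun h35 =>
    Tri.time (Tri.ite (T := 1)
    (T' := m0.reg 9 * (stepCost m0 + D * s * 40 + 80) + 4 * q + 2 * D + 2 * E + 40)
    (fun h37 => Tri.skip ?_) (fun h37 => ?_)) ?_)))))))))) ?_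
  all_goals
    try
      have f1 : ∀ i < 10, m1.reg i = m0.reg i := fun i hi => by
        rw [hf1.reg i (fun h => by have := mulConst_writesReg h; omega), Mem.setReg_reg,
          if_neg (by omega), hlow i hi]
      have g1 : ∀ a, m1.arr a = m.arr a := fun a => hf1.arr a mulConst_writesArr
      simp only [Mem.setReg_reg] at k1
      rw [if_neg (by norm_num), hlow 7 (by norm_num), ← hs] at k1
  · rw [Mem.setReg_reg, if_neg (by norm_num), f1 2 (by norm_num), hR.one]
  · rw [Mem.setReg_reg, if_neg (by norm_num), f1 3 (by norm_num), hR.zero]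
  · rw [Mem.setReg_reg, if_neg (by norm_num), f1 6 (by norm_num)]
  · simp only [Mem.setReg_reg, if_true, k1]; omega
  all_goals
    try
      have f2 : ∀ i < 10, m2.reg i = m0.reg i := fun i hi => by
        rw [hf2.reg i (fun h => by have := parseTree_writesReg h; omega), Mem.setReg_reg,
          if_neg (by omega), f1 i hi]
      have g2 : ∀ a, m2.arr a = m.arr a := fun a =>
        (hf2.arr a parseTree_writesArr).trans (g1 a)
      have e10 : m2.reg 10 = 0 := by
        rw [hf2.reg 10 (fun h => by have := parseTree_writesReg h; omega), Mem.setReg_reg,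
          if_neg (by omega), hf1.reg 10 (fun h => by have := mulConst_writesReg h; omega)]
        simp
      simp only [Mem.setReg_reg, Mem.setReg_arr, if_true, k1, g1] at k2 k2'
      have hfuel : ∀ T : DTree (m0.reg 6), q * T.size ≤ D * s →
          T.listing.length ≤ D * s + D * s := fun T hT => by
        have := T.listing_length
        have : 1 * T.size ≤ q * T.size := Nat.mul_le_mul_right _ hq
        omega
  · rw [e10, if_neg]
    rintro ⟨T, hT, hsz, -⟩
    exact h35 (k2' T hT (hfuel T hsz)).1
  · rw [e10, if_neg]
    rintro ⟨T, hT, hsz, -⟩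
    exact h37 (k2' T hT (hfuel T hsz)).2
  · obtain ⟨T, hT, h36⟩ := k2 h35 h37
    -- By `Holds.tree_unique` the existential in `Accepts` concerns only the parsed tree.
    have hacc : Accepts q D E m0 (m.arr 4) ↔ q * T.size ≤ D * s ∧
        q * numErrs m0 T (m0.reg 9) ≤ E * m0.reg 9 := by
      constructor
      · rintro ⟨T', hT', h⟩
        rw [hT.tree_unique hT']
        exact h
      · exact fun h => ⟨T, hT, h⟩
    rw [hacc]
    refine Tri.time (Tri.seq (Tri.mono (mulConst_spec (by norm_num) q _) le_rfl
      (fun m3 k3 hf3 => Tri.seq (Tri.mono (mulConst_spec (by norm_num) D _) le_rfl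
      (fun m4 k4 hf4 => Tri.seq (Tri.sub (Tri.ite (T := 1)
      (T' := m0.reg 9 * (stepCost m0 + D * s * 40 + 80) + 2 * q + 2 * E + 25)
      (fun h11 => Tri.skip ?_) (fun h11 => ?_)))))))) ?_
    all_goals
      try
        have f3 : ∀ i, i ≠ 11 → m3.reg i = m2.reg i := fun i hi =>
          hf3.reg i (fun h => hi (mulConst_writesReg h))
        have f4 : ∀ i, i ≠ 13 → m4.reg i = m3.reg i := fun i hi =>
          hf4.reg i (fun h => hi (mulConst_writesReg h))
        have g4 : ∀ a, m4.arr a = m.arr a := fun a =>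
          (hf4.arr a mulConst_writesArr).trans ((hf3.arr a mulConst_writesArr).trans (g2 a))
        rw [f3 7 (by norm_num), f2 7 (by norm_num), ← hs] at k4
        simp only [Mem.setReg_reg, if_true] at h11
        rw [f4 11 (by norm_num), k3, k4, ← h36] at h11
    · rw [if_neg (fun h => h11 (Nat.sub_eq_zero_of_le h.1))]
      simp only [Mem.setReg_reg]
      rw [if_neg (by norm_num), f4 10 (by norm_num), f3 10 (by norm_num), e10]
    · have hsz : q * T.size ≤ D * s := Nat.sub_eq_zero_iff_le.1 h11
      refine Tri.time (Tri.seq (Tri.mono (countErrors_spec hR ?_ ?_ ?_ T ?_ h9)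
        (T' := m0.reg 9 * (stepCost m0 + D * s * 40 + 80) + 10) ?_
        (fun m5 k5 hf5 => Tri.seq (Tri.mono (mulConst_spec (by norm_num) q _) le_rfl
        (fun m6 k6 hf6 => Tri.seq (Tri.mono (mulConst_spec (by norm_num) E _) le_rfl
        (fun m7 k7 hf7 => Tri.time (Tri.loopFree (by simp [Prog.LoopFree]) ?_)
          (T' := 4) le_rfl))))))) (by omega)
      · intro i hi
        rw [Mem.setReg_reg, if_neg (by omega), f4 i (by omega), f3 i (by omega), f2 i hi]
      · rw [Mem.setReg_arr, g4, h1]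
      · rw [Mem.setReg_arr, g4, h2]
      · rw [Mem.setReg_arr, g4]; exact hT
      · have := hfuel T hsz
        have : stepCost m0 + T.listing.length * 20 + 80 ≤ stepCost m0 + D * s * 40 + 80 := by
          omega
        exact Nat.add_le_add_right (Nat.mul_le_mul_left _ this) _
      · have f5 : ∀ i < 12, m5.reg i = if i = 11 then m4.reg 11 - m4.reg 13 else m4.reg i :=
          fun i hi => (hf5.reg i (fun h => by have := countErrors_writesReg h; omega)).trans
            (Mem.setReg_reg _ _ _ _)
        have f6 : ∀ i, i ≠ 11 → m6.reg i = m5.reg i := fun i hi =>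
          hf6.reg i (fun h => hi (mulConst_writesReg h))
        have f7 : ∀ i, i ≠ 13 → m7.reg i = m6.reg i := fun i hi =>
          hf7.reg i (fun h => hi (mulConst_writesReg h))
        rw [f6 9 (by norm_num), f5 9 (by norm_num), if_neg (by norm_num), f4 9 (by norm_num),
          f3 9 (by norm_num), f2 9 (by norm_num)] at k7
        have e11 : m7.reg 11 = q * numErrs m0 T (m0.reg 9) := by
          rw [f7 11 (by norm_num), k6, k5]
        have e10' : m7.reg 10 = 0 := by
          rw [f7 10 (by norm_num), f6 10 (by norm_num), f5 10 (by norm_num), if_neg (by norm_num),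
            f4 10 (by norm_num), f3 10 (by norm_num), e10]
        simp only [Prog.exec, Mem.setReg_reg, if_true, e11, k7, hsz, true_and]
        by_cases hE : q * numErrs m0 T (m0.reg 9) ≤ E * m0.reg 9
        · have : q * numErrs m0 T (m0.reg 9) - E * m0.reg 9 = 0 := by omega
          simp [hE, this]
        · have : ¬ (q * numErrs m0 T (m0.reg 9) - E * m0.reg 9 = 0) := by omega
          simp [hE, this, e10']
    · omega
  · omega
  · simp only [checkCost, ← hs]; omega

/-! ### The edge list -/

/-- The lists `U`, `V` of length `k` contain the pairs `a < b < n` with `A a b` that come before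
`(u, v)` in the lexicographic order. -/
structure Listed (n : ℕ) (A : ℕ → ℕ → Prop) (u v k : ℕ) (U V : ℕ → ℕ) : Prop where
  sound : ∀ e < k, U e < V e ∧ V e < n ∧ A (U e) (V e) ∧ (U e < u ∨ U e = u ∧ V e < v)
  inj : ∀ e < k, ∀ e' < k, U e = U e' → V e = V e' → e = e'
  complete : ∀ a b, a < b → b < n → A a b → (a < u ∨ a = u ∧ b < v) → ∃ e < k, U e = a ∧ V e = b

theorem Listed.skip {n : ℕ} {A : ℕ → ℕ → Prop} {u v k : ℕ} {U V : ℕ → ℕ}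
    (H : Listed n A u v k U V) (h : ¬ (A u v ∧ u < v)) : Listed n A u (v + 1) k U V := by
  refine ⟨fun e he => ?_, H.inj, fun a b hab hb hA hl => ?_⟩
  · obtain ⟨h1, h2, h3, h4⟩ := H.sound e he
    exact ⟨h1, h2, h3, by omega⟩
  · refine H.complete a b hab hb hA ?_
    by_contra hc
    obtain ⟨rfl, rfl⟩ : a = u ∧ b = v := by omega
    exact h ⟨hA, hab⟩

theorem Listed.push {n : ℕ} {A : ℕ → ℕ → Prop} {u v k : ℕ} {U V : ℕ → ℕ}
    (H : Listed n A u v k U V) (hA : A u v) (huv : u < v) (hv : v < n) :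
    Listed n A u (v + 1) (k + 1) (Function.update U k u) (Function.update V k v) := by
  refine ⟨fun e he => ?_, fun e he e' he' => ?_, fun a b hab hb hA' hl => ?_⟩
  · by_cases hk : e = k
    · subst hk
      simp only [Function.update_self]
      exact ⟨huv, hv, hA, by simp⟩
    · obtain ⟨h1, h2, h3, h4⟩ := H.sound e (by omega)
      simp only [Function.update_of_ne hk]
      exact ⟨h1, h2, h3, by omega⟩
  · by_cases hk : e = k <;> by_cases hk' : e' = k
    · intros; omega
    · subst hk
      have := (H.sound e' (by omega)).2.2.2
      simp only [Function.update_self, Function.update_of_ne hk']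
      intros; omega
    · subst hk'
      have := (H.sound e (by omega)).2.2.2
      simp only [Function.update_self, Function.update_of_ne hk]
      intros; omega
    · simp only [Function.update_of_ne hk, Function.update_of_ne hk']
      exact H.inj e (by omega) e' (by omega)
  · by_cases hc : a = u ∧ b = v
    · exact ⟨k, by omega, by simp [hc.1], by simp [hc.2]⟩
    · obtain ⟨e, he, h1, h2⟩ := H.complete a b hab hb hA' (by omega)
      have hk : e ≠ k := by omega
      exact ⟨e, by omega, by simp [hk, h1], by simp [hk, h2]⟩

theorem Listed.row {n : ℕ} {A : ℕ → ℕ → Prop} {u k : ℕ} {U V : ℕ → ℕ}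
    (H : Listed n A u n k U V) : Listed n A (u + 1) 0 k U V := by
  refine ⟨fun e he => ?_, H.inj, fun a b hab hb hA hl => H.complete a b hab hb hA (by omega)⟩
  obtain ⟨h1, h2, h3, h4⟩ := H.sound e he
  exact ⟨h1, h2, h3, by omega⟩

/-- Lists the edges of the graph whose adjacency matrix is in array `0`. -/
def listEdges : Prog Empty :=
  .const 4 0 ;; .const 15 0 ;; forLoop 16 17 0 (forLoop 18 19 0 (
    -- Register `21` is `v - u`, nonzero only above the diagonal, so each edge is listed once.
    .load 20 0 15 ;; .add 15 15 2 ;; .sub 21 18 16 ;;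
    .ite 20 (.ite 21 (.store 1 4 16 ;; .store 2 4 18 ;; .add 4 4 2) .skip) .skip))

theorem listEdges_spec {m : Mem} (h2 : m.reg 2 = 1) (h3 : m.reg 3 = 0) :
    Tri listEdges m (m.reg 0 * (m.reg 0 * 25 + 10) + 10) (fun m' =>
      Listed (m.reg 0) (fun u v => m.arr 0 (u * m.reg 0 + v) ≠ 0) (m.reg 0) 0 (m'.reg 4)
        (m'.arr 1) (m'.arr 2)) := by
  set n := m.reg 0 with hn
  set A : ℕ → ℕ → Prop := fun u v => m.arr 0 (u * n + v) ≠ 0 with hA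
  refine Tri.time (Tri.seq (Tri.const (Tri.seq (Tri.const (Tri.mono (Tri.forLoop
    (T := n * 25 + 5) n (fun u m' => m'.reg 15 = u * n ∧
      Listed n A u 0 (m'.reg 4) (m'.arr 1) (m'.arr 2)) ?_ ?_ ?_ (by decide) ?_ ?_ ?_) le_rfl
      (fun m' h _ => h.2))))))
    (T := 1 + (1 + (n * ((n * 25 + 5) + 5) + 5) + 1) + 1) (by ring_nf; omega)
  · simp [h2]
  · simp [h3]
  · simp [hn]
  · intro j hj
    simp [forLoop, Prog.WritesReg] at hj
    omega
  · refine ⟨by simp, ?_⟩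
    constructor <;> simp
  · rintro u hu m1 hf1 hu1 ⟨h15, hL⟩
    have f0 := hf1.reg 0 (by simp [forLoop, Prog.WritesReg])
    have f2 := hf1.reg 2 (by simp [forLoop, Prog.WritesReg])
    have f3 := hf1.reg 3 (by simp [forLoop, Prog.WritesReg])
    have fa := hf1.arr 0 (by simp [forLoop, Prog.WritesArr])
    simp [h2, h3, ← hn] at f0 f2 f3 fa
    refine Tri.mono (Tri.forLoop (T := 18) n (fun v m' => m'.reg 15 = u * n + v ∧
      Listed n A u v (m'.reg 4) (m'.arr 1) (m'.arr 2)) f2 f3 f0 (by decide) ?_ ?_ ?_) (by omega) ?_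
    · intro j hj
      simp [Prog.WritesReg] at hj
      omega
    · simpa using ⟨h15, hL⟩
    · rintro v hv m2 hf2 hv2 ⟨h15', hL'⟩
      have g2 := hf2.reg 2 (by simp [forLoop, Prog.WritesReg])
      have g16 := hf2.reg 16 (by simp [forLoop, Prog.WritesReg])
      have ga := hf2.arr 0 (by simp [forLoop, Prog.WritesArr])
      rw [f2] at g2
      rw [hu1] at g16
      rw [fa] at ga
      refine Tri.time (Tri.loopFree (by simp [Prog.LoopFree]) ?_) (by simp [Prog.cost])
      by_cases hAuv : m.arr 0 (u * n + v) = 0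
      · have := hL'.skip (fun h => h.1 hAuv)
        simpa [Prog.exec, h15', ga, hAuv, g2, hv2, g16, Nat.add_assoc] using this
      · by_cases huv : v - u = 0
        · have := hL'.skip (fun h => by omega)
          have huv' : v ≤ u := by omega
          simpa [Prog.exec, h15', ga, hAuv, g2, hv2, g16, Nat.add_assoc, huv] using this
        · have := hL'.push hAuv (by omega) hv
          have huv' : ¬ v ≤ u := by omega
          simpa [Prog.exec, h15', ga, hAuv, g2, hv2, g16, Nat.add_assoc, huv] using this
    · rintro m2 ⟨h15', hL'⟩ hf2
      refine ⟨by simp [h15', Nat.add_mul], ?_⟩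
      simpa using hL'.row

/-! ### The reduction -/

/-- Computes the parameters of the learning task: `C n` layers, the number of variables, the size
bound, the number of sample points, and the input of the learner. -/
def setup (C : ℕ) : Prog Empty :=
  -- Register `7` becomes `l κ + (l + n) k + 1`, the size bound of `exists_tree_of_cover` for a
  -- cover of size `κ`; register `9` becomes `4 l k`.
  mulConst 5 0 C ;; mulReg 6 5 0 ;; mulReg 7 5 1 ;; .add 15 5 0 ;; mulReg 14 15 4 ;;
  .add 7 7 14 ;; .add 7 7 2 ;; mulReg 13 5 4 ;; mulConst 9 13 4 ;; .sub 8 9 2 ;;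
  .add 40 6 3 ;; .add 41 7 3

theorem mulReg_writesReg {x y z i : ℕ} (h : (mulReg x y z).WritesReg i) :
    i = x ∨ i = 16 ∨ i = 17 := by
  simp [mulReg, forLoop, Prog.WritesReg] at h
  omega

theorem mulReg_writesArr {x y z a : ℕ} : ¬ (mulReg x y z).WritesArr a := by
  simp [mulReg, forLoop, Prog.WritesArr]

theorem setup_writesReg {C i : ℕ} (h : (setup C).WritesReg i) :
    5 ≤ i ∧ i < 18 ∨ i = 40 ∨ i = 41 := by
  simp only [setup, Prog.WritesReg] at h
  rcases h with h | h | h | h | h | h | h | h | h | h | h | h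
  all_goals first | omega | (have := mulConst_writesReg h; omega) |
    (have := mulReg_writesReg h; omega)

theorem setup_writesArr {C a : ℕ} : ¬ (setup C).WritesArr a := by
  simp [setup, Prog.WritesArr, mulConst_writesArr, mulReg_writesArr]

theorem setup_spec (C : ℕ) {m : Mem} (h2 : m.reg 2 = 1) (h3 : m.reg 3 = 0) :
    Tri (setup C) m (2 * C + 6 * m.reg 0 + 6 * m.reg 1 + 12 * m.reg 4 + 100) (fun m' =>
      m'.reg 5 = C * m.reg 0 ∧ m'.reg 6 = C * m.reg 0 * m.reg 0 ∧
      m'.reg 7 = C * m.reg 0 * m.reg 1 + (C * m.reg 0 + m.reg 0) * m.reg 4 + 1 ∧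
      m'.reg 9 = 4 * (C * m.reg 0 * m.reg 4) ∧ m'.reg 8 = m'.reg 9 - 1 ∧
      m'.reg 40 = m'.reg 6 ∧ m'.reg 41 = m'.reg 7) := by
  have hc : ∀ {x y c : ℕ} {m m' : Mem}, Frame (mulConst x y c) m m' →
      ∀ i, i ≠ x → m'.reg i = m.reg i := fun hf i hi =>
    hf.reg i (fun h => hi (mulConst_writesReg h))
  have hm : ∀ {x y z : ℕ} {m m' : Mem}, Frame (mulReg x y z) m m' →
      ∀ i < 16, i ≠ x → m'.reg i = m.reg i := fun hf i hi hx =>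
    hf.reg i (fun h => by have := mulReg_writesReg h; omega)
  refine Tri.time (Tri.seq (Tri.mono (mulConst_spec (x := 5) (y := 0) (by norm_num) C m) le_rfl
    (fun m1 k1 hf1 => ?_)))
    (T := 2 * C + 1 + (6 * m.reg 0 + 6 * m.reg 1 + 12 * m.reg 4 + 80) + 1) (by omega)
  have f1 := hc hf1
  refine Tri.time (Tri.seq (Tri.mono (mulReg_spec (x := 6) (y := 5) (z := 0) (by norm_num) (by norm_num) (by norm_num)
    (by norm_num) (by norm_num) (by rw [f1 2 (by norm_num), h2])
    (by rw [f1 3 (by norm_num), h3])) (T' := m.reg 0 * 6 + 10) (by rw [f1 0 (by norm_num)])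
    (fun m2 k2 hf2 => ?_)))
    (T := m.reg 0 * 6 + 10 + (6 * m.reg 1 + 12 * m.reg 4 + 65) + 1) (by omega)
  have f2 : ∀ i < 16, i ≠ 5 → i ≠ 6 → m2.reg i = m.reg i := fun i hi a b =>
    (hm hf2 i hi b).trans (f1 i a)
  have l2 := hm hf2 5 (by norm_num) (by norm_num)
  refine Tri.time (Tri.seq (Tri.mono (mulReg_spec (x := 7) (y := 5) (z := 1) (by norm_num) (by norm_num) (by norm_num)
    (by norm_num) (by norm_num) (by rw [f2 2 (by norm_num) (by norm_num) (by norm_num), h2])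
    (by rw [f2 3 (by norm_num) (by norm_num) (by norm_num), h3])) (T' := m.reg 1 * 6 + 10)
    (by rw [f2 1 (by norm_num) (by norm_num) (by norm_num)])
    (fun m3 k3 hf3 => Tri.seq (Tri.add ?_))))
    (T := m.reg 1 * 6 + 10 + (1 + (12 * m.reg 4 + 50) + 1) + 1) (by omega)
  have f3 : ∀ i < 16, i ≠ 5 → i ≠ 6 → i ≠ 7 → m3.reg i = m.reg i := fun i hi a b c =>
    (hm hf3 i hi c).trans (f2 i hi a b)
  have l3 := hm hf3 5 (by norm_num) (by norm_num)
  have n3 := hm hf3 6 (by norm_num) (by norm_num)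
  set m3' := m3.setReg 15 (m3.reg 5 + m3.reg 0) with hm3'
  have f3' : ∀ i, i ≠ 15 → m3'.reg i = m3.reg i := fun i hi => by simp [hm3', hi]
  have e15 : m3'.reg 15 = m3.reg 5 + m3.reg 0 := by simp [hm3']
  refine Tri.time (Tri.seq (Tri.mono (mulReg_spec (x := 14) (y := 15) (z := 4) (by norm_num) (by norm_num) (by norm_num)
    (by norm_num) (by norm_num)
    (by rw [f3' 2 (by norm_num), f3 2 (by norm_num) (by norm_num) (by norm_num) (by norm_num), h2])
    (by rw [f3' 3 (by norm_num), f3 3 (by norm_num) (by norm_num) (by norm_num) (by norm_num), h3]))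
    (T' := m.reg 4 * 6 + 10)
    (by rw [f3' 4 (by norm_num), f3 4 (by norm_num) (by norm_num) (by norm_num) (by norm_num)])
    (fun m4 k4 hf4 => Tri.seq (Tri.add (Tri.seq (Tri.add ?_))))))
    (T := m.reg 4 * 6 + 10 + (1 + (1 + (6 * m.reg 4 + 32) + 1) + 1) + 1) (by omega)
  have f4 : ∀ i < 14, m4.reg i = m3.reg i := fun i hi =>
    (hm hf4 i (by omega) (by omega)).trans (f3' i (by omega))
  set m5 := (m4.setReg 7 (m4.reg 7 + m4.reg 14)).setReg 7
    ((m4.setReg 7 (m4.reg 7 + m4.reg 14)).reg 7 + (m4.setReg 7 (m4.reg 7 + m4.reg 14)).reg 2)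
    with hm5
  have f5 : ∀ i, i ≠ 7 → m5.reg i = m4.reg i := fun i hi => by simp [hm5, hi]
  have e7 : m5.reg 7 = m4.reg 7 + m4.reg 14 + m4.reg 2 := by simp [hm5]
  have f5' : ∀ i < 14, i ≠ 7 → m5.reg i = m3.reg i := fun i hi a => (f5 i a).trans (f4 i hi)
  refine Tri.time (Tri.seq (Tri.mono (mulReg_spec (x := 13) (y := 5) (z := 4) (by norm_num) (by norm_num) (by norm_num)
    (by norm_num) (by norm_num)
    (by rw [f5' 2 (by norm_num) (by norm_num),
      f3 2 (by norm_num) (by norm_num) (by norm_num) (by norm_num), h2])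
    (by rw [f5' 3 (by norm_num) (by norm_num),
      f3 3 (by norm_num) (by norm_num) (by norm_num) (by norm_num), h3]))
    (T' := m.reg 4 * 6 + 10)
    (by rw [f5' 4 (by norm_num) (by norm_num),
      f3 4 (by norm_num) (by norm_num) (by norm_num) (by norm_num)])
    (fun m6 k6 hf6 => Tri.seq (Tri.mono (mulConst_spec (x := 9) (y := 13) (by norm_num) 4 _) (T' := 9) le_rfl
    (fun m7 k7 hf7 => Tri.time (Tri.loopFree (by simp [Prog.LoopFree]) ?_) (T' := 5) le_rfl)))))
    (T := m.reg 4 * 6 + 10 + (9 + 5 + 1) + 1) (by omega)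
  have f6 := hm hf6
  have f7 := hc hf7
  have a0 := f3 0 (by norm_num) (by norm_num) (by norm_num) (by norm_num)
  have a2 := f3 2 (by norm_num) (by norm_num) (by norm_num) (by norm_num)
  have a3 := f3 3 (by norm_num) (by norm_num) (by norm_num) (by norm_num)
  have a4 := f3 4 (by norm_num) (by norm_num) (by norm_num) (by norm_num)
  have a5 : m3.reg 5 = C * m.reg 0 := by rw [l3, l2, k1]
  have a6 : m3.reg 6 = C * m.reg 0 * m.reg 0 := by rw [n3, k2, k1, f1 0 (by norm_num)]
  have a7 : m3.reg 7 = C * m.reg 0 * m.reg 1 := by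
    rw [k3, l2, k1, f2 1 (by norm_num) (by norm_num) (by norm_num)]
  have b7 : m5.reg 7 = C * m.reg 0 * m.reg 1 + (C * m.reg 0 + m.reg 0) * m.reg 4 + 1 := by
    rw [e7, f4 7 (by norm_num), f4 2 (by norm_num), k4, e15, f3' 4 (by norm_num), a5, a0, a4, a7,
      a2, h2]
  have c2 : m7.reg 2 = 1 := by
    rw [f7 2 (by norm_num), f6 2 (by norm_num) (by norm_num), f5' 2 (by norm_num) (by norm_num),
      a2, h2]
  have c3 : m7.reg 3 = 0 := by
    rw [f7 3 (by norm_num), f6 3 (by norm_num) (by norm_num), f5' 3 (by norm_num) (by norm_num),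
      a3, h3]
  have c5 : m7.reg 5 = C * m.reg 0 := by
    rw [f7 5 (by norm_num), f6 5 (by norm_num) (by norm_num), f5' 5 (by norm_num) (by norm_num), a5]
  have c6 : m7.reg 6 = C * m.reg 0 * m.reg 0 := by
    rw [f7 6 (by norm_num), f6 6 (by norm_num) (by norm_num), f5' 6 (by norm_num) (by norm_num), a6]
  have c7 : m7.reg 7 = C * m.reg 0 * m.reg 1 + (C * m.reg 0 + m.reg 0) * m.reg 4 + 1 := by
    rw [f7 7 (by norm_num), f6 7 (by norm_num) (by norm_num), b7]
  have c9 : m7.reg 9 = 4 * (C * m.reg 0 * m.reg 4) := by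
    rw [k7, k6, f5' 5 (by norm_num) (by norm_num), f5' 4 (by norm_num) (by norm_num), a5, a4]
  simp [Prog.exec, c2, c3, c5, c6, c7, c9]

/-- The algorithm for Vertex Cover that uses the learner `p`. -/
def vertexCoverProg (d C q D E : ℕ) (p : Prog LearnerCall) : Prog Empty :=
  -- Three cases need no learner: Yes if `κ ≥ n`, Yes if there are no edges (there would be no
  -- sample points), No if there are more than `d κ` edges. What remains has `κ < n` and `0 < k ≤ d
  -- κ`, as the size and time bounds require.
  .const 2 1 ;; listEdges ;; .const 10 1 ;; .sub 15 0 1 ;;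
  .ite 15 (.ite 4 (mulConst 16 1 d ;; .sub 16 4 16 ;;
    .ite 16 (.const 10 0) (setup C ;; simulate p ;; checkTree q D E)) .skip) .skip ;;
  .add 0 10 3

section

variable {O : Type} {h : O → Mem → PMF Mem} {t : ℕ} {k : List (Prog O)} {m : Mem} {P : Mem → Prop}
  {r : ENNReal}

theorem Good.seq {p q : Prog O} (H : Good h t (p :: q :: k, m) P r) :
    Good h (t + 1) (.seq p q :: k, m) P r :=
  H.of_step rfl

theorem Good.iteTrue {x : ℕ} {p q : Prog O} (hx : m.reg x ≠ 0) (H : Good h t (p :: k, m) P r) :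
    Good h (t + 1) (.ite x p q :: k, m) P r :=
  H.of_step (by simp [step, hx])

theorem Good.iteFalse {x : ℕ} {p q : Prog O} (hx : m.reg x = 0) (H : Good h t (q :: k, m) P r) :
    Good h (t + 1) (.ite x p q :: k, m) P r :=
  H.of_step (by simp [step, hx])

end

/-- The alternative `r = 0` serves the claims that are only about halting. -/
theorem Good.answer {m : Mem} {b : ℕ} {r : ENNReal} (hr : r ≤ 1) (h3 : m.reg 3 = 0)
    (hb : m.reg 10 = b ∨ r = 0) :
    Good noOracle 1 ([.add 0 10 3], m) (fun m' => m'.reg 0 = b) r := by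
  refine Good.of_step (c' := ([], m.setReg 0 (m.reg 10 + m.reg 3))) rfl ?_
  rcases hb with hb | rfl
  · exact (Good.nil_one (by simp [h3, hb])).weaken hr
  · exact Good.nil_zero

theorem listEdges_writesReg {i : ℕ} (h : listEdges.WritesReg i) : 4 ≤ i ∧ i ≠ 10 ∧ i < 22 := by
  simp [listEdges, forLoop, Prog.WritesReg] at h
  omega

theorem listEdges_writesArr {a : ℕ} (h : listEdges.WritesArr a) : a = 1 ∨ a = 2 := by
  simpa [listEdges, forLoop, Prog.WritesArr] using h

open Classical in
-- Separates the control flow from the mathematics. `b` is the answer to be established and `r` a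
-- lower bound for its probability. Each branch becomes one hypothesis; that of the learner branch
-- bounds `r` by the probability that the check of the learner's output yields `b`.
theorem vertexCoverProg_good {d C q D E n κ : ℕ} {p : Prog LearnerCall} {m : Mem} (hq : 0 < q)
    (hn : 1 ≤ n) (hC : 1 ≤ C) (h0 : m.reg 0 = n) (h1 : m.reg 1 = κ)
    (hreg : ∀ i, 2 ≤ i → m.reg i = 0) (harr : ∀ a, 1 ≤ a → m.arr a = fun _ => 0) :
    ∃ (k : ℕ) (U V : ℕ → ℕ), Listed n (fun u v => m.arr 0 (u * n + v) ≠ 0) n 0 k U V ∧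
    ∀ (b τ T : ℕ) (r : ENNReal), r ≤ 1 →
      (n ≤ κ → b = 1 ∨ r = 0) → (k = 0 → b = 1 ∨ r = 0) → (d * κ < k → b = 0 ∨ r = 0) →
      25 * n ^ 2 + 10 * n + 100 + 2 * d ≤ T →
      (κ < n → 0 < k → k ≤ d * κ → ∀ m0, Ready m0 → m0.reg 0 = n → m0.reg 4 = k →
        m0.reg 5 = C * n → m0.reg 6 = C * n * n →
        m0.reg 7 = C * n * κ + (C * n + n) * k + 1 → m0.reg 9 = m0.reg 8 + 1 →
        m0.arr 1 = U → m0.arr 2 = V →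
        AlwaysHalted (run (learnerOracle (memTarget m0) (memDist m0)) τ
          ([p], learnerInput (m0.reg 6) (m0.reg 7))) ∧
        r ≤ probMem (run (learnerOracle (memTarget m0) (memDist m0)) τ
          ([p], learnerInput (m0.reg 6) (m0.reg 7)))
            (fun m' => (if Accepts q D E m0 (m'.arr 0) then 1 else 0) = b) ∧
        25 * n ^ 2 + 10 * n + 100 + 2 * d + (2 * C + 6 * n + 6 * κ + 12 * k + 100) +
          checkCost q D E m0 + stepCost m0 * τ + 10 ≤ T) →
      Good noOracle T ([vertexCoverProg d C q D E p], m) (fun m' => m'.reg 0 = b) r := by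
  have H := listEdges_spec (m := m.setReg 2 1) (by simp) (by simp [hreg])
  obtain ⟨m1, a, ha, he, hL⟩ := H
  have hf := he.frame
  simp only [Mem.setReg_reg, Mem.setReg_arr, h0] at hL ha
  norm_num at hL ha
  have f : ∀ i, i < 4 ∨ i = 10 ∨ 22 ≤ i → m1.reg i = if i = 2 then 1 else m.reg i := fun i hi => by
    rw [hf.reg i (fun h => by have := listEdges_writesReg h; omega), Mem.setReg_reg]
  have g : ∀ a, a ≠ 1 → a ≠ 2 → m1.arr a = m.arr a := fun a ha ha' => by
    rw [hf.arr a (fun h => by have := listEdges_writesArr h; omega), Mem.setReg_arr]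
  refine ⟨m1.reg 4, m1.arr 1, m1.arr 2, by simpa using hL, ?_⟩
  intro b τ T r hr hb1 hb2 hb3 hT hbig
  set m2 := (m1.setReg 10 1).setReg 15 (m1.reg 0 - m1.reg 1) with hm2
  have e0 : m1.reg 0 = n := by rw [f 0 (by norm_num), if_neg (by norm_num), h0]
  have e1 : m1.reg 1 = κ := by rw [f 1 (by norm_num), if_neg (by norm_num), h1]
  have e2 : m1.reg 2 = 1 := by rw [f 2 (by norm_num), if_pos rfl]
  have e3 : m1.reg 3 = 0 := by rw [f 3 (by norm_num), if_neg (by norm_num), hreg 3 (by norm_num)]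
  suffices hmain : ∃ t, t ≤ T - (25 * n ^ 2 + 10 * n + 50) ∧ Good noOracle t
      (.ite 15 (.ite 4 (mulConst 16 1 d ;; .sub 16 4 16 ;;
        .ite 16 (.const 10 0) (setup C ;; simulate p ;; checkTree q D E)) .skip) .skip ::
        [.add 0 10 3], m2) (fun m' => m'.reg 0 = b) r by
    obtain ⟨t, ht, hg⟩ := hmain
    have G : Good noOracle ((t + 1 + 1 + 1 + 1 + 1 + a) + 1 + 1 + 1)
        ([vertexCoverProg d C q D E p], m) (fun m' => m'.reg 0 = b) r := by
      refine Good.seq (Good.of_step (c' := (_, m.setReg 2 1)) rfl (Good.seq (he.good ?_)))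
      refine Good.seq (Good.of_step (c' := (_, m1.setReg 10 1)) rfl (Good.seq
        (Good.of_step (c' := (_, m2)) ?_ (Good.seq hg))))
      simp [step, hm2]
    refine G.mono ?_
    have : n * (n * 25 + 10) = 25 * n ^ 2 + 10 * n := by ring
    omega
  have x15 : m2.reg 15 = n - κ := by simp [hm2, e0, e1]
  have x4 : m2.reg 4 = m1.reg 4 := by simp [hm2]
  have x10 : m2.reg 10 = 1 := by simp [hm2]
  have x3 : m2.reg 3 = 0 := by simp [hm2, e3]
  by_cases hκ : n ≤ κ
  · refine ⟨1 + 1 + 1, by omega, Good.iteFalse (by rw [x15]; omega) (Good.of_step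
      (c' := (_, m2)) rfl (Good.answer hr x3 ?_))⟩
    rw [x10]
    exact (hb1 hκ).imp_left Eq.symm
  by_cases hk : m1.reg 4 = 0
  · refine ⟨1 + 1 + 1 + 1, by omega, Good.iteTrue (by rw [x15]; omega) (Good.iteFalse
      (by rw [x4, hk]) (Good.of_step (c' := (_, m2)) rfl (Good.answer hr x3 ?_)))⟩
    rw [x10]
    exact (hb2 hk).imp_left Eq.symm
  obtain ⟨m3, a3, ha3, he3, k3⟩ := mulConst_spec (x := 16) (y := 1) (by norm_num) d m2
  have f3 : ∀ i, i ≠ 16 → m3.reg i = m2.reg i := fun i hi =>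
    he3.frame.reg i (fun h => hi (mulConst_writesReg h))
  have g3 : ∀ a, m3.arr a = m1.arr a := fun a => he3.frame.arr a mulConst_writesArr
  have k16 : m3.reg 16 = d * κ := by rw [k3]; simp [hm2, e1]
  set m4 := m3.setReg 16 (m1.reg 4 - d * κ) with hm4
  have hstep : step noOracle (.sub 16 4 16 :: (.ite 16 (.const 10 0)
      (setup C ;; simulate p ;; checkTree q D E)) :: [.add 0 10 3], m3) =
      PMF.pure ((.ite 16 (.const 10 0) (setup C ;; simulate p ;; checkTree q D E)) ::
        [.add 0 10 3], m4) := by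
    simp only [step, hm4, k16]
    rw [f3 4 (by norm_num), x4]
  have x16 : m4.reg 16 = m1.reg 4 - d * κ := by simp [hm4]
  suffices hmain : ∃ t, t ≤ T - (25 * n ^ 2 + 10 * n + 70 + 2 * d) ∧ Good noOracle t
      (.ite 16 (.const 10 0) (setup C ;; simulate p ;; checkTree q D E) ::
        [.add 0 10 3], m4) (fun m' => m'.reg 0 = b) r by
    obtain ⟨t, ht, hg⟩ := hmain
    refine ⟨t + 1 + 1 + a3 + 1 + 1 + 1, by omega, Good.iteTrue (by rw [x15]; omega) (Good.iteTrue
      (by rw [x4]; exact hk) (Good.seq (he3.good (Good.seq (Good.of_step hstep hg)))))⟩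
  by_cases hdk : d * κ < m1.reg 4
  · refine ⟨1 + 1 + 1, by omega, Good.iteTrue (by rw [x16]; omega) (Good.of_step
      (c' := (_, m4.setReg 10 0)) rfl (Good.answer hr ?_ ?_))⟩
    · simp [hm4, f3, x3]
    · simpa using (hb3 hdk).imp_left Eq.symm
  have y : ∀ i, i ≠ 10 → i ≠ 15 → i ≠ 16 → m4.reg i = m1.reg i := fun i ha hb hc => by
    simp [hm4, hc, f3, hm2, ha, hb]
  obtain ⟨m0, a0, ha0, he0, k5, k6, k7, k9, k8, k40, k41⟩ := setup_spec C (m := m4)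
    (by rw [y 2 (by norm_num) (by norm_num) (by norm_num), e2])
    (by rw [y 3 (by norm_num) (by norm_num) (by norm_num), e3])
  have f0 : ∀ i, i < 5 ∨ 18 ≤ i → i ≠ 40 → i ≠ 41 → m0.reg i = m1.reg i := fun i hi ha hb =>
    (he0.frame.reg i (fun h => by have := setup_writesReg h; omega)).trans
      (y i (by omega) (by omega) (by omega))
  have g0 : ∀ a, m0.arr a = m1.arr a := fun a => (he0.frame.arr a setup_writesArr).trans (g3 a)
  rw [y 0 (by norm_num) (by norm_num) (by norm_num), y 1 (by norm_num) (by norm_num) (by norm_num),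
    y 4 (by norm_num) (by norm_num) (by norm_num), e0, e1] at ha0
  rw [y 0 (by norm_num) (by norm_num) (by norm_num), e0] at k5 k6
  rw [y 0 (by norm_num) (by norm_num) (by norm_num), y 1 (by norm_num) (by norm_num) (by norm_num),
    y 4 (by norm_num) (by norm_num) (by norm_num), e0, e1] at k7
  rw [y 0 (by norm_num) (by norm_num) (by norm_num),
    y 4 (by norm_num) (by norm_num) (by norm_num), e0] at k9
  have w0 := f0 0 (by norm_num) (by norm_num) (by norm_num)
  have w2 := f0 2 (by norm_num) (by norm_num) (by norm_num)
  have w3 := f0 3 (by norm_num) (by norm_num) (by norm_num)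
  have w4 := f0 4 (by norm_num) (by norm_num) (by norm_num)
  rw [e0] at w0
  rw [e2] at w2
  rw [e3] at w3
  have hl : 0 < C * n := Nat.mul_pos hC hn
  have hlk : 0 < C * n * m1.reg 4 := Nat.mul_pos hl (Nat.pos_of_ne_zero hk)
  have h98 : m0.reg 9 = m0.reg 8 + 1 := by omega
  have hR : Ready m0 := by
    refine ⟨w2, w3, by omega, by omega, by rw [k6, k5, w0], ?_, ?_⟩
    · rw [w4, w0, g0, g0]
      exact fun e he => ⟨(hL.sound e he).1, (hL.sound e he).2.1⟩
    · rw [← h98, k9, k5, w4, Nat.mul_assoc]; ring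
  obtain ⟨hh, hp, hTt⟩ := hbig (by omega) (by omega) (by omega) m0 hR w0 w4 k5 k6 k7 h98
    (g0 1) (g0 2)
  refine ⟨(2 + checkCost q D E m0 + stepCost m0 * τ) + 1 + a0 + 1 + 1, by omega,
    Good.iteFalse (by rw [x16]; omega) (Good.seq (he0.good (Good.seq ?_)))⟩
  refine Good.weaken (simulate_good hR _ (fun _ => rfl) ?_ τ [p] _ m0 ?_ hh) hp
  · intro ml mh hrep
    refine Good.mono (t := 1 + checkCost q D E m0) ?_ (by omega)
    refine (checkTree_spec (q := q) (D := D) (E := E) hq hR hrep.low hrep.fst hrep.snd h98).good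
      (fun m' hm' hf' => Good.answer ?_ ?_ ?_)
    · rw [probMem_pure]; split_ifs <;> norm_num
    · rw [hf'.reg 3, hrep.low 3 (by norm_num), w3]
      simp only [checkTree, Prog.WritesReg]
      rintro (h | h | h | h | h | h | h | h | h | h | h | h | h | h | h | h)
      all_goals first | exact h | omega | (have := mulConst_writesReg h; omega) |
        (have := parseTree_writesReg h; omega) | (have := countErrors_writesReg h; omega)
    · rw [hm', hrep.arr 0, probMem_pure]
      by_cases hA : (if Accepts q D E m0 (ml.arr 0) then 1 else 0) = b
      · exact Or.inl hA
      · right; rw [if_neg hA]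
  -- In the learner's part of memory only registers `40` and `41` have been written, with the number
  -- of variables and the size bound: this is the learner's input.
  · refine ⟨fun i => ?_, fun a => ?_, fun i hi => rfl, rfl, rfl⟩
    · simp only [learnerInput]
      by_cases hi0 : i = 0
      · subst hi0; simp [k40]
      by_cases hi1 : i = 1
      · subst hi1; simp [k41]
      rw [if_neg hi0, if_neg hi1, f0 _ (by omega) (by omega) (by omega), f _ (by omega),
        if_neg (by omega), hreg _ (by omega)]
    · rw [g0, g _ (by omega) (by omega), harr _ (by omega)]
      rfl

/-! ### The target function on sample points -/

section Target

variable {n l k N : ℕ} {U V : ℕ → ℕ}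

/-- The edges listed in two arrays. -/
def edgeSet (k : ℕ) (U V : ℕ → ℕ) : Finset (ℕ × ℕ) :=
  (Finset.range k).image (fun e => (U e, V e))

theorem mem_edgeSet {e : ℕ × ℕ} : e ∈ edgeSet k U V ↔ ∃ i < k, (U i, V i) = e := by
  simp [edgeSet]

theorem bitArray_ne_zero {x : Fin N → Bool} {j : ℕ} (h : j < N) :
    bitArray x j ≠ 0 ↔ x ⟨j, h⟩ = true := by
  cases hx : x ⟨j, h⟩ <;> simp [bitArray, h, hx]

theorem mul_add_lt {i w : ℕ} (hi : i < l) (hw : w < n) : i * n + w < l * n := by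
  have : (i + 1) * n ≤ l * n := Nat.mul_le_mul_right _ hi
  rw [Nat.add_mul] at this
  omega

theorem mul_add_mod_of_lt {i w : ℕ} (hw : w < n) : (i * n + w) % n = w := by
  rw [Nat.mul_comm, Nat.mul_add_mod, Nat.mod_eq_of_lt hw]

theorem mul_add_div_of_lt {i w : ℕ} (hw : w < n) : (i * n + w) / n = i := by
  rw [Nat.mul_comm, Nat.mul_add_div (by omega), Nat.div_eq_of_lt hw, Nat.add_zero]

open Classical in
theorem target_iff (hl : 0 < l) (hU : ∀ e < k, U e < V e ∧ V e < n) (x : Fin (l * n) → Bool) :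
    target n l k U V x = true ↔
      IsEdge (fun j => (j : ℕ) % n) (fun j => (j : ℕ) / n) (edgeSet k U V) x := by
  rw [target, decide_eq_true_eq, EdgeRec, IsEdge]
  constructor
  · rintro ⟨e, he, h1, h2⟩
    have hn : 0 < n := by have := hU e he; omega
    refine ⟨(U e, V e), mem_edgeSet.2 ⟨e, he, rfl⟩, fun j hj => ?_, fun j hj hx => ?_⟩
    · have hjl : (j : ℕ) / n < l := Nat.div_lt_of_lt_mul (j.2.trans_eq (Nat.mul_comm l n))
      have := h2 _ hjl
      have hd := Nat.div_add_mod' (j : ℕ) n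
      rcases hj with hj | hj
      · simp only at hj
        rw [← hj, hd] at this
        exact (bitArray_ne_zero j.2).1 this.1
      · simp only at hj
        rw [← hj, hd] at this
        exact (bitArray_ne_zero j.2).1 this.2
    · have hjn : (j : ℕ) < n := (Nat.div_eq_zero_iff_lt hn).1 hj
      simpa [Nat.mod_eq_of_lt hjn] using h1 j hjn ((bitArray_ne_zero j.2).2 hx)
  · rintro ⟨e, he, h1, h2⟩
    obtain ⟨i, hi, rfl⟩ := mem_edgeSet.1 he
    have := hU i hi
    refine ⟨i, hi, fun w hw hx => ?_, fun c hc => ⟨?_, ?_⟩⟩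
    · have hN : w < l * n := by simpa using mul_add_lt hl hw
      have := h2 ⟨w, hN⟩ (Nat.div_eq_of_lt hw) ((bitArray_ne_zero hN).1 hx)
      simpa [Nat.mod_eq_of_lt hw] using this
    · refine (bitArray_ne_zero (mul_add_lt hc (by omega))).2 (h1 _ (Or.inl ?_))
      exact mul_add_mod_of_lt (by omega)
    · refine (bitArray_ne_zero (mul_add_lt hc (by omega))).2 (h1 _ (Or.inr ?_))
      exact mul_add_mod_of_lt (by omega)

theorem samplePt_eq (r : ℕ) : samplePt n l k U V N r = samplePoint (fun j => (j : ℕ) % n)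
    (fun j => (j : ℕ) / n) (U (r % k), V (r % k)) (r / k % l) (r / k / l) := by
  ext j
  simp [samplePt, SampleBit, samplePoint]

theorem target_samplePoint_of_lt_two (hl : 0 < l) (hU : ∀ e < k, U e < V e ∧ V e < n)
    {e : ℕ × ℕ} (he : e ∈ edgeSet k U V) (i : ℕ) {b : ℕ} (hb : b < 2) :
    target n l k U V (N := l * n) (samplePoint (fun j => (j : ℕ) % n) (fun j => (j : ℕ) / n) e i b)
      = true := by
  rw [target_iff hl hU]
  refine ⟨e, he, fun j hj => ?_, fun j hj hx => ?_⟩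
  · have h2 : b ≠ 2 := by omega
    have h3 : b ≠ 3 := by omega
    simpa [samplePoint, h2, h3] using hj
  · simp only [samplePoint, decide_eq_true_eq] at hx
    exact hx.1

/-- Acceptance needs two distinct vertices that are `1` in layer `i`, but the erasure leaves only
one there. -/
theorem target_samplePoint_of_flip (hl : 0 < l) (hU : ∀ e < k, U e < V e ∧ V e < n)
    {e : ℕ × ℕ} (he : e ∈ edgeSet k U V) {i : ℕ} (hi : i < l) {b : ℕ} (hb : b = 2 ∨ b = 3) :
    target n l k U V (N := l * n) (samplePoint (fun j => (j : ℕ) % n) (fun j => (j : ℕ) / n) e i b)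
      = false := by
  by_contra h
  rw [Bool.not_eq_false, target_iff hl hU] at h
  obtain ⟨e', he', h1, -⟩ := h
  have hlt : ∀ e ∈ edgeSet k U V, e.1 < e.2 ∧ e.2 < n := fun e he => by
    obtain ⟨i, hi, rfl⟩ := mem_edgeSet.1 he
    exact hU i hi
  have a := hlt e he
  have a' := hlt e' he'
  have key : ∀ w < n, (w = e'.1 ∨ w = e'.2) → ∀ c < l, (w = e.1 ∨ w = e.2) ∧
      ¬ (b = 2 ∧ c = i ∧ w = e.1) ∧ ¬ (b = 3 ∧ c = i ∧ w = e.2) := by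
    intro w hw h c hc
    have := h1 ⟨c * n + w, mul_add_lt hc hw⟩ (by simpa [mul_add_mod_of_lt hw] using h)
    simpa only [samplePoint, decide_eq_true_eq, mul_add_mod_of_lt hw, mul_add_div_of_lt hw]
      using this
  have k1 := key e'.1 (by omega) (Or.inl rfl) i hi
  have k2 := key e'.2 (by omega) (Or.inr rfl) i hi
  omega

theorem sum_range_mul (a b : ℕ) (f : ℕ → ℕ) :
    ∑ r ∈ Finset.range (a * b), f r = ∑ i ∈ Finset.range a, ∑ j ∈ Finset.range b, f (i * b + j) := by
  induction a with
  | zero => simp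
  | succ a ih => rw [Nat.add_mul, Nat.one_mul, Finset.sum_range_add, ih, Finset.sum_range_succ]

theorem samplePt_mul_add {b i e : ℕ} (hi : i < l) (he : e < k) :
    samplePt n l k U V N ((b * l + i) * k + e) = samplePoint (fun j => (j : ℕ) % n)
      (fun j => (j : ℕ) / n) (U e, V e) i b := by
  rw [samplePt_eq, mul_add_mod_of_lt he, mul_add_div_of_lt he, mul_add_mod_of_lt hi,
    mul_add_div_of_lt hi]

open Classical in
/-- If the vertex covers have at least `v` elements, then a tree is large or errs at many sample
points. -/
theorem size_add_errors_ge (hN : N = l * n) (hl : 0 < l) (hU : ∀ e < k, U e < V e ∧ V e < n)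
    (hinj : ∀ e < k, ∀ e' < k, U e = U e' → V e = V e' → e = e') {v : ℕ}
    (hv : ∀ S : Finset ℕ, (∀ e < k, U e ∈ S ∨ V e ∈ S) → v ≤ S.card) (T : DTree N) :
    l * (v + k) + 1 ≤ T.size + ((Finset.range (4 * l * k)).filter (fun r =>
      T.eval (samplePt n l k U V N r) ≠ target n l k U V (samplePt n l k U V N r))).card := by
  subst hN
  set err : ℕ × ℕ → ℕ → ℕ → Prop := fun e i b =>
    T.eval (samplePoint (fun j => (j : ℕ) % n) (fun j => (j : ℕ) / n) e i b) ≠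
      target n l k U V (samplePoint (fun j => (j : ℕ) % n) (fun j => (j : ℕ) / n) e i b) with herr
  have hI : Set.InjOn (fun e => (U e, V e)) (Finset.range k : Set ℕ) := by
    intro e he e' he' h
    simp only [Finset.coe_range, Set.mem_Iio] at he he'
    simp only [Prod.mk.injEq] at h
    exact hinj e he e' he' h.1 h.2
  have hcard : (edgeSet k U V).card = k := by
    rw [edgeSet, Finset.card_image_of_injOn hI, Finset.card_range]
  have hlayer : ∀ i ∈ Finset.range l, v + k ≤ T.nodesAt (fun j => (j : ℕ) / n) i +
      ∑ e ∈ Finset.range k, ((Finset.range 4).filter (err (U e, V e) i)).card := by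
    intro i hi
    have := le_nodesAt_add_errors (vert := fun j : Fin (l * n) => (j : ℕ) % n)
      (lay := fun j => (j : ℕ) / n) i T (edgeSet k U V)
      (fun e he => by obtain ⟨i, hi, rfl⟩ := mem_edgeSet.1 he; exact (hU i hi).1)
      (target n l k U V) (fun e he b hb => target_samplePoint_of_lt_two hl hU he i hb)
      (fun e he b hb => target_samplePoint_of_flip hl hU he (Finset.mem_range.1 hi) hb) v
      (fun S hS => hv S (fun e he => hS (U e, V e) (mem_edgeSet.2 ⟨e, he, rfl⟩)))
    rw [hcard, edgeSet, Finset.sum_image hI] at this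
    convert this
  have hsum := Finset.sum_le_sum hlayer
  rw [Finset.sum_const, Finset.card_range, smul_eq_mul, Finset.sum_add_distrib] at hsum
  -- Sample numbers decompose as `(b l + i) k + e` into type, layer and edge.
  have hcount : ((Finset.range (4 * l * k)).filter (fun r =>
      T.eval (samplePt n l k U V (l * n) r) ≠
        target n l k U V (samplePt n l k U V (l * n) r))).card =
      ∑ i ∈ Finset.range l, ∑ e ∈ Finset.range k,
        ((Finset.range 4).filter (err (U e, V e) i)).card := by
    simp only [Finset.card_filter]
    rw [sum_range_mul, sum_range_mul, Finset.sum_comm]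
    refine Finset.sum_congr rfl (fun i hi => ?_)
    rw [Finset.sum_comm]
    refine Finset.sum_congr rfl (fun e he => Finset.sum_congr rfl (fun b _ => ?_))
    rw [samplePt_mul_add (Finset.mem_range.1 hi) (Finset.mem_range.1 he)]
  have := DTree.sum_nodesAt_lt_size (fun j : Fin (l * n) => (j : ℕ) / n) l T
  omega

/-- A vertex cover yields a decision tree for the target. -/
theorem exists_tree_of_cover (hN : N = l * n) (hl : 0 < l) (hU : ∀ e < k, U e < V e ∧ V e < n) (S : Finset ℕ)
    (hS : ∀ e < k, U e ∈ S ∨ V e ∈ S) (hSn : ∀ u ∈ S, u < n) :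
    ∃ T : DTree N, T.Computes (target n l k U V) ∧
      T.size ≤ S.card * l + k * (l + n) + 1 := by
  subst hN
  have hlt : ∀ e ∈ edgeSet k U V, e.1 < e.2 ∧ e.2 < n := fun e he => by
    obtain ⟨i, hi, rfl⟩ := mem_edgeSet.1 he
    exact hU i hi
  rcases Nat.eq_zero_or_pos n with rfl | hn
  · have hk : k = 0 := by
      by_contra hk
      have := hU 0 (by omega)
      omega
    subst hk
    refine ⟨.leaf false, fun x => ?_, by simp [DTree.size]⟩
    simp [DTree.eval, target, EdgeRec]
  obtain ⟨T, h1, h2⟩ := hasTreeOn_of_cover (vert := fun j : Fin (l * n) => (j : ℕ) % n)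
    (lay := fun j => (j : ℕ) / n) (n := n) (l := l) (f := target n l k U V) (edgeSet k U V)
    (edgeSet k U V) S Set.univ
    (fun j j' ha hb => by
      have h := Nat.div_add_mod (j : ℕ) n
      rw [ha, hb, Nat.div_add_mod] at h
      exact (Fin.ext h).symm)
    (fun u hu => ⟨⟨u, by simpa using mul_add_lt hl hu⟩, Nat.mod_eq_of_lt hu, Nat.div_eq_of_lt hu⟩)
    (fun j => Nat.div_lt_of_lt_mul (j.2.trans_eq (Nat.mul_comm l n)))
    (fun j => Nat.mod_lt _ hn) hlt (target_iff hl hU) subset_rfl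
    (fun e he => by obtain ⟨i, hi, rfl⟩ := mem_edgeSet.1 he; exact hS i hi) hSn
    (fun x _ hx => (target_iff hl hU x).1 hx)
  refine ⟨T, fun x => h2 x trivial, h1.trans ?_⟩
  have : (edgeSet k U V).card ≤ k := by simpa [edgeSet] using Finset.card_image_le (s := Finset.range k)
  gcongr

end Target

/-- An error bound under the uniform distribution on sample points. -/
theorem card_le_of_error_le {n l k N M q E : ℕ} {U V : ℕ → ℕ} {g f : (Fin N → Bool) → Bool}
    {ε : ℝ} (hε : 0 ≤ ε) (h : error (sampleDist n l k U V N M) g f ≤ ENNReal.ofReal ε) (hE : ε * q ≤ E)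
    (P : ℕ → Prop) [DecidablePred P]
    (hP : ∀ r, P r ↔ g (samplePt n l k U V N r) ≠ f (samplePt n l k U V N r)) :
    q * ((Finset.range (M + 1)).filter P).card ≤ E * (M + 1) := by
  classical
  rw [error, sampleDist, PMF.toOuterMeasure_map_apply, PMF.toOuterMeasure_uniformOfFintype_apply,
    Fintype.card_fin] at h
  have hc : Fintype.card ((fun r : Fin (M + 1) => samplePt n l k U V N r) ⁻¹' {x | g x ≠ f x}) =
      ((Finset.range (M + 1)).filter P).card := by
    rw [Fintype.card_subtype, Finset.card_filter, Finset.card_filter,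
      ← Fin.sum_univ_eq_sum_range (fun r => if P r then 1 else 0)]
    refine Finset.sum_congr rfl (fun r _ => ?_)
    simp [hP]
  rw [hc, ENNReal.div_le_iff (by simp) (by simp), ← ENNReal.ofReal_natCast (M + 1),
    ← ENNReal.ofReal_mul hε, ← ENNReal.ofReal_natCast, ENNReal.ofReal_le_ofReal_iff (by positivity)]
    at h
  have : (q : ℝ) * ((Finset.range (M + 1)).filter P).card ≤ E * ((M + 1 : ℕ) : ℝ) := by
    calc _ ≤ (q : ℝ) * (ε * ((M + 1 : ℕ) : ℝ)) := by gcongr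
      _ = ε * q * ((M + 1 : ℕ) : ℝ) := by ring
      _ ≤ _ := by gcongr
  exact_mod_cast this

/-! ### Graphs and edge lists -/

section Graph

variable {n κ k : ℕ} {G : SimpleGraph (Fin n)} {U V : ℕ → ℕ}

theorem vertexCoverInput_arr_ne_zero (u v : Fin n) :
    (vertexCoverInput G κ).arr 0 ((u : ℕ) * n + v) ≠ 0 ↔ G.Adj u v := by
  simp only [vertexCoverInput, true_and, ne_eq, ite_eq_right_iff, one_ne_zero, imp_false, not_not]
  constructor
  · rintro ⟨u', v', h, hA⟩
    have h1 := congrArg (· / n) h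
    have h2 := congrArg (· % n) h
    simp only [mul_add_div_of_lt v.2, mul_add_div_of_lt v'.2, mul_add_mod_of_lt v.2,
      mul_add_mod_of_lt v'.2] at h1 h2
    rwa [Fin.ext h1, Fin.ext h2]
  · exact fun h => ⟨u, v, rfl, h⟩

/-- The arrays list the edges of the graph. -/
abbrev ListsEdges (G : SimpleGraph (Fin n)) (κ k : ℕ) (U V : ℕ → ℕ) : Prop :=
  Listed n (fun u v => (vertexCoverInput G κ).arr 0 (u * n + v) ≠ 0) n 0 k U V

theorem ListsEdges.adj (H : ListsEdges G κ k U V) {e : ℕ} (he : e < k) :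
    ∃ u v : Fin n, (u : ℕ) = U e ∧ (v : ℕ) = V e ∧ G.Adj u v := by
  obtain ⟨h1, h2, h3, -⟩ := H.sound e he
  exact ⟨⟨U e, by omega⟩, ⟨V e, h2⟩, rfl, rfl, (vertexCoverInput_arr_ne_zero _ _).1 h3⟩

theorem ListsEdges.exists_of_adj (H : ListsEdges G κ k U V) {u v : Fin n} (h : G.Adj u v)
    (huv : u < v) :
    ∃ e < k, U e = u ∧ V e = v :=
  H.complete u v huv v.2 ((vertexCoverInput_arr_ne_zero u v).2 h) (Or.inl u.2)

/-- Elements of `S` that are not vertices are discarded. -/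
theorem ListsEdges.exists_isVertexCover (H : ListsEdges G κ k U V) (S : Finset ℕ)
    (hS : ∀ e < k, U e ∈ S ∨ V e ∈ S) :
    ∃ S' : Finset (Fin n), G.IsVertexCover (S' : Set (Fin n)) ∧ S'.card ≤ S.card := by
  classical
  refine ⟨Finset.univ.filter (fun u => (u : ℕ) ∈ S), ?_, ?_⟩
  · intro u v h
    simp only [Finset.coe_filter, Finset.mem_univ, true_and, Set.mem_ofPred_eq]
    rcases lt_or_gt_of_ne h.ne with huv | huv
    · obtain ⟨e, he, h1, h2⟩ := H.exists_of_adj h huv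
      rw [← h1, ← h2]
      exact hS e he
    · obtain ⟨e, he, h1, h2⟩ := H.exists_of_adj h.symm huv
      rw [← h1, ← h2]
      exact (hS e he).symm
  · refine Finset.card_le_card_of_injOn (fun u => (u : ℕ)) (fun u hu => ?_)
      (fun u _ v _ h => Fin.ext h)
    simpa using hu

/-- Each edge is charged to a pair of a cover vertex and a neighbor. The pair determines the edge,
and every cover vertex has at most `d` neighbors. -/
theorem ListsEdges.le_mul_card (H : ListsEdges G κ k U V) {d : ℕ}
    (hd : ∀ v, (G.neighborSet v).ncard ≤ d) {S : Finset (Fin n)} (hS : G.IsVertexCover (S : Set (Fin n))) : k ≤ d * S.card := by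
  classical
  have h : ∀ e : Fin k, ∃ p : Fin n × Fin n, p.1 ∈ S ∧ G.Adj p.1 p.2 ∧
      ((p.1 : ℕ) = U e ∧ (p.2 : ℕ) = V e ∨ (p.1 : ℕ) = V e ∧ (p.2 : ℕ) = U e) := by
    intro e
    obtain ⟨u, v, h1, h2, h3⟩ := H.adj e.2
    rcases hS h3 with h | h
    · exact ⟨(u, v), h, h3, Or.inl ⟨h1, h2⟩⟩
    · exact ⟨(v, u), h, h3.symm, Or.inr ⟨h2, h1⟩⟩
  choose p hp1 hp2 hp3 using h
  have hinj : Function.Injective p := by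
    intro e e' h
    have a := hp3 e
    have a' := hp3 e'
    rw [h] at a
    have b := (H.sound e e.2).1
    have b' := (H.sound e' e'.2).1
    exact Fin.ext (H.inj e e.2 e' e'.2 (by omega) (by omega))
  have hle : (Finset.univ : Finset (Fin k)).card ≤
      (S.sigma (fun u => G.neighborFinset u)).card := by
    refine Finset.card_le_card_of_injOn (fun e => ⟨(p e).1, (p e).2⟩) (fun e _ => ?_)
      (fun e _ e' _ h => hinj ?_)
    · simp only [Finset.coe_sigma, Set.mem_sigma_iff, Finset.mem_coe, SimpleGraph.mem_neighborFinset]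
      exact ⟨hp1 e, hp2 e⟩
    · simp only [Sigma.mk.injEq, heq_eq_eq] at h
      exact Prod.ext h.1 h.2
  rw [Finset.card_univ, Fintype.card_fin, Finset.card_sigma] at hle
  refine hle.trans ((Finset.sum_le_card_nsmul _ _ d (fun u _ => ?_)).trans_eq
    (by rw [smul_eq_mul, Nat.mul_comm]))
  have := hd u
  rwa [← SimpleGraph.coe_neighborFinset, Set.ncard_coe_finset] at this

end Graph

/-! ### Constants -/

/-- `D / q` and `E / q` are rational upper approximations of `1 + δ` and `ε`, fine enough to keep
the gap in `h` open. Then `C` is chosen so large that this gap outweighs the lower-order terms `D (d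
+ 1)`. -/
theorem exists_constants (d : ℕ) {δ ε δ' : ℝ} (hδ : 0 < δ) (hε : 0 < ε)
    (h : (δ + 4 * ε) * d + δ < δ') :
    ∃ q D E C : ℕ, 0 < q ∧ 1 ≤ C ∧ q ≤ D ∧ (1 + δ) * q ≤ D ∧ ε * q ≤ E ∧
      (D * (d + 1) : ℝ) ≤ C * (q * (1 + δ') - D - d * (D - q + 4 * E)) := by
  -- Rounding up `D` loses less than `1 + d` and rounding up `E` less than `4 d` (or nothing if `d =
  -- 0`).
  obtain ⟨q, hq⟩ := exists_nat_gt ((1 + 5 * d) / (δ' - ((δ + 4 * ε) * d + δ)))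
  have hgap : 0 < δ' - ((δ + 4 * ε) * d + δ) := by linarith
  rw [div_lt_iff₀ hgap] at hq
  have hq0 : (0 : ℝ) < q := by
    by_contra hq0
    have : (q : ℝ) * (δ' - ((δ + 4 * ε) * d + δ)) ≤ 0 :=
      mul_nonpos_of_nonpos_of_nonneg (not_lt.1 hq0) hgap.le
    have : (0 : ℝ) ≤ d := by positivity
    linarith
  set D := ⌈(1 + δ) * q⌉₊ with hD
  set E := ⌈ε * q⌉₊ with hE
  have hD1 : (1 + δ) * q ≤ D := Nat.le_ceil _
  have hD2 : (D : ℝ) < (1 + δ) * q + 1 := Nat.ceil_lt_add_one (by positivity)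
  have hE2 : (E : ℝ) < ε * q + 1 := Nat.ceil_lt_add_one (by positivity)
  have hX : (d : ℝ) * (D - q + 4 * E) ≤ d * (δ * q + 4 * ε * q + 5) :=
    mul_le_mul_of_nonneg_left (by linarith) (by positivity)
  have hpos : (0 : ℝ) < q * (1 + δ') - D - d * (D - q + 4 * E) := by linarith
  obtain ⟨C, hC⟩ := exists_nat_gt
    ((D * (d + 1) : ℝ) / (q * (1 + δ') - D - d * (D - q + 4 * E)))
  rw [div_lt_iff₀ hpos] at hC
  refine ⟨q, D, E, C + 1, by exact_mod_cast hq0, by omega, ?_, hD1, Nat.le_ceil _, ?_⟩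
  · have : (q : ℝ) ≤ D := by
      have : 0 < δ * q := by positivity
      linarith
    exact_mod_cast this
  · push_cast
    linarith

/-- If a tree for the learning task is small and makes few errors, then there is a small vertex
cover. -/
theorem cover_lt_of_small {d q D E C n l k κ s v z W : ℕ} {δ' : ℝ} (hq : 0 < q) (hqD : q ≤ D)
    (hC : (D * (d + 1) : ℝ) ≤ C * (q * (1 + δ') - D - d * (D - q + 4 * E))) (hn : 1 ≤ n)
    (hκ : 1 ≤ κ) (hk : k ≤ d * κ) (hl : l = C * n) (hs : s = C * n * κ + (C * n + n) * k + 1)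
    (h : l * (v + k) + 1 ≤ z + W) (hz : q * z ≤ D * s) (hW : q * W ≤ E * (4 * l * k)) :
    (v : ℝ) < (1 + δ') * κ := by
  by_contra! hv
  have h1 : q * (l * (v + k) + 1) ≤ D * s + E * (4 * l * k) := by
    calc _ ≤ q * (z + W) := Nat.mul_le_mul_left _ h
      _ = q * z + q * W := by ring
      _ ≤ _ := by gcongr
  subst hs
  have h1' : (q : ℝ) * (l * (v + k) + 1) ≤
      D * (C * n * κ + (C * n + n) * k + 1) + E * (4 * l * k) := by exact_mod_cast h1
  have hl' : (l : ℝ) = C * n := by exact_mod_cast hl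
  rw [hl'] at h1'
  have hk' : (k : ℝ) ≤ d * κ := by exact_mod_cast hk
  have hq' : (0 : ℝ) < q := by exact_mod_cast hq
  have hqD' : (q : ℝ) ≤ D := by exact_mod_cast hqD
  have hn' : (1 : ℝ) ≤ n := by exact_mod_cast hn
  have hκ' : (1 : ℝ) ≤ κ := by exact_mod_cast hκ
  have h2 : (q : ℝ) * (C * n) * ((1 + δ') * κ) ≤ q * (C * n) * v := by gcongr
  -- With a nonnegative coefficient, `k` may be replaced by its upper bound `d κ`.
  have hX : (0 : ℝ) ≤ D - q + 4 * E := by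
    have : (0 : ℝ) ≤ E := by positivity
    linarith
  have h3 : (C * n : ℝ) * (D - q + 4 * E) * k ≤ C * n * (D - q + 4 * E) * (d * κ) :=
    mul_le_mul_of_nonneg_left hk' (mul_nonneg (by positivity) hX)
  -- The terms without a factor `C`, namely `n k` and `1` in `s`, add up to at most `D (d + 1) n κ`.
  have h4 : (D * n : ℝ) * k ≤ D * n * (d * κ) := by gcongr
  have h5 : (D : ℝ) * 1 ≤ D * (n * κ) :=
    mul_le_mul_of_nonneg_left (one_le_mul_of_one_le_of_one_le hn' hκ') (by positivity)
  have h6 := mul_le_mul_of_nonneg_right hC (show (0 : ℝ) ≤ n * κ by positivity)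
  linarith

/-! ### The reduction theorem -/

/-- A constant for the time bound of the reduction. -/
def timeConst (d C q D E : ℕ) : ℕ :=
  (4 * C * d * (d * (25 + 25 * C + 30) + 106 * C + 150 + D * (C + d * (C + 1) + 1) * 40 + 80) +
    D * (C + d * (C + 1) + 1) * 50 + (10 * (q + D + E) + 100)) +
    (d * (25 + 25 * C + 30) + 106 * C + 150) + (14 * d + 2 * C + 257)

theorem time_bound {d C q D E n κ τ : ℕ} {m : Mem} (hn : 1 ≤ n) (hκ : κ ≤ n)
    (hk : m.reg 4 ≤ d * n) (h0 : m.reg 0 = n) (h5 : m.reg 5 = C * n) (h6 : m.reg 6 = C * n * n)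
    (h7 : m.reg 7 = C * n * κ + (C * n + n) * m.reg 4 + 1) (h9 : m.reg 9 = 4 * m.reg 5 * m.reg 4)
    (hτ : n ^ 2 ≤ τ) :
    25 * n ^ 2 + 10 * n + 100 + 2 * d + (2 * C + 6 * n + 6 * κ + 12 * m.reg 4 + 100) +
      checkCost q D E m + stepCost m * τ + 10 ≤ timeConst d C q D E * (n ^ 2 * τ) := by
  set k := m.reg 4 with hk4
  set y := n ^ 2 with hy
  set S := d * (25 + 25 * C + 30) + 106 * C + 150 with hS
  set Z := C + d * (C + 1) + 1 with hZ
  have hny : n ≤ y := by rw [hy]; exact Nat.le_self_pow (by norm_num) n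
  have hy1 : 1 ≤ y := hn.trans hny
  have hyy : n * n = y := by rw [hy, sq]
  have hyτ : y ≤ y * τ := Nat.le_mul_of_pos_right _ (by omega)
  -- This absorbs the `O(n⁴)` cost of the final check.
  have hyyτ : y * y ≤ y * τ := Nat.mul_le_mul_left _ hτ
  have hstep : stepCost m ≤ S * y := by
    have a : stepCost m ≤ d * n * (25 * n + 25 * (C * n) + 30 * n) + 100 * (C * y) +
        6 * (C * y) + 150 * y := by
      rw [stepCost, h0, h5, h6, ← hk4, Nat.mul_assoc C n n, hyy]
      gcongr <;> omega
    refine a.trans_eq ?_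
    rw [hS, ← hyy]
    ring
  have hs : m.reg 7 ≤ Z * y := by
    have a : m.reg 7 ≤ C * n * n + (C * n + n) * (d * n) + y := by
      rw [h7]
      gcongr
    refine a.trans_eq ?_
    rw [hZ, ← hyy]
    ring
  have hM : m.reg 9 ≤ 4 * C * d * y := by
    rw [h9, h5]
    calc 4 * (C * n) * k ≤ 4 * (C * n) * (d * n) := by gcongr
      _ = 4 * C * d * y := by rw [← hyy]; ring
  have hcheck : checkCost q D E m ≤
      (4 * C * d * (S + D * Z * 40 + 80) + D * Z * 50 + (10 * (q + D + E) + 100)) * (y * τ) := by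
    calc checkCost q D E m
      _ ≤ 4 * C * d * y * (S * y + D * (Z * y) * 40 + 80 * y) + D * (Z * y) * 50 +
          (10 * (q + D + E) + 100) := by
        rw [checkCost]
        have : 80 ≤ 80 * y := by omega
        rw [Nat.add_assoc]
        gcongr
      _ = 4 * C * d * (S + D * Z * 40 + 80) * (y * y) + D * Z * 50 * y +
          (10 * (q + D + E) + 100) * 1 := by ring
      _ ≤ 4 * C * d * (S + D * Z * 40 + 80) * (y * τ) + D * Z * 50 * (y * τ) +
          (10 * (q + D + E) + 100) * (y * τ) := by
        gcongr
        omega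
      _ = _ := by ring
  have hbase : 25 * y + 10 * n + 100 + 2 * d + (2 * C + 6 * n + 6 * κ + 12 * k + 100) + 10 ≤
      (14 * d + 2 * C + 257) * (y * τ) := by
    have a : k ≤ d * y := hk.trans (Nat.mul_le_mul_left _ hny)
    have b : d * 1 ≤ d * y := Nat.mul_le_mul_left _ hy1
    have c : C * 1 ≤ C * y := Nat.mul_le_mul_left _ hy1
    calc _ ≤ 14 * (d * y) + 2 * (C * y) + 257 * y := by omega
      _ = (14 * d + 2 * C + 257) * y := by ring
      _ ≤ _ := Nat.mul_le_mul_left _ hyτ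
  have hsim : stepCost m * τ ≤ S * (y * τ) := by
    rw [← Nat.mul_assoc]
    exact Nat.mul_le_mul_right _ hstep
  rw [timeConst, ← hS, ← hZ, Nat.add_mul, Nat.add_mul]
  omega

theorem two_thirds_le_one : (2 / 3 : ENNReal) ≤ 1 :=
  ENNReal.div_le_of_le_mul (by norm_num)

theorem probMem_mono {O : Type} {μ : PMF (Config O)} {P Q : Mem → Prop} (h : ∀ m, P m → Q m) :
    probMem μ P ≤ probMem μ Q :=
  μ.toOuterMeasure.mono (fun c hc => h c.2 hc)

theorem probMem_eq_one {O : Type} {μ : PMF (Config O)} {P : Mem → Prop} (h : ∀ m, P m) :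
    probMem μ P = 1 :=
  (PMF.toOuterMeasure_apply_eq_one_iff _ _).2 (fun c _ => h c.2)

open Classical in
/-- A successful output of the learner passes the check. -/
theorem accepts_of_output {δ ε : ℝ} {q D E : ℕ} (hε : 0 ≤ ε) (hD : (1 + δ) * q ≤ D)
    (hE : ε * q ≤ E) {m m' : Mem} (h9 : m.reg 9 = m.reg 8 + 1)
    (h : ∃ T : DTree (m.reg 6), m'.HoldsTree T ∧ (T.size : ℝ) ≤ (1 + δ) * m.reg 7 ∧
      error (memDist m) T.eval (memTarget m) ≤ ENNReal.ofReal ε) :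
    Accepts q D E m (m'.arr 0) := by
  obtain ⟨T, h1, h2, h3⟩ := h
  refine ⟨T, fun i hi => by simpa using h1 i hi, ?_, ?_⟩
  · have : (q : ℝ) * T.size ≤ D * m.reg 7 := by
      calc (q : ℝ) * T.size ≤ q * ((1 + δ) * m.reg 7) := by gcongr
        _ = (1 + δ) * q * m.reg 7 := by ring
        _ ≤ _ := by gcongr
    exact_mod_cast this
  · rw [h9, numErrs]
    exact card_le_of_error_le hε h3 hE _ (fun r => Iff.rfl)

/-- The algorithm for Vertex Cover decides correctly within the time bound. -/
theorem vertexCoverProg_correct {d q D E C n κ τ b : ℕ} {δ ε δ' : ℝ} {p : Prog LearnerCall}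
    {t : ℕ → ℕ} {r : ENNReal} (hδ' : 0 < δ') (hε : 0 ≤ ε) (hq : 0 < q) (hqD : q ≤ D) (hC1 : 1 ≤ C)
    (hD : (1 + δ) * q ≤ D) (hE : ε * q ≤ E)
    (hC : (D * (d + 1) : ℝ) ≤ C * (q * (1 + δ') - D - d * (D - q + 4 * E)))
    (hp : SolvesDTLearn p (2 * d + 2) δ ε t) (ht : t (C * n ^ 2) = τ) (hτ : C * n ^ 2 ≤ τ)
    (hn : 1 ≤ n) (hκ : 1 ≤ κ) {G : SimpleGraph (Fin n)} (hd : ∀ v, (G.neighborSet v).ncard ≤ d)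
    (hb : b = 1 ∧ r = 2 / 3 ∧
        (∃ S : Finset (Fin n), G.IsVertexCover (S : Set (Fin n)) ∧ S.card ≤ κ) ∨
      b = 0 ∧ r = 2 / 3 ∧ (∀ S : Finset (Fin n), G.IsVertexCover (S : Set (Fin n)) →
        (1 + δ') * κ ≤ (S.card : ℝ)) ∨ r = 0) :
    Good noOracle (timeConst d C q D E * (n ^ 2 * τ))
      ([vertexCoverProg d C q D E p], vertexCoverInput G κ) (fun m => m.reg 0 = b) r := by
  classical
  have hr : r ≤ 1 := by
    rcases hb with ⟨-, rfl, -⟩ | ⟨-, rfl, -⟩ | rfl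
    · exact two_thirds_le_one
    · exact two_thirds_le_one
    · exact bot_le
  have hyτ : n ^ 2 ≤ τ := (Nat.le_mul_of_pos_left _ hC1).trans hτ
  have hCn : C * n * n = C * n ^ 2 := by ring
  obtain ⟨k, U, V, H, hgood⟩ := vertexCoverProg_good (d := d) (C := C) (q := q) (D := D) (E := E)
    (n := n) (κ := κ) (p := p) (m := vertexCoverInput G κ) hq hn hC1 rfl rfl
    (fun i hi => by
      have h0 : i ≠ 0 := by omega
      have h1 : i ≠ 1 := by omega
      simp [vertexCoverInput, h0, h1])
    (fun a ha => by
      have h0 : a ≠ 0 := by omega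
      simp [vertexCoverInput, h0])
  replace H : ListsEdges G κ k U V := H
  refine hgood b τ _ r hr ?_ ?_ ?_ ?_ ?_
  · intro h
    rcases hb with ⟨rfl, -⟩ | ⟨-, -, hb⟩ | hb
    · exact Or.inl rfl
    · have := hb Finset.univ (by simp)
      rw [Finset.card_univ, Fintype.card_fin] at this
      have h1 : (n : ℝ) ≤ κ := by exact_mod_cast h
      have h2 : (1 : ℝ) ≤ κ := by exact_mod_cast hκ
      have h3 : 0 < δ' * κ := by positivity
      linarith
    · exact Or.inr hb
  · rintro rfl
    rcases hb with ⟨rfl, -⟩ | ⟨-, -, hb⟩ | hb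
    · exact Or.inl rfl
    · obtain ⟨S, hS, hc⟩ := H.exists_isVertexCover ∅ (by simp)
      have h1 := hb S hS
      have h2 : (S.card : ℝ) ≤ 0 := by exact_mod_cast hc
      have h3 : (1 : ℝ) ≤ κ := by exact_mod_cast hκ
      have h4 : 0 < (1 + δ') * κ := by positivity
      linarith
    · exact Or.inr hb
  · intro h
    rcases hb with ⟨-, -, S, hS, hc⟩ | ⟨hb, -⟩ | hb
    · have := H.le_mul_card hd hS
      have := Nat.mul_le_mul_left d hc
      omega
    · exact Or.inl hb
    · exact Or.inr hb
  · have hny : n ≤ n ^ 2 := Nat.le_self_pow (by norm_num) n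
    have hy : n ^ 2 ≤ n ^ 2 * τ := Nat.le_mul_of_pos_right _ (by omega)
    calc 25 * n ^ 2 + 10 * n + 100 + 2 * d ≤ (14 * d + 2 * C + 257) * (n ^ 2) := by
          have : d * 1 ≤ d * n ^ 2 := Nat.mul_le_mul_left _ (by omega)
          have : (14 * d + 2 * C + 257) * (n ^ 2) =
            14 * (d * n ^ 2) + 2 * (C * n ^ 2) + 257 * n ^ 2 := by ring
          omega
      _ ≤ timeConst d C q D E * (n ^ 2 * τ) := by
          gcongr
          exact Nat.le_add_left _ _
  · intro hκn hk0 hkd m hR h0 h4 h5 h6 h7 h98 hU hV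
    have h6' : m.reg 6 = C * n ^ 2 := h6.trans hCn
    have hN1 : 1 ≤ m.reg 6 := by rw [h6]; exact Nat.mul_pos (Nat.mul_pos hC1 hn) hn
    -- Here `κ < n`, `k ≤ d κ` and `n ≤ l` bring `s` into the range of the learner; this determines
    -- the constant `c`.
    have hs : m.reg 7 ≤ (2 * d + 2) * m.reg 6 := by
      have a : κ + 1 ≤ n := hκn
      have b : C * n * κ + 1 ≤ C * n * n := by
        calc C * n * κ + 1 ≤ C * n * κ + C * n := by
              gcongr; exact Nat.mul_pos hC1 hn
          _ = C * n * (κ + 1) := by ring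
          _ ≤ _ := by gcongr
      have c : (C * n + n) * k ≤ 2 * d * (C * n * n) := by
        calc (C * n + n) * k ≤ (C * n + C * n) * (d * n) := by
              have : n ≤ C * n := Nat.le_mul_of_pos_left _ hC1
              have : k ≤ d * n := hkd.trans (Nat.mul_le_mul_left _ (by omega))
              gcongr
          _ = _ := by ring
      calc m.reg 7 = C * n * κ + 1 + (C * n + n) * k := by rw [h7]; ring
        _ ≤ C * n * n + 2 * d * (C * n * n) := Nat.add_le_add b c
        _ ≤ (2 * d + 2) * (C * n * n) := by rw [Nat.add_mul]; omega
        _ = _ := by rw [h6]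
    have h9 : m.reg 9 = 4 * m.reg 5 * m.reg 4 := h98.trans hR.samples
    obtain ⟨hh, hsolve⟩ := hp (m.reg 6) (m.reg 7) hN1 hs (memTarget m) (memDist m)
    rw [show t (m.reg 6) = τ by rw [h6', ht]] at hh hsolve
    refine ⟨hh, ?_, ?_⟩
    · rcases hb with ⟨rfl, rfl, S, hS, hc⟩ | ⟨rfl, rfl, hb⟩ | rfl
      · refine (hsolve ?_).trans (probMem_mono (fun m' hm' => ?_))
        · obtain ⟨T, h1, h2⟩ := exists_tree_of_cover hR.vars hR.layers hR.lt
            (S.map Fin.valEmbedding) (fun e he => by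
              rw [hU, hV]
              obtain ⟨u, v, h1, h2, h3⟩ := H.adj (h4 ▸ he)
              rw [← h1, ← h2]
              exact (hS h3).imp (fun h => Finset.mem_map_of_mem Fin.valEmbedding h)
                (fun h => Finset.mem_map_of_mem Fin.valEmbedding h))
            (fun u hu => by
              obtain ⟨v, -, rfl⟩ := Finset.mem_map.1 hu
              rw [h0]; exact v.2)
          refine ⟨T, h1, h2.trans ?_⟩
          rw [Finset.card_map, h0, h4, h5, h7]
          have : S.card * (C * n) ≤ κ * (C * n) := Nat.mul_le_mul_right _ hc
          have e1 : κ * (C * n) = C * n * κ := Nat.mul_comm _ _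
          have e2 : k * (C * n + n) = (C * n + n) * k := Nat.mul_comm _ _
          omega
        · exact if_pos (accepts_of_output hε hD hE h98 hm')
      -- In the No case no tree at all passes the check, so nothing about the learner's success is
      -- used.
      · rw [probMem_eq_one]
        · exact two_thirds_le_one
        · intro m'
          refine if_neg ?_
          rintro ⟨T, -, hz, hW⟩
          have hlow := size_add_errors_ge hR.vars hR.layers hR.lt
            (fun e he e' he' => by
              rw [hU, hV]; exact H.inj e (h4 ▸ he) e' (h4 ▸ he'))
            (v := ⌈(1 + δ') * κ⌉₊) (fun S hS => by
              rw [hU, hV] at hS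
              obtain ⟨S', h1, h2⟩ := H.exists_isVertexCover S (fun e he => hS e (h4 ▸ he))
              exact (Nat.ceil_le.2 (hb S' h1)).trans h2) T
          refine (cover_lt_of_small hq hqD hC hn hκ (h4.le.trans hkd) h5 (by rw [h4]; exact h7) hlow
            hz ?_).not_ge (Nat.le_ceil _)
          rw [h9] at hW
          convert hW using 2
          rw [numErrs]
          congr
      · exact bot_le
    · rw [← h4]
      exact time_bound hn hκn.le (h4.le.trans (hkd.trans (Nat.mul_le_mul_left _ (by omega)))) h0 h5 h6
        (by rw [h4]; exact h7) h9 hyτ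

end DTLearning

theorem mainTheorem5 (d : ℕ) :
    ∃ c : ℕ, ∀ δ ε δ' : ℝ, 0 < δ → 0 < ε → ε < 1 → (δ + 4 * ε) * d + δ < δ' →
      ∃ C : ℕ, ∀ t : ℕ → ℝ → ℕ, (∀ n, n ≤ t n (1 / ε)) →
        (∃ p : DTLearning.Prog DTLearning.LearnerCall,
          DTLearning.SolvesDTLearn p c δ ε (fun n => t n (1 / ε))) →
        DTLearning.ApproximatesVertexCover d (1 + δ')
          (fun n => n ^ 2 * t (C * n ^ 2) (1 / ε)) ∧
        ((∀ a : ℕ, ∃ b : ℕ, ∀ n, t (a * n) (1 / ε) ≤ b * t n (1 / ε)) →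
          DTLearning.ApproximatesVertexCover d (1 + δ')
            (fun n => n ^ 2 * t (n ^ 2) (1 / ε))) := by
  refine ⟨2 * d + 2, fun δ ε δ' hδ hε _ h => ?_⟩
  have hδ' : 0 < δ' := by
    have : 0 ≤ (δ + 4 * ε) * d := by positivity
    linarith
  obtain ⟨q, D, E, C, hq, hC1, hqD, hD, hE, hC⟩ := DTLearning.exists_constants d hδ hε h
  refine ⟨C, fun t ht ⟨p, hp⟩ => ?_⟩
  have main := fun {n κ b : ℕ} {r : ENNReal} {G : SimpleGraph (Fin n)} (hn : 1 ≤ n) (hκ : 1 ≤ κ)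
    (hd : ∀ v, (G.neighborSet v).ncard ≤ d) => DTLearning.vertexCoverProg_correct (b := b) (r := r)
      hδ' hε.le hq hqD hC1 hD hE hC hp (τ := t (C * n ^ 2) (1 / ε)) rfl (ht _) hn hκ hd
  refine ⟨⟨DTLearning.vertexCoverProg d C q D E p, DTLearning.timeConst d C q D E,
    -- Halting on inputs outside the promise comes from the trivial instance `r = 0`.
    fun n hn G hd κ hκ => ⟨(main (b := 0) hn hκ hd (Or.inr (Or.inr rfl))).halted,
      fun hS => (main hn hκ hd (Or.inl ⟨rfl, rfl, hS⟩)).prob,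
      fun hS => (main hn hκ hd (Or.inr (Or.inl ⟨rfl, rfl, hS⟩))).prob⟩⟩, fun hlin => ?_⟩
  obtain ⟨a, ha⟩ := hlin C
  have hle : ∀ n, DTLearning.timeConst d C q D E * (n ^ 2 * t (C * n ^ 2) (1 / ε)) ≤
      DTLearning.timeConst d C q D E * a * (n ^ 2 * t (n ^ 2) (1 / ε)) := fun n => by
    calc _ ≤ DTLearning.timeConst d C q D E * (n ^ 2 * (a * t (n ^ 2) (1 / ε))) := by
          gcongr
          exact ha _
      _ = _ := by ring
  exact ⟨DTLearning.vertexCoverProg d C q D E p, DTLearning.timeConst d C q D E * a,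
    fun n hn G hd κ hκ => ⟨((main (b := 0) hn hκ hd (Or.inr (Or.inr rfl))).mono (hle n)).halted,
      fun hS => ((main hn hκ hd (Or.inl ⟨rfl, rfl, hS⟩)).mono (hle n)).prob,
      fun hS => ((main hn hκ hd (Or.inr (Or.inl ⟨rfl, rfl, hS⟩))).mono (hle n)).prob⟩⟩
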